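/- Let $\ell>0$. In $L^2(\mathbb R)$ consider the formal expression $M_{i\ell}=-\partial_x^2-\ell^2e^{2x}$ with maximal domain $$\mathcal D(M^{\max}_{i\ell})=\{\Xi\in L^2(\mathbb R)\cap AC^1(\mathbb R)\;:\;-\Xi''-\ell^2e^{2x}\Xi\in L^2(\mathbb R)\},$$ where $AC^1(\mathbb R)$ denotes the differentiable functions whose derivative is locally absolutely continuous. For functions $\Phi,\Xi$ of $x$ write $\mathcal W(\Phi,\Xi)(x)=\Phi(x)\Xi'(x)-\Phi'(x)\Xi(x)$. Let $J_m$ be the Bessel function and $H_m^{+}=H_m^{(1)}$, $H_m^-=H_m^{(2)}$ the Hankel functions; in particular $H^\pm_{1/2}(r)=\mp i\,(2/(\pi r))^{1/2}e^{\pm ir}$. Let $M^0_{i\ell}$ and $M^\infty_{i\ell}$ be the restrictions of the maximal operator to $$\mathcal D(M^0_{i\ell})=\Big\{\Xi\in\mathcal D(M^{\max}_{i\ell}):\lim_{x\to+\infty}\mathcal W\big(H^+_{1/2}(\ell e^{\,\cdot}),\Xi\big)(x)=0\Big\},$$ $$\mathcal D(M^\infty_{i\ell})=\Big\{\Xi\in\mathcal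 D(M^{\max}_{i\ell}):\lim_{x\to+\infty}\mathcal W\big(H^-_{1/2}(\ell e^{\,\cdot}),\Xi\big)(x)=0\Big\}.$$ Then: 1. $M^0_{i\ell}$ and $M^\infty_{i\ell}$ are two distinct closed operators; their domains contain $C_c^\infty(\mathbb R)$, on which they are given by $-\partial_x^2-\ell^2e^{2x}$. 2. $\sigma(M^0_{i\ell})=\sigma(M^\infty_{i\ell})=[0,\infty[$ and $\sigma_{\rm p}(M^0_{i\ell})=\sigma_{\rm p}(M^\infty_{i\ell})=\emptyset$. 3. For every $m\in\mathbb C$ with $\operatorname{Re}m>0$, the bounded inverses $(M^0_{i\ell}+m^2)^{-1}$ and $(M^\infty_{i\ell}+m^2)^{-1}$ exist and have the integral kernels $$(M^0_{i\ell}+m^2)^{-1}(x,y)=\frac{\pi i}{2}\,J_m\big(\ell e^{\min(x,y)}\big)\,H^+_m\big(\ell e^{\max(x,y)}\big),$$ $$(M^\infty_{i\ell}+m^2)^{-1}(x,y)=-\frac{\pi i}{2}\,J_m\big(\ell e^{\min(x,y)}\big)\,H^-_m\big(\ell e^{\max(x,y)}\big).$$ -/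

import Mathlib

open MeasureTheory Filter Topology Set
open scoped ContDiff ENNReal

noncomputable section

namespace NegExp

/-! ### Bessel, Macdonald and Hankel functions -/

/-- The Bessel function `J_m(r) = (r/2)^m ∑ (-r²/4)^n / (n! Γ(m+1+n))`, for `r > 0` and `m ∈ ℂ`,
written with the regularized hypergeometric function `₀𝐅₁(m+1; -r²/4)`. -/
def besselJ (m : ℂ) (r : ℝ) : ℂ :=
  ((r : ℂ) / 2) ^ m * Complex.regularizedHGFun 0 {m + 1} (-((r : ℂ) ^ 2 / 4))

/-- The function `₂F₀(a, b; -; w)` for `Re a > 0` and `w ∉ [0, ∞[`, given by its Laplace integral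
`Γ(a)⁻¹ ∫₀^∞ e^{-t} t^{a-1} (1 - w t)^{-b} dt`. -/
def hyp2F0 (a b w : ℂ) : ℂ :=
  (Complex.Gamma a)⁻¹ *
    ∫ t in Ioi (0 : ℝ), Complex.exp (-(t : ℂ)) * (t : ℂ) ^ (a - 1) * (1 - w * (t : ℂ)) ^ (-b)

/-- The Macdonald function
`K_m(z) = √(π/(2z)) e^{-z} ₂F₀(1/2 + m, 1/2 - m; -; -1/(2z))`, for `|arg z| < π` and
`Re m > -1/2`. -/
def macdonaldK (m z : ℂ) : ℂ :=
  ((Real.pi : ℂ) / (2 * z)) ^ (1 / 2 : ℂ) * Complex.exp (-z) *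
    hyp2F0 (1 / 2 + m) (1 / 2 - m) (-1 / (2 * z))

/-- The Hankel function `H_m^+ = H_m^{(1)}`:
`H_m^+(r) = (2/π) e^{-iπ(m+1)/2} K_m(e^{-iπ/2} r)` for `r > 0`. -/
def hankelPlus (m : ℂ) (r : ℝ) : ℂ :=
  2 / (Real.pi : ℂ) * Complex.exp (-(Complex.I * Real.pi / 2 * (m + 1))) *
    macdonaldK m (-Complex.I * r)

/-- The Hankel function `H_m^- = H_m^{(2)}`:
`H_m^-(r) = (2/π) e^{iπ(m+1)/2} K_m(e^{iπ/2} r)` for `r > 0`. -/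
def hankelMinus (m : ℂ) (r : ℝ) : ℂ :=
  2 / (Real.pi : ℂ) * Complex.exp (Complex.I * Real.pi / 2 * (m + 1)) *
    macdonaldK m (Complex.I * r)

/-! ### The differential expression and the maximal operator -/

/-- The Hilbert space `L²(ℝ)`. -/
abbrev L2R : Type := Lp ℂ 2 (volume : Measure ℝ)

/-- `u ∈ AC¹(ℝ)`: `u` is differentiable and `u'` is absolutely continuous on every compact
interval. -/
def IsAC1 (u : ℝ → ℂ) : Prop :=
  Differentiable ℝ u ∧ ∀ a b : ℝ, AbsolutelyContinuousOnInterval (deriv u) a b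

/-- The formal expression `-u'' - ℓ² e^{2x} u`. -/
def formalOp (ℓ : ℝ) (u : ℝ → ℂ) (x : ℝ) : ℂ :=
  -deriv (deriv u) x - ((ℓ ^ 2 * Real.exp (2 * x) : ℝ) : ℂ) * u x

/-- The Wronskian `W(Φ, Ξ)(x) = Φ(x) Ξ'(x) - Φ'(x) Ξ(x)`. -/
def wronskian (Φ Ξ : ℝ → ℂ) (x : ℝ) : ℂ :=
  Φ x * deriv Ξ x - deriv Φ x * Ξ x

theorem IsAC1.add {u v : ℝ → ℂ} (hu : IsAC1 u) (hv : IsAC1 v) : IsAC1 (u + v) := by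
  refine ⟨hu.1.add hv.1, fun a b => ?_⟩
  have h : deriv (u + v) = deriv u + deriv v := by
    funext x; exact deriv_add (hu.1 x) (hv.1 x)
  rw [h]; exact (hu.2 a b).add (hv.2 a b)

theorem deriv_const_smul_fun (c : ℂ) (u : ℝ → ℂ) : deriv (c • u) = c • deriv u := by
  funext x; exact deriv_const_smul_field c u

theorem IsAC1.smul {u : ℝ → ℂ} (c : ℂ) (hu : IsAC1 u) : IsAC1 (c • u) := by
  refine ⟨hu.1.const_smul c, fun a b => ?_⟩
  rw [deriv_const_smul_fun]
  exact (hu.2 a b).const_smul c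

theorem isAC1_zero : IsAC1 0 := by
  have h : IsAC1 ((0 : ℂ) • fun x : ℝ => (x : ℂ)) := by
    have h0 : ((0 : ℂ) • fun x : ℝ => (x : ℂ)) = fun _ => (0 : ℂ) := by
      funext x; simp
    rw [h0]
    refine ⟨differentiable_const 0, fun a b => ?_⟩
    have h1 : deriv (fun _ : ℝ => (0 : ℂ)) = fun _ => 0 := by
      funext x; exact deriv_const x 0
    rw [h1]
    exact (contDiff_const.contDiffOn (n := 1)).absolutelyContinuousOnInterval
  simpa using h

theorem IsAC1.ae_differentiableAt {u : ℝ → ℂ} (hu : IsAC1 u) :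
    ∀ᵐ x : ℝ, DifferentiableAt ℝ (deriv u) x := by
  have h : LocallyBoundedVariationOn (deriv u) univ := by
    intro a b _ _
    rcases le_total a b with hab | hab
    · have := (hu.2 a b).boundedVariationOn
      rw [uIcc_of_le hab] at this
      rwa [univ_inter]
    · rw [univ_inter]
      rw [BoundedVariationOn, eVariationOn.subsingleton _ (subsingleton_Icc_of_ge hab)]
      exact ENNReal.zero_ne_top
  exact h.ae_differentiableAt

/-- Two continuous representatives of the same class agree. -/
theorem IsAC1.eq_of_ae {u v : ℝ → ℂ} (hu : IsAC1 u) (hv : IsAC1 v) (h : u =ᵐ[volume] v) :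
    u = v :=
  (Continuous.ae_eq_iff_eq volume hu.1.continuous hv.1.continuous).1 h

theorem formalOp_add (ℓ : ℝ) {u v : ℝ → ℂ} (hu : IsAC1 u) (hv : IsAC1 v) :
    formalOp ℓ (u + v) =ᵐ[volume] formalOp ℓ u + formalOp ℓ v := by
  have h : deriv (u + v) = deriv u + deriv v := by
    funext x; exact deriv_add (hu.1 x) (hv.1 x)
  filter_upwards [hu.ae_differentiableAt, hv.ae_differentiableAt] with x h1 h2
  simp only [formalOp, h, Pi.add_apply]
  rw [deriv_add h1 h2]
  ring

theorem formalOp_smul (ℓ : ℝ) (c : ℂ) (u : ℝ → ℂ) :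
    formalOp ℓ (c • u) = c • formalOp ℓ u := by
  funext x
  simp only [formalOp, deriv_const_smul_fun, Pi.smul_apply, smul_eq_mul]
  ring

theorem formalOp_zero (ℓ : ℝ) : formalOp ℓ 0 = 0 := by
  have := formalOp_smul ℓ 0 0
  simpa using this

/-- `u` is the `AC¹` representative of `f`, and `-u'' - ℓ² e^{2x} u` is square integrable. -/
def IsMaxRep (ℓ : ℝ) (f : L2R) (u : ℝ → ℂ) : Prop :=
  IsAC1 u ∧ f =ᵐ[volume] u ∧ MemLp (formalOp ℓ u) 2 volume

theorem IsMaxRep.add {ℓ : ℝ} {f g : L2R} {u v : ℝ → ℂ} (hf : IsMaxRep ℓ f u)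
    (hg : IsMaxRep ℓ g v) : IsMaxRep ℓ (f + g) (u + v) :=
  ⟨hf.1.add hg.1, (Lp.coeFn_add f g).trans (hf.2.1.add hg.2.1),
    (hf.2.2.add hg.2.2).ae_eq (formalOp_add ℓ hf.1 hg.1).symm⟩

theorem IsMaxRep.smul {ℓ : ℝ} {f : L2R} {u : ℝ → ℂ} (c : ℂ) (hf : IsMaxRep ℓ f u) :
    IsMaxRep ℓ (c • f) (c • u) :=
  ⟨hf.1.smul c, (Lp.coeFn_smul c f).trans (hf.2.1.const_smul c), by
    rw [formalOp_smul]; exact hf.2.2.const_smul c⟩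

theorem IsMaxRep.unique {ℓ : ℝ} {f : L2R} {u v : ℝ → ℂ} (hu : IsMaxRep ℓ f u)
    (hv : IsMaxRep ℓ f v) : u = v :=
  hu.1.eq_of_ae hv.1 (hu.2.1.symm.trans hv.2.1)

/-- The maximal domain `{f ∈ L²(ℝ) ∩ AC¹(ℝ) | -f'' - ℓ² e^{2x} f ∈ L²(ℝ)}`. -/
def maxDomain (ℓ : ℝ) : Submodule ℂ L2R where
  carrier := {f | ∃ u, IsMaxRep ℓ f u}
  add_mem' := by
    rintro f g ⟨u, hu⟩ ⟨v, hv⟩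
    exact ⟨u + v, hu.add hv⟩
  zero_mem' := ⟨0, isAC1_zero, Lp.coeFn_zero ℂ 2 volume, by rw [formalOp_zero]; exact MemLp.zero⟩
  smul_mem' := by
    rintro c f ⟨u, hu⟩
    exact ⟨c • u, hu.smul c⟩

/-- The `AC¹` representative of an element of the maximal domain. -/
def maxRep {ℓ : ℝ} (f : maxDomain ℓ) : ℝ → ℂ := Classical.choose f.2

theorem maxRep_spec {ℓ : ℝ} (f : maxDomain ℓ) : IsMaxRep ℓ (f : L2R) (maxRep f) :=
  Classical.choose_spec f.2

/-- The maximal operator of `-∂² - ℓ² e^{2x}` in `L²(ℝ)`. -/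
def maxOp (ℓ : ℝ) : L2R →ₗ.[ℂ] L2R where
  domain := maxDomain ℓ
  toFun :=
    { toFun := fun f => (maxRep_spec f).2.2.toLp (formalOp ℓ (maxRep f))
      map_add' := by
        intro f g
        have h : maxRep (f + g) = maxRep f + maxRep g :=
          (maxRep_spec (f + g)).unique ((maxRep_spec f).add (maxRep_spec g))
        rw [← MemLp.toLp_add]
        refine (MemLp.toLp_eq_toLp_iff _ _).2 ?_
        rw [h]
        exact formalOp_add ℓ (maxRep_spec f).1 (maxRep_spec g).1
      map_smul' := by
        intro c f
        have h : maxRep (c • f) = c • maxRep f :=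
          (maxRep_spec (c • f)).unique ((maxRep_spec f).smul c)
        rw [RingHom.id_apply, ← MemLp.toLp_const_smul]
        refine (MemLp.toLp_eq_toLp_iff _ _).2 ?_
        rw [h, formalOp_smul] }

/-! ### Boundary conditions at `+∞` -/

theorem wronskian_add (Φ : ℝ → ℂ) {u v : ℝ → ℂ} (hu : IsAC1 u) (hv : IsAC1 v) :
    wronskian Φ (u + v) = fun x => wronskian Φ u x + wronskian Φ v x := by
  funext x
  simp only [wronskian, deriv_add (hu.1 x) (hv.1 x), Pi.add_apply]
  ring

theorem wronskian_smul (Φ : ℝ → ℂ) (c : ℂ) (u : ℝ → ℂ) :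
    wronskian Φ (c • u) = fun x => c * wronskian Φ u x := by
  funext x
  simp only [wronskian, deriv_const_smul_fun, Pi.smul_apply, smul_eq_mul]
  ring

/-- The domain `{Ξ ∈ D(M^max) | lim_{x → +∞} W(Φ, Ξ)(x) = 0}`. -/
def bcDomain (ℓ : ℝ) (Φ : ℝ → ℂ) : Submodule ℂ L2R where
  carrier := {f | ∃ u, IsMaxRep ℓ f u ∧ Tendsto (wronskian Φ u) atTop (𝓝 0)}
  add_mem' := by
    rintro f g ⟨u, hu, hu'⟩ ⟨v, hv, hv'⟩
    refine ⟨u + v, hu.add hv, ?_⟩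
    rw [wronskian_add Φ hu.1 hv.1]
    simpa using hu'.add hv'
  zero_mem' := by
    refine ⟨0, ⟨isAC1_zero, Lp.coeFn_zero ℂ 2 volume, by rw [formalOp_zero]; exact MemLp.zero⟩, ?_⟩
    have h := wronskian_smul Φ 0 0
    simp only [zero_smul, zero_mul] at h
    rw [h]; exact tendsto_const_nhds
  smul_mem' := by
    rintro c f ⟨u, hu, hu'⟩
    refine ⟨c • u, hu.smul c, ?_⟩
    rw [wronskian_smul]
    simpa using hu'.const_mul c

/-- The restriction of the maximal operator by the boundary condition at `+∞` set by `Φ`. -/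
def bcOp (ℓ : ℝ) (Φ : ℝ → ℂ) : L2R →ₗ.[ℂ] L2R := (maxOp ℓ).domRestrict (bcDomain ℓ Φ)

/-- `M^0_{iℓ}`: the boundary condition at `+∞` is set by `H^+_{1/2}(ℓ e^x)`. -/
def opZero (ℓ : ℝ) : L2R →ₗ.[ℂ] L2R :=
  bcOp ℓ (fun x => hankelPlus (1 / 2) (ℓ * Real.exp x))

/-- `M^∞_{iℓ}`: the boundary condition at `+∞` is set by `H^-_{1/2}(ℓ e^x)`. -/
def opInfty (ℓ : ℝ) : L2R →ₗ.[ℂ] L2R :=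
  bcOp ℓ (fun x => hankelMinus (1 / 2) (ℓ * Real.exp x))

/-- `A` is a closed realization of `-∂² - ℓ² e^{2x}`: it is closed, it is a restriction of the
maximal operator, and on `C_c^∞(ℝ)` it is defined and given by the formal expression. -/
structure IsClosedRealization (ℓ : ℝ) (A : L2R →ₗ.[ℂ] L2R) : Prop where
  isClosed : A.IsClosed
  le_max : A ≤ maxOp ℓ
  on_test : ∀ φ : ℝ → ℂ, ContDiff ℝ ∞ φ → HasCompactSupport φ →
    ∃ f : A.domain, (f : L2R) =ᵐ[volume] φ ∧ A f =ᵐ[volume] formalOp ℓ φ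

/-! ### Resolvent, spectrum and point spectrum of an unbounded operator -/

/-- The bounded operator `R` is the inverse `(A - z)⁻¹`. -/
def IsResolventAt (A : L2R →ₗ.[ℂ] L2R) (z : ℂ) (R : L2R →L[ℂ] L2R) : Prop :=
  (∀ g : L2R, ∃ f : A.domain, (f : L2R) = R g ∧ A f - z • (f : L2R) = g) ∧
    ∀ f : A.domain, R (A f - z • (f : L2R)) = f

/-- The spectrum: the set of `z` such that `A - z` has no bounded everywhere defined inverse. -/
def opSpectrum (A : L2R →ₗ.[ℂ] L2R) : Set ℂ :=
  {z | ¬ ∃ R : L2R →L[ℂ] L2R, IsResolventAt A z R}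

/-- The point spectrum: the set of eigenvalues. -/
def opPointSpectrum (A : L2R →ₗ.[ℂ] L2R) : Set ℂ :=
  {z | ∃ f : A.domain, (f : L2R) ≠ 0 ∧ A f = z • (f : L2R)}

/-- The bounded operator `R` has the integral kernel `k`: for every `g ∈ L²(ℝ)` and almost every
`x`, the function `y ↦ k(x, y) g(y)` is integrable and its integral is `(R g)(x)`. -/
def HasIntegralKernel (R : L2R →L[ℂ] L2R) (k : ℝ → ℝ → ℂ) : Prop :=
  ∀ g : L2R, ∀ᵐ x : ℝ, Integrable (fun y => k x y * g y) volume ∧ R g x = ∫ y, k x y * g y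

end NegExp

end

/-!
The equation `-u'' - ℓ² e^{2x} u = -m² u` becomes Bessel's equation in the variable `r = ℓ e^x`, and
the proof works with two explicit solutions of it. The solution `J_m(ℓ e^x)` behaves like `e^{mx}`
at `-∞`. With `η = ∓i`, the Hankel functions `H_m^±(ℓ e^x)` are constant multiples of
`K_m(η ℓ e^x)`, the Macdonald function on the imaginary axis (`macdonaldExp`); its Laplace integral
`∫ e^{-t} t^{m-1/2} (z + t/2)^{m-1/2} dt` gives the differential equation, by integration by parts,
the behaviour `e^{-mx}` at `-∞`, and the boundary condition at `+∞`. For `m = 1/2` it reduces to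
`boundaryFun η`, that is `e^{-x/2} e^{-η ℓ e^x}`, so that the two operators are the operators `bcOp`
with the boundary functions `boundaryFun (-i)` and `boundaryFun i`. The duplication formula for the
Gamma function shows that the Wronskian of the two solutions is `-1`
(`isWeylPair_bessel_macdonald`).

Resolvent. An energy estimate shows that all solutions are `O(e^{-x/2})` at `+∞`
(`IsSolution.exists_bound_atTop`). Hence for `Re m > 0` the kernel `j(min(x, y)) h(max(x, y))` is
bounded by a multiple of `e^{-a|x - y|}` and defines a bounded operator `R`, by Schur's test.
Variation of constants shows that `R g` lies in the domain and that `(A + m²) R g = g`. The operator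
`A + m²` is injective: an eigenfunction is a multiple of `j` because of its decay at `-∞`, and `j`
violates the boundary condition at `+∞`, by a Plücker relation between the Wronskians with
`boundaryFun (±η)` (`IsWeylPair.not_tendsto_left`). An operator with a bounded inverse is closed.
Every `z ∉ [0, ∞[` is of the form `-m²` with `Re m > 0`.

Points `k²` of `[0, ∞[`. A square integrable solution would be a multiple of `J_{ik}(ℓ e^x)`, whose
absolute value tends to a nonzero limit at `-∞` (`IsSolution.eq_zero_of_memLp`), so there are no
eigenvalues. The functions `e^{(ε + ik)x} e^{-e^x}` belong to the domain for either boundary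
condition and are approximate eigenfunctions as `ε → 0`, so `k²` is in the spectrum
(`not_isResolventAt_sq`).

The two operators differ because `boundaryFun η`, cut off at `-∞` by the factor `e^{-e^{-x}}`,
satisfies its own boundary condition but not the one of `boundaryFun (-η)`, the Wronskian of the two
being `2ηℓ` (`bcOp_boundaryFun_ne`).
-/

noncomputable section

namespace NegExp

/-! ### Absolutely continuous functions with complex values -/

theorem absolutelyContinuousOnInterval_ofReal {f : ℝ → ℝ} {a b : ℝ}
    (hf : AbsolutelyContinuousOnInterval f a b) :
    AbsolutelyContinuousOnInterval (fun x => (f x : ℂ)) a b := by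
  simpa only [AbsolutelyContinuousOnInterval, Complex.dist_of_im_eq, Complex.ofReal_im,
    Complex.ofReal_re] using! hf

theorem absolutelyContinuousOnInterval_mul {f g : ℝ → ℂ} {a b : ℝ}
    (hf : AbsolutelyContinuousOnInterval f a b) (hg : AbsolutelyContinuousOnInterval g a b) :
    AbsolutelyContinuousOnInterval (fun x => f x * g x) a b :=
  hf.smul hg

theorem absolutelyContinuousOnInterval_of_hasDerivAt {f f' : ℝ → ℂ}
    (hf : ∀ x, HasDerivAt f (f' x) x) (hf' : Continuous f') (a b : ℝ) :
    AbsolutelyContinuousOnInterval f a b := by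
  have hd : deriv f = f' := funext fun x => (hf x).deriv
  have h1 : ContDiff ℝ 1 f := by
    rw [contDiff_one_iff_deriv, hd]
    exact ⟨fun x => (hf x).differentiableAt, hf'⟩
  exact (h1.contDiffOn (n := 1)).absolutelyContinuousOnInterval

/-- A primitive of a locally integrable complex function is absolutely continuous. -/
theorem absolutelyContinuousOnInterval_primitive {f : ℝ → ℂ} (hf : LocallyIntegrable f volume)
    (c a b : ℝ) : AbsolutelyContinuousOnInterval (fun x => ∫ t in c..x, f t) a b := by
  have hi : ∀ x y : ℝ, IntervalIntegrable f volume x y := fun x y =>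
    intervalIntegrable_iff.mpr
      ((hf.integrableOn_isCompact isCompact_uIcc).mono_set uIoc_subset_uIcc)
  have key : ∀ g : ℝ → ℝ, (∀ x y : ℝ, IntervalIntegrable g volume x y) →
      AbsolutelyContinuousOnInterval (fun x => ∫ t in c..x, g t) a b := by
    intro g hg
    have hle : min (min a b) c ≤ max (max a b) c := by simp
    have h := (hg (min (min a b) c)
      (max (max a b) c)).absolutelyContinuousOnInterval_intervalIntegral (c := c) (by
        rw [uIcc_of_le hle]
        exact ⟨min_le_right _ _, le_max_right _ _⟩)
    refine h.mono ?_
    rw [uIcc_of_le hle]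
    exact Icc_subset_Icc (min_le_left _ _) (le_max_left _ _)
  have hre := absolutelyContinuousOnInterval_ofReal (key (fun t => (f t).re) fun x y =>
    ⟨(hi x y).1.re, (hi x y).2.re⟩)
  have him := absolutelyContinuousOnInterval_ofReal (key (fun t => (f t).im) fun x y =>
    ⟨(hi x y).1.im, (hi x y).2.im⟩)
  have h : AbsolutelyContinuousOnInterval (fun x => ((∫ t in c..x, (f t).re : ℝ) : ℂ) +
      Complex.I * ((∫ t in c..x, (f t).im : ℝ) : ℂ)) a b :=
    hre.add (him.const_smul Complex.I)
  have he : (fun x => ∫ t in c..x, f t) = fun x => ((∫ t in c..x, (f t).re : ℝ) : ℂ) +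
      Complex.I * ((∫ t in c..x, (f t).im : ℝ) : ℂ) := by
    funext x
    rw [← intervalIntegral.integral_ofReal, ← intervalIntegral.integral_ofReal,
      ← intervalIntegral.integral_const_mul, ← intervalIntegral.integral_add]
    · refine intervalIntegral.integral_congr fun t _ => ?_
      rw [mul_comm]
      exact (Complex.re_add_im (f t)).symm
    · exact ⟨(hi c x).1.re.ofReal, (hi c x).2.re.ofReal⟩
    · exact IntervalIntegrable.const_mul ⟨(hi c x).1.im.ofReal, (hi c x).2.im.ofReal⟩ _
  rw [he]
  exact h

/-- An absolutely continuous function whose derivative agrees almost everywhere with a continuous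
function is differentiable everywhere. -/
theorem hasDerivAt_of_ae_hasDerivAt {f w : ℝ → ℂ}
    (hf : ∀ a b, AbsolutelyContinuousOnInterval f a b) (hw : Continuous w)
    (h : ∀ᵐ x, HasDerivAt f (w x) x) (x : ℝ) : HasDerivAt f (w x) x := by
  have hp : ∀ y, HasDerivAt (fun y => ∫ t in (0 : ℝ)..y, w t) (w y) y := fun y =>
    (hw.integral_hasStrictDerivAt 0 y).hasDerivAt
  have hg : ∀ a b, AbsolutelyContinuousOnInterval (fun y => f y - ∫ t in (0 : ℝ)..y, w t) a b :=
    fun a b => (hf a b).sub (absolutelyContinuousOnInterval_of_hasDerivAt hp hw a b)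
  have hc : ∀ y, f y = f 0 + ∫ t in (0 : ℝ)..y, w t := by
    intro y
    obtain ⟨C, hC⟩ := (hg 0 y).const_of_ae_hasDerivAt_zero (by
      filter_upwards [h] with z hz _
      exact (hz.sub (hp z)).congr_deriv (sub_self _))
    have h0 := hC 0 left_mem_uIcc
    have h1 := hC y right_mem_uIcc
    simp only [intervalIntegral.integral_same, sub_zero] at h0
    rw [h0, ← h1]; ring
  rw [show f = fun y => f 0 + ∫ t in (0 : ℝ)..y, w t from funext hc]
  exact (hp x).const_add _

theorem isAC1_of_hasDerivAt {u u' u'' : ℝ → ℂ} (h : ∀ x, HasDerivAt u (u' x) x)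
    (h' : ∀ x, HasDerivAt u' (u'' x) x) (hc : Continuous u'') : IsAC1 u := by
  refine ⟨fun x => (h x).differentiableAt, fun a b => ?_⟩
  rw [show deriv u = u' from funext fun x => (h x).deriv]
  exact absolutelyContinuousOnInterval_of_hasDerivAt h' hc a b

theorem formalOp_of_hasDerivAt (ℓ : ℝ) {u u' u'' : ℝ → ℂ} (h : ∀ x, HasDerivAt u (u' x) x)
    (h' : ∀ x, HasDerivAt u' (u'' x) x) (x : ℝ) :
    formalOp ℓ u x = -u'' x - ((ℓ ^ 2 * Real.exp (2 * x) : ℝ) : ℂ) * u x := by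
  rw [formalOp, show deriv u = u' from funext fun x => (h x).deriv, (h' x).deriv]

/-! ### The boundary condition operators -/

theorem mem_bcOp_domain {ℓ : ℝ} {Φ : ℝ → ℂ} {f : L2R} :
    f ∈ (bcOp ℓ Φ).domain ↔ ∃ u, IsMaxRep ℓ f u ∧ Tendsto (wronskian Φ u) atTop (𝓝 0) := by
  constructor
  · intro h
    exact h.1
  · rintro ⟨u, hu, h⟩
    exact ⟨⟨u, hu, h⟩, ⟨u, hu⟩⟩

theorem bcOp_apply_ae {ℓ : ℝ} {Φ : ℝ → ℂ} (f : (bcOp ℓ Φ).domain) {u : ℝ → ℂ}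
    (hu : IsMaxRep ℓ (f : L2R) u) : bcOp ℓ Φ f =ᵐ[volume] formalOp ℓ u := by
  have hm : (f : L2R) ∈ maxDomain ℓ := ⟨u, hu⟩
  have h1 : bcOp ℓ Φ f = maxOp ℓ ⟨f, hm⟩ := LinearPMap.domRestrict_apply rfl
  rw [h1]
  have h2 : maxRep (⟨f, hm⟩ : maxDomain ℓ) = u := (maxRep_spec (⟨f, hm⟩ : maxDomain ℓ)).unique hu
  rw [← h2]
  exact (maxRep_spec (⟨f, hm⟩ : maxDomain ℓ)).2.2.coeFn_toLp

theorem bcOp_le_maxOp (ℓ : ℝ) (Φ : ℝ → ℂ) : bcOp ℓ Φ ≤ maxOp ℓ := LinearPMap.domRestrict_le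

/-- Multiplying the boundary function by a nonzero constant does not change the operator. -/
theorem bcOp_const_mul (ℓ : ℝ) {c : ℂ} (hc : c ≠ 0) (Φ : ℝ → ℂ) :
    bcOp ℓ (fun x => c * Φ x) = bcOp ℓ Φ := by
  have hw : ∀ u, wronskian (fun x => c * Φ x) u = fun x => c * wronskian Φ u x := by
    intro u
    funext x
    have hd : deriv (fun x => c * Φ x) x = c * deriv Φ x := deriv_const_mul_field c
    simp only [wronskian, hd]
    ring
  have hd : bcDomain ℓ (fun x => c * Φ x) = bcDomain ℓ Φ := by
    ext f
    constructor
    · rintro ⟨u, hu, h⟩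
      refine ⟨u, hu, ?_⟩
      rw [hw] at h
      simpa [hc] using h.const_mul c⁻¹
    · rintro ⟨u, hu, h⟩
      refine ⟨u, hu, ?_⟩
      rw [hw]
      simpa using h.const_mul c
  rw [bcOp, bcOp, hd]

/-- The functions in `C_c^∞(ℝ)` lie in the domain, whatever the boundary condition. -/
theorem bcOp_on_test (ℓ : ℝ) (Φ : ℝ → ℂ) (φ : ℝ → ℂ) (hφ : ContDiff ℝ ∞ φ)
    (hs : HasCompactSupport φ) :
    ∃ f : (bcOp ℓ Φ).domain, (f : L2R) =ᵐ[volume] φ ∧ bcOp ℓ Φ f =ᵐ[volume] formalOp ℓ φ := by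
  have hd1 : ContDiff ℝ ∞ (deriv φ) := hφ.deriv'
  have hd2 : ContDiff ℝ ∞ (deriv (deriv φ)) := hd1.deriv'
  have hac : IsAC1 φ := isAC1_of_hasDerivAt
    (fun x => (hφ.differentiable (by simp) x).hasDerivAt)
    (fun x => (hd1.differentiable (by simp) x).hasDerivAt) hd2.continuous
  have hm : MemLp φ 2 volume := hφ.continuous.memLp_of_hasCompactSupport hs
  have hcont : Continuous (formalOp ℓ φ) := by
    unfold formalOp
    have := hφ.continuous
    have := hd2.continuous
    fun_prop
  have hsupp : HasCompactSupport (formalOp ℓ φ) :=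
    hs.deriv.deriv.neg.sub (hs.mul_left (f := fun x => ((ℓ ^ 2 * Real.exp (2 * x) : ℝ) : ℂ)))
  have hrep : IsMaxRep ℓ (hm.toLp φ) φ :=
    ⟨hac, hm.coeFn_toLp, hcont.memLp_of_hasCompactSupport hsupp⟩
  have hW : Tendsto (wronskian Φ φ) atTop (𝓝 0) := by
    have h0 : ∀ {ψ : ℝ → ℂ}, HasCompactSupport ψ → ∀ᶠ x in atTop, ψ x = 0 := fun h =>
      (hasCompactSupport_iff_eventuallyEq.1 h).filter_mono
        (atTop_le_cocompact.trans (coclosedCompact_eq_cocompact (X := ℝ)).ge)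
    have h1 := h0 hs
    have h2 := h0 hs.deriv
    refine tendsto_const_nhds.congr' ?_
    filter_upwards [h1, h2] with x hx hx'
    simp [wronskian, hx, hx']
  exact ⟨⟨_, mem_bcOp_domain.2 ⟨φ, hrep, hW⟩⟩, hm.coeFn_toLp, bcOp_apply_ae _ hrep⟩

/-! ### Solutions of the eigenvalue equation -/

/-- `u` is a classical solution of `-u'' - ℓ² e^{2x} u = z u` with derivative `u'`. -/
def IsSolution (ℓ : ℝ) (z : ℂ) (u u' : ℝ → ℂ) : Prop :=
  ∀ x, HasDerivAt u (u' x) x ∧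
    HasDerivAt u' (-(z + ((ℓ ^ 2 * Real.exp (2 * x) : ℝ) : ℂ)) * u x) x

namespace IsSolution

variable {ℓ : ℝ} {z : ℂ} {u u' v v' : ℝ → ℂ}

theorem continuous (h : IsSolution ℓ z u u') : Continuous u :=
  continuous_iff_continuousAt.2 fun x => (h x).1.continuousAt

theorem continuous' (h : IsSolution ℓ z u u') : Continuous u' :=
  continuous_iff_continuousAt.2 fun x => (h x).2.continuousAt

theorem deriv_eq (h : IsSolution ℓ z u u') : deriv u = u' := funext fun x => (h x).1.deriv

theorem const_mul (h : IsSolution ℓ z u u') (c : ℂ) :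
    IsSolution ℓ z (fun x => c * u x) (fun x => c * u' x) := fun x =>
  ⟨(h x).1.const_mul c, ((h x).2.const_mul c).congr_deriv (by ring)⟩

/-- The Wronskian of two solutions is constant. -/
theorem wronskian_const (hu : IsSolution ℓ z u u') (hv : IsSolution ℓ z v v') (x y : ℝ) :
    u x * v' x - u' x * v x = u y * v' y - u' y * v y := by
  have hd : ∀ x, HasDerivAt (fun x => u x * v' x - u' x * v x) 0 x := by
    intro x
    exact (((hu x).1.mul (hv x).2).sub ((hu x).2.mul (hv x).1)).congr_deriv (by ring)
  exact is_const_of_deriv_eq_zero (fun x => (hd x).differentiableAt) (fun x => (hd x).deriv) x y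

theorem eq_zero_of_initial (hu : IsSolution ℓ z u u') {x₀ : ℝ} (h0 : u x₀ = 0)
    (h1 : u' x₀ = 0) (x : ℝ) : u x = 0 := by
  set M : ℝ := |x| + |x₀| + 1 with hM
  set K : ℝ := ‖z‖ + ℓ ^ 2 * Real.exp (2 * M) + 1 with hK
  have hK0 : 0 ≤ K := by positivity
  have hx : x ∈ Ioo (-M) M := by
    constructor <;> linarith [neg_abs_le x, le_abs_self x, abs_nonneg x₀]
  have hx₀ : x₀ ∈ Ioo (-M) M := by
    constructor <;> linarith [neg_abs_le x₀, le_abs_self x₀, abs_nonneg x]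
  have key := ODE_solution_unique_of_mem_Ioo (K := K.toNNReal) (s := fun _ => univ)
    (v := fun t p => ((p.2, -(z + ((ℓ ^ 2 * Real.exp (2 * t) : ℝ) : ℂ)) * p.1) : ℂ × ℂ))
    (f := fun t => (u t, u' t)) (g := fun _ => (0, 0)) (a := -M) (b := M) (t₀ := x₀)
    (by
      intro t ht
      refine LipschitzWith.lipschitzOnWith (LipschitzWith.of_dist_le_mul ?_)
      rintro ⟨p, p'⟩ ⟨r, r'⟩
      rw [Real.coe_toNNReal _ hK0]
      have hb : ‖z + ((ℓ ^ 2 * Real.exp (2 * t) : ℝ) : ℂ)‖ ≤ K := by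
        refine (norm_add_le _ _).trans ?_
        rw [Complex.norm_real, Real.norm_of_nonneg (by positivity)]
        have : ℓ ^ 2 * Real.exp (2 * t) ≤ ℓ ^ 2 * Real.exp (2 * M) := by
          gcongr
          exact ht.2.le
        linarith
      have h1 : dist p' r' ≤ K * max (dist p r) (dist p' r') := by
        have hK1 : 1 ≤ K := by
          have : 0 ≤ ‖z‖ + ℓ ^ 2 * Real.exp (2 * M) := by positivity
          linarith
        calc dist p' r' ≤ max (dist p r) (dist p' r') := le_max_right _ _
          _ ≤ _ := le_mul_of_one_le_left (dist_nonneg.trans (le_max_right _ _)) hK1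
      rw [Prod.dist_eq, Prod.dist_eq]
      refine max_le h1 ?_
      simp only [dist_eq_norm, ← mul_sub, norm_mul, norm_neg]
      gcongr
      exact le_max_left _ _)
    hx₀ (fun t _ => ⟨(hu t).1.prodMk (hu t).2, mem_univ _⟩)
    (fun t _ => ⟨(hasDerivAt_const t ((0, 0) : ℂ × ℂ)).congr_deriv
      (by simp; rfl), mem_univ _⟩)
    (by simp [h0, h1]) hx
  exact congrArg Prod.fst key

/-- Two solutions with vanishing Wronskian are proportional. -/
theorem exists_eq_mul (hu : IsSolution ℓ z u u') (hv : IsSolution ℓ z v v') {x₀ : ℝ}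
    (h0 : u x₀ ≠ 0) (hW : u x₀ * v' x₀ - u' x₀ * v x₀ = 0) : ∃ c, ∀ x, v x = c * u x := by
  refine ⟨v x₀ / u x₀, fun x => ?_⟩
  have hd : IsSolution ℓ z (fun x => v x - v x₀ / u x₀ * u x)
      (fun x => v' x - v x₀ / u x₀ * u' x) := fun x => by
    have hc := hu.const_mul (v x₀ / u x₀) x
    refine ⟨(hv x).1.sub hc.1, ?_⟩
    exact ((hv x).2.sub hc.2).congr_deriv (by ring)
  have := hd.eq_zero_of_initial (x₀ := x₀) (by field_simp; ring)
    (by field_simp; linear_combination hW) x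
  linear_combination this

end IsSolution

/-- A weak eigenfunction in `AC¹` is a classical solution. -/
theorem IsAC1.isSolution {ℓ : ℝ} {z : ℂ} {u : ℝ → ℂ} (hu : IsAC1 u)
    (h : ∀ᵐ x, formalOp ℓ u x = z * u x) : IsSolution ℓ z u (deriv u) := by
  refine fun x => ⟨(hu.1 x).hasDerivAt, ?_⟩
  refine hasDerivAt_of_ae_hasDerivAt
    (w := fun x => -(z + ((ℓ ^ 2 * Real.exp (2 * x) : ℝ) : ℂ)) * u x) hu.2 ?_ ?_ x
  · have := hu.1.continuous
    fun_prop
  · filter_upwards [h, hu.ae_differentiableAt] with y hy hy'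
    rw [formalOp] at hy
    exact hy'.hasDerivAt.congr_deriv (by linear_combination -hy)

/-- An eigenfunction of a boundary condition operator is a classical solution of the eigenvalue
equation, is square integrable, and satisfies the boundary condition. -/
theorem exists_isSolution_of_eigen {ℓ : ℝ} {Φ : ℝ → ℂ} {z : ℂ} (f : (bcOp ℓ Φ).domain)
    (hf : bcOp ℓ Φ f = z • (f : L2R)) :
    ∃ u, IsSolution ℓ z u (deriv u) ∧ MemLp u 2 volume ∧ (f : L2R) =ᵐ[volume] u ∧
      Tendsto (wronskian Φ u) atTop (𝓝 0) := by
  obtain ⟨u, hu, hW⟩ := mem_bcOp_domain.1 f.2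
  refine ⟨u, hu.1.isSolution ?_, (memLp_congr_ae hu.2.1).1 (Lp.memLp _), hu.2.1, hW⟩
  have h1 := bcOp_apply_ae f hu
  rw [hf] at h1
  filter_upwards [h1, Lp.coeFn_smul z (f : L2R), hu.2.1] with x h1 h2 h3
  rw [← h1, h2, Pi.smul_apply, h3, smul_eq_mul]

/-! ### Behaviour of solutions at `+∞` and at `-∞` -/

/-- Every solution is `O(e^{-x/2})` at `+∞`, and its derivative is `O(e^{x/2})`. The energy
`e^{-x} |u' + u/2|² + ℓ² e^x |u|²` changes at a relative rate of at most `O(e^{-x})`. -/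
theorem IsSolution.exists_bound_atTop {ℓ : ℝ} (hℓ : 0 < ℓ) {z : ℂ} {u u' : ℝ → ℂ}
    (h : IsSolution ℓ z u u') :
    ∃ C, 0 ≤ C ∧ ∀ x, 0 ≤ x → ‖u x‖ ≤ C * Real.exp (-x / 2) ∧ ‖u' x‖ ≤ C * Real.exp (x / 2) := by
  set κ : ℂ := -z - 1 / 4 with hκ
  set p : ℝ → ℂ := fun x => u' x + u x / 2 with hp
  set c : ℝ := ‖κ‖ / ℓ with hc
  set E : ℝ → ℝ := fun x => Real.exp (-x) * ‖p x‖ ^ 2 + ℓ ^ 2 * Real.exp x * ‖u x‖ ^ 2 with hE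
  have hE0 : ∀ x, 0 ≤ E x := fun x => by positivity
  have hpd : ∀ x, HasDerivAt p (p x / 2 + κ * u x -
      ((ℓ ^ 2 * Real.exp (2 * x) : ℝ) : ℂ) * u x) x := fun x =>
    ((h x).2.add ((h x).1.div_const 2)).congr_deriv (by simp only [hp, hκ]; ring)
  have hEd : ∀ x, HasDerivAt E (2 * Real.exp (-x) * inner ℝ (p x) (κ * u x)) x := by
    intro x
    have he : HasDerivAt (fun x => Real.exp (-x)) (Real.exp (-x) * -1) x := (hasDerivAt_neg x).exp
    have h1 := he.mul (hpd x).norm_sq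
    have h2 := ((Real.hasDerivAt_exp x).const_mul (ℓ ^ 2)).mul (h x).1.norm_sq
    refine (h1.add h2).congr_deriv ?_
    have hu' : u' x = p x - u x / 2 := by simp [hp]
    have hexp : Real.exp (2 * x) = Real.exp x * Real.exp x := by rw [← Real.exp_add]; ring_nf
    have hexp' : Real.exp (-x) * Real.exp x = 1 := by rw [← Real.exp_add]; simp
    rw [hu', hexp]
    simp only [← Complex.normSq_eq_norm_sq, Complex.normSq_apply, Complex.inner,
      Complex.mul_re, Complex.mul_im, Complex.conj_re, Complex.conj_im, Complex.add_re,
      Complex.add_im, Complex.sub_re, Complex.sub_im, Complex.ofReal_re, Complex.ofReal_im,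
      Complex.div_ofNat_re, Complex.div_ofNat_im]
    linear_combination (-2 * ℓ ^ 2 * Real.exp x * ((p x).re * (u x).re + (p x).im * (u x).im)) *
      hexp'
  have hEb : ∀ x, 2 * Real.exp (-x) * inner ℝ (p x) (κ * u x) ≤ c * Real.exp (-x) * E x := by
    intro x
    have h1 : inner ℝ (p x) (κ * u x) ≤ ‖p x‖ * (‖κ‖ * ‖u x‖) := by
      rw [← norm_mul]; exact real_inner_le_norm _ _
    have h2 : 2 * ℓ * (‖p x‖ * ‖u x‖) ≤ E x := by
      have ha : Real.exp (-x) = Real.exp (-x / 2) ^ 2 := by rw [← Real.exp_nat_mul]; ring_nf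
      have hb : Real.exp x = Real.exp (x / 2) ^ 2 := by rw [← Real.exp_nat_mul]; ring_nf
      have hab : Real.exp (-x / 2) * Real.exp (x / 2) = 1 := by
        rw [← Real.exp_add]; ring_nf; simp
      simp only [hE]
      rw [ha, hb]
      have := sq_nonneg (Real.exp (-x / 2) * ‖p x‖ - ℓ * Real.exp (x / 2) * ‖u x‖)
      have h3 : 2 * (Real.exp (-x / 2) * ‖p x‖) * (ℓ * Real.exp (x / 2) * ‖u x‖) =
          2 * ℓ * (‖p x‖ * ‖u x‖) := by
        linear_combination (2 * ℓ * (‖p x‖ * ‖u x‖)) * hab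
      nlinarith
    calc 2 * Real.exp (-x) * inner ℝ (p x) (κ * u x)
        ≤ 2 * Real.exp (-x) * (‖p x‖ * (‖κ‖ * ‖u x‖)) := by gcongr
      _ = c * Real.exp (-x) * (2 * ℓ * (‖p x‖ * ‖u x‖)) := by rw [hc]; field_simp
      _ ≤ c * Real.exp (-x) * E x := by gcongr
  set F : ℝ → ℝ := fun x => E x * Real.exp (c * Real.exp (-x)) with hF
  have hanti : Antitone F := by
    have hFd : ∀ x, HasDerivAt F (2 * Real.exp (-x) * inner ℝ (p x) (κ * u x) *
        Real.exp (c * Real.exp (-x)) + E x * (Real.exp (c * Real.exp (-x)) *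
          (c * (Real.exp (-x) * -1)))) x := fun x =>
      (hEd x).mul (((hasDerivAt_id x).neg.exp).const_mul c).exp
    refine antitone_of_hasDerivAt_nonpos hFd fun x => ?_
    have := mul_le_mul_of_nonneg_right (hEb x) (Real.exp_nonneg (c * Real.exp (-x)))
    simp only [Pi.zero_apply]
    linarith
  have hEM : ∀ x, 0 ≤ x → E x ≤ F 0 := fun x hx =>
    calc E x ≤ F x := le_mul_of_one_le_right (hE0 x) (Real.one_le_exp (by positivity))
      _ ≤ F 0 := hanti hx
  set M := Real.sqrt (F 0) with hM
  have hM0 : 0 ≤ M := Real.sqrt_nonneg _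
  have hMF : M ^ 2 = F 0 := Real.sq_sqrt ((hE0 0).trans (hEM 0 le_rfl))
  have hub : ∀ x, 0 ≤ x → ‖u x‖ ≤ M / ℓ * Real.exp (-x / 2) := by
    intro x hx
    refine le_of_sq_le_sq ?_ (by positivity)
    have h1 : ℓ ^ 2 * Real.exp x * ‖u x‖ ^ 2 ≤ M ^ 2 := by
      rw [hMF]
      exact le_trans (le_add_of_nonneg_left (by positivity)) (hEM x hx)
    have h2 : (M / ℓ * Real.exp (-x / 2)) ^ 2 = M ^ 2 / (ℓ ^ 2 * Real.exp x) := by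
      rw [mul_pow, ← Real.exp_nat_mul, div_pow]
      rw [show ((2 : ℕ) : ℝ) * (-x / 2) = -x by push_cast; ring, Real.exp_neg]
      field_simp
    rw [h2, le_div_iff₀ (by positivity)]
    linarith
  have hpb : ∀ x, 0 ≤ x → ‖p x‖ ≤ M * Real.exp (x / 2) := by
    intro x hx
    refine le_of_sq_le_sq ?_ (by positivity)
    have h1 : Real.exp (-x) * ‖p x‖ ^ 2 ≤ M ^ 2 := by
      rw [hMF]
      exact le_trans (le_add_of_nonneg_right (by positivity)) (hEM x hx)
    have h2 : (M * Real.exp (x / 2)) ^ 2 = M ^ 2 * Real.exp x := by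
      rw [mul_pow, ← Real.exp_nat_mul]
      rw [show ((2 : ℕ) : ℝ) * (x / 2) = x by push_cast; ring]
    rw [Real.exp_neg, inv_mul_le_iff₀ (Real.exp_pos x)] at h1
    rw [h2]
    linarith
  have hC1 : 0 ≤ M / ℓ := by positivity
  refine ⟨M + M / ℓ, by positivity, fun x hx => ⟨?_, ?_⟩⟩
  · refine (hub x hx).trans ?_
    gcongr
    linarith
  · have h1 : u' x = p x - u x / 2 := by simp [hp]
    have h2 : Real.exp (-x / 2) ≤ Real.exp (x / 2) := Real.exp_le_exp.2 (by linarith)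
    have h3 := mul_le_mul_of_nonneg_left h2 hC1
    have h4 : ‖u x / 2‖ = ‖u x‖ / 2 := by simp
    calc ‖u' x‖ ≤ ‖p x‖ + ‖u x / 2‖ := by rw [h1]; exact norm_sub_le _ _
      _ ≤ M * Real.exp (x / 2) + M / ℓ * Real.exp (x / 2) := by
        rw [h4]
        have := hub x hx
        have := hpb x hx
        have := norm_nonneg (u x)
        linarith
      _ = _ := by ring

/-- The Wronskian of two solutions for different values of the spectral parameter stays bounded
at `+∞`. -/
theorem IsSolution.exists_wronskian_bound {ℓ : ℝ} (hℓ : 0 < ℓ) {z w : ℂ} {u u' v v' : ℝ → ℂ}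
    (hu : IsSolution ℓ z u u') (hv : IsSolution ℓ w v v') :
    ∃ C, ∀ x, 0 ≤ x → ‖u x * v' x - u' x * v x‖ ≤ C := by
  obtain ⟨C, hC0, hC⟩ := hu.exists_bound_atTop hℓ
  obtain ⟨D, hD0, hD⟩ := hv.exists_bound_atTop hℓ
  refine ⟨2 * (C * D), fun x hx => ?_⟩
  have hab : Real.exp (-x / 2) * Real.exp (x / 2) = 1 := by
    rw [← Real.exp_add]; ring_nf; simp
  calc ‖u x * v' x - u' x * v x‖ ≤ ‖u x‖ * ‖v' x‖ + ‖u' x‖ * ‖v x‖ := by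
        rw [← norm_mul, ← norm_mul]; exact norm_sub_le _ _
    _ ≤ (C * Real.exp (-x / 2)) * (D * Real.exp (x / 2)) +
        (C * Real.exp (x / 2)) * (D * Real.exp (-x / 2)) := by
        gcongr
        exacts [(hC x hx).1, (hD x hx).2, (hC x hx).2, (hD x hx).1]
    _ = 2 * (C * D) := by linear_combination (2 * C * D) * hab

theorem tendsto_integral_unit_atBot {g : ℝ → ℝ} (hg : Integrable g volume) :
    Tendsto (fun x : ℝ => ∫ t in x..(x + 1), g t) atBot (𝓝 0) := by
  have h1 := intervalIntegral_tendsto_integral_Iic (0 : ℝ) hg.integrableOn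
    (tendsto_id (α := ℝ) (x := atBot))
  have h2 := intervalIntegral_tendsto_integral_Iic (0 : ℝ) hg.integrableOn
    (tendsto_atBot_add_const_right atBot (1 : ℝ) tendsto_id)
  have h3 := h1.sub h2
  rw [sub_self] at h3
  refine h3.congr fun x => ?_
  rw [sub_eq_iff_eq_add]
  exact (intervalIntegral.integral_add_adjacent_intervals hg.intervalIntegrable
    hg.intervalIntegrable).symm

/-- A square integrable solution tends to `0` at `-∞`, together with its derivative: both are
controlled by the integral of `|u|` over the next unit interval, through integration by parts
against polynomials. -/
theorem IsSolution.tendsto_atBot {ℓ : ℝ} {z : ℂ} {u u' : ℝ → ℂ}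
    (h : IsSolution ℓ z u u') (hm : MemLp u 2 volume) :
    Tendsto u atBot (𝓝 0) ∧ Tendsto u' atBot (𝓝 0) := by
  set K : ℝ := ‖z‖ + ℓ ^ 2 with hK
  have hK0 : 0 ≤ K := by positivity
  have hint : Integrable (fun x => ‖u x‖ ^ 2) volume := by
    simpa using hm.integrable_norm_rpow (by simp) (by simp)
  have hI := tendsto_integral_unit_atBot hint
  set I : ℝ → ℝ := fun x => ∫ t in x..(x + 1), ‖u t‖ ^ 2 with hIdef
  have huc := h.continuous
  have huc' := h.continuous'
  -- Green's formula on `[x, x + 1]` against a polynomial vanishing to second order at `x + 1`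
  have key : ∀ α β : ℝ, ∃ D : ℝ, 0 ≤ D ∧ ∀ x ≤ -1, ∀ ε > 0,
      ‖(β : ℂ) * u x - α * u' x‖ ≤ D * (ε + I x / ε) := by
    intro α β
    set γ : ℝ := β + 2 * α with hγ
    refine ⟨(2 * |α| + 4 * |γ|) + (|α| + |γ|) * K, by positivity, fun x hx ε hε => ?_⟩
    have hφ : ∀ t, HasDerivAt (fun t : ℝ => (((α + γ * (t - x)) * (1 - (t - x)) ^ 2 : ℝ) : ℂ))
        ((γ * (1 - (t - x)) ^ 2 - 2 * (α + γ * (t - x)) * (1 - (t - x)) : ℝ) : ℂ) t := by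
      intro t
      have hs : HasDerivAt (fun t : ℝ => t - x) 1 t := (hasDerivAt_id t).sub_const x
      exact (((hs.const_mul γ).const_add α).mul ((hs.const_sub 1).pow 2)).ofReal_comp.congr_deriv
        (by simp only [Pi.pow_apply]; push_cast; ring)
    have hφ' : ∀ t, HasDerivAt (fun t : ℝ =>
          ((γ * (1 - (t - x)) ^ 2 - 2 * (α + γ * (t - x)) * (1 - (t - x)) : ℝ) : ℂ))
        ((2 * α - 4 * γ * (1 - (t - x)) + 2 * γ * (t - x) : ℝ) : ℂ) t := by
      intro t
      have hs : HasDerivAt (fun t : ℝ => t - x) 1 t := (hasDerivAt_id t).sub_const x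
      exact ((((hs.const_sub 1).pow 2).const_mul γ).sub
        ((((hs.const_mul γ).const_add α).const_mul 2).mul (hs.const_sub 1))).ofReal_comp.congr_deriv
        (by push_cast; ring)
    set G : ℝ → ℂ := fun t => ((2 * α - 4 * γ * (1 - (t - x)) + 2 * γ * (t - x) : ℝ) : ℂ) * u t +
      (((α + γ * (t - x)) * (1 - (t - x)) ^ 2 : ℝ) : ℂ) *
        ((z + ((ℓ ^ 2 * Real.exp (2 * t) : ℝ) : ℂ)) * u t) with hG
    have hGc : Continuous G := by fun_prop
    have hgreen : ∫ t in x..(x + 1), G t = -((β : ℂ) * u x - α * u' x) := by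
      rw [intervalIntegral.integral_eq_sub_of_hasDerivAt
        (f := fun t => ((γ * (1 - (t - x)) ^ 2 - 2 * (α + γ * (t - x)) * (1 - (t - x)) : ℝ) : ℂ) *
          u t - (((α + γ * (t - x)) * (1 - (t - x)) ^ 2 : ℝ) : ℂ) * u' t)
        (fun t _ => (((hφ' t).mul (h t).1).sub ((hφ t).mul (h t).2)).congr_deriv
          (by simp only [hG]; ring)) (hGc.intervalIntegrable _ _)]
      simp only [hγ]
      push_cast
      ring
    have hpt : ∀ t ∈ Icc x (x + 1), ‖G t‖ ≤
        ((2 * |α| + 4 * |γ|) + (|α| + |γ|) * K) * (ε + ‖u t‖ ^ 2 / ε) := by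
      intro t ht
      have hs0 : 0 ≤ t - x := by linarith [ht.1]
      have hs1 : t - x ≤ 1 := by linarith [ht.2]
      have h1 : |2 * α - 4 * γ * (1 - (t - x)) + 2 * γ * (t - x)| ≤ 2 * |α| + 4 * |γ| := by
        have : 2 * α - 4 * γ * (1 - (t - x)) + 2 * γ * (t - x) =
          2 * α + γ * (6 * (t - x) - 4) := by ring
        rw [this]
        refine (abs_add_le _ _).trans ?_
        rw [abs_mul, abs_mul]
        have : |6 * (t - x) - 4| ≤ 4 := abs_le.2 ⟨by linarith, by linarith⟩
        have := mul_le_mul_of_nonneg_left this (abs_nonneg γ)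
        rw [abs_two]
        linarith
      have h2 : |(α + γ * (t - x)) * (1 - (t - x)) ^ 2| ≤ |α| + |γ| := by
        have h3 : |α + γ * (t - x)| ≤ |α| + |γ| := by
          refine (abs_add_le _ _).trans ?_
          rw [abs_mul, abs_of_nonneg hs0]
          have := mul_le_of_le_one_right (abs_nonneg γ) hs1
          linarith
        rw [abs_mul, abs_of_nonneg (sq_nonneg (1 - (t - x)))]
        have h4 : (1 - (t - x)) ^ 2 ≤ 1 := by nlinarith
        calc _ ≤ (|α| + |γ|) * 1 := by gcongr
          _ = _ := mul_one _
      have h3 : ‖z + ((ℓ ^ 2 * Real.exp (2 * t) : ℝ) : ℂ)‖ ≤ K := by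
        refine (norm_add_le _ _).trans ?_
        rw [Complex.norm_real, Real.norm_of_nonneg (by positivity)]
        have : Real.exp (2 * t) ≤ 1 := Real.exp_le_one_iff.2 (by linarith [ht.2])
        have := mul_le_of_le_one_right (sq_nonneg ℓ) this
        linarith
      have h4 : ‖u t‖ ≤ ε + ‖u t‖ ^ 2 / ε := by
        have h5 : ε * ‖u t‖ ≤ ε * (ε + ‖u t‖ ^ 2 / ε) := by
          have : ε * (ε + ‖u t‖ ^ 2 / ε) = ε ^ 2 + ‖u t‖ ^ 2 := by field_simp
          rw [this]
          nlinarith [sq_nonneg (ε - ‖u t‖), sq_nonneg ε, sq_nonneg ‖u t‖]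
        exact le_of_mul_le_mul_left h5 hε
      calc ‖G t‖ ≤ (2 * |α| + 4 * |γ|) * ‖u t‖ + (|α| + |γ|) * (K * ‖u t‖) := by
            refine (norm_add_le _ _).trans ?_
            rw [norm_mul, norm_mul, norm_mul, Complex.norm_real, Complex.norm_real,
              Real.norm_eq_abs, Real.norm_eq_abs]
            gcongr
        _ = ((2 * |α| + 4 * |γ|) + (|α| + |γ|) * K) * ‖u t‖ := by ring
        _ ≤ _ := by gcongr
    have hfin := intervalIntegral.norm_integral_le_of_norm_le (by linarith : x ≤ x + 1)
      (Eventually.of_forall fun t ht => hpt t (Ioc_subset_Icc_self ht))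
      (Continuous.intervalIntegrable (μ := volume) (by fun_prop) x (x + 1))
    rw [hgreen, norm_neg] at hfin
    refine hfin.trans (le_of_eq ?_)
    have hc1 : Continuous fun _ : ℝ => ε := continuous_const
    have hc2 : Continuous fun t : ℝ => ‖u t‖ ^ 2 / ε := by fun_prop
    rw [intervalIntegral.integral_const_mul, intervalIntegral.integral_add
      (hc1.intervalIntegrable _ _) (hc2.intervalIntegrable _ _), intervalIntegral.integral_div]
    simp [hIdef]
  have lim : ∀ α β : ℝ, Tendsto (fun x => (β : ℂ) * u x - α * u' x) atBot (𝓝 0) := by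
    intro α β
    obtain ⟨D, hD0, hD⟩ := key α β
    rw [Metric.tendsto_nhds]
    intro δ hδ
    have hε : 0 < δ / (2 * D + 1) := by positivity
    set ε := δ / (2 * D + 1) with hεdef
    have h1 : ∀ᶠ x in atBot, I x < ε ^ 2 := hI.eventually_lt_const (by positivity)
    filter_upwards [h1, eventually_le_atBot (-1)] with x hx hx1
    rw [dist_zero_right]
    have h2 : I x / ε ≤ ε := by
      rw [div_le_iff₀ hε]
      nlinarith
    calc _ ≤ D * (ε + I x / ε) := hD x hx1 ε hε
      _ ≤ D * (ε + ε) := by gcongr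
      _ < (2 * D + 1) * ε := by linarith
      _ = δ := by rw [hεdef]; field_simp
  refine ⟨by simpa using lim 0 1, ?_⟩
  have := (lim (-1) 0)
  simpa using this

/-! ### Integral operators with exponentially localized kernels -/

theorem integrable_exp_neg_mul_abs {a : ℝ} (ha : 0 < a) :
    Integrable (fun x : ℝ => Real.exp (-a * |x|)) volume := by
  rw [← integrableOn_univ, ← Iic_union_Ioi (a := (0 : ℝ)), integrableOn_union]
  constructor
  · refine (integrableOn_exp_mul_Iic ha 0).congr_fun (fun x hx => ?_) measurableSet_Iic
    simp only [abs_of_nonpos (mem_Iic.1 hx)]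
    ring_nf
  · refine (exp_neg_integrableOn_Ioi 0 ha).congr_fun (fun x hx => ?_) measurableSet_Ioi
    simp only [abs_of_pos (mem_Ioi.1 hx)]

theorem memLp_two_of_norm_le_exp {f : ℝ → ℂ} (hf : AEStronglyMeasurable f volume) {a C : ℝ}
    (ha : 0 < a) (h : ∀ x, ‖f x‖ ≤ C * Real.exp (-a * |x|)) : MemLp f 2 volume := by
  have h1 : MemLp (fun x : ℝ => Real.exp (-a * |x|)) 2 volume := by
    rw [memLp_two_iff_integrable_sq (Continuous.aestronglyMeasurable (by fun_prop))]
    refine (integrable_exp_neg_mul_abs (a := 2 * a) (by positivity)).congr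
      (Eventually.of_forall fun x => ?_)
    simp only [← Real.exp_nat_mul]
    push_cast
    ring_nf
  refine h1.of_le_mul hf (c := C) (Eventually.of_forall fun x => ?_)
  rw [Real.norm_of_nonneg (Real.exp_nonneg _)]
  exact h x

/-- The Schur test (or Young's inequality) for a convolution kernel on `L²(ℝ)`. -/
theorem lintegral_sq_convolution_le {w φ : ℝ → ℝ≥0∞} (hw : Measurable w) (hφ : Measurable φ) :
    ∫⁻ x, (∫⁻ y, w (x - y) * φ y) ^ (2 : ℝ) ≤ (∫⁻ t, w t) ^ 2 * ∫⁻ y, φ y ^ (2 : ℝ) := by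
  set N := ∫⁻ t, w t with hN
  have hrt : ∀ t : ℝ≥0∞, t ^ (1 / 2 : ℝ) * t ^ (1 / 2 : ℝ) = t := by
    intro t
    rw [← ENNReal.rpow_add_of_nonneg _ _ (by norm_num) (by norm_num)]
    norm_num
  have hpt : ∀ x, (∫⁻ y, w (x - y) * φ y) ^ (2 : ℝ) ≤ N * ∫⁻ y, w (x - y) * φ y ^ (2 : ℝ) := by
    intro x
    -- Cauchy-Schwarz for `w φ = w^{1/2} (w^{1/2} φ)`
    have h1 := ENNReal.lintegral_mul_le_Lp_mul_Lq volume Real.HolderConjugate.two_two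
      (f := fun y => w (x - y) ^ (1 / 2 : ℝ)) (g := fun y => w (x - y) ^ (1 / 2 : ℝ) * φ y)
      (by fun_prop) (by fun_prop)
    have h2 : ∀ y, ((fun y => w (x - y) ^ (1 / 2 : ℝ)) *
        fun y => w (x - y) ^ (1 / 2 : ℝ) * φ y) y = w (x - y) * φ y := by
      intro y
      simp only [Pi.mul_apply]
      rw [← mul_assoc, hrt]
    have h3 : ∀ y, (w (x - y) ^ (1 / 2 : ℝ)) ^ (2 : ℝ) = w (x - y) := by
      intro y
      rw [← ENNReal.rpow_mul]
      norm_num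
    simp only [h2, h3, ENNReal.mul_rpow_of_nonneg _ _ (by norm_num : (0 : ℝ) ≤ 2)] at h1
    rw [lintegral_sub_left_eq_self] at h1
    calc (∫⁻ y, w (x - y) * φ y) ^ (2 : ℝ)
        ≤ (N ^ (1 / 2 : ℝ) * (∫⁻ y, w (x - y) * φ y ^ (2 : ℝ)) ^ (1 / 2 : ℝ)) ^ (2 : ℝ) := by
          gcongr
      _ = _ := by
        rw [ENNReal.mul_rpow_of_nonneg _ _ (by norm_num), ← ENNReal.rpow_mul, ← ENNReal.rpow_mul]
        norm_num
  calc ∫⁻ x, (∫⁻ y, w (x - y) * φ y) ^ (2 : ℝ)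
      ≤ ∫⁻ x, N * ∫⁻ y, w (x - y) * φ y ^ (2 : ℝ) := lintegral_mono hpt
    _ = N * ∫⁻ x, ∫⁻ y, w (x - y) * φ y ^ (2 : ℝ) :=
        lintegral_const_mul _ (Measurable.lintegral_prod_right (by fun_prop))
    _ = N * ∫⁻ y, ∫⁻ x, w (x - y) * φ y ^ (2 : ℝ) := by
        rw [lintegral_lintegral_swap (by fun_prop)]
    _ = N * ∫⁻ y, N * φ y ^ (2 : ℝ) := by
        congr 1
        refine lintegral_congr fun y => ?_
        rw [lintegral_mul_const _ (by fun_prop), lintegral_sub_right_eq_self w y]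
    _ = _ := by
        rw [lintegral_const_mul _ (by fun_prop), sq, mul_assoc]

/-- A continuous kernel bounded by `C e^{-a|x - y|}` defines a bounded operator on `L²(ℝ)`. -/
theorem exists_clm_of_norm_kernel_le {k : ℝ → ℝ → ℂ} (hk : Continuous (Function.uncurry k))
    {a C : ℝ} (ha : 0 < a) (hC : 0 ≤ C) (h : ∀ x y, ‖k x y‖ ≤ C * Real.exp (-a * |x - y|)) :
    ∃ R : L2R →L[ℂ] L2R, ∀ g : L2R, (∀ x, Integrable (fun y => k x y * g y) volume) ∧
      R g =ᵐ[volume] fun x => ∫ y, k x y * g y := by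
  have hkx : ∀ x, Continuous (k x) := fun x => hk.comp (by fun_prop : Continuous fun y => (x, y))
  have hint : ∀ (g : L2R) (x : ℝ), Integrable (fun y => k x y * g y) volume := by
    intro g x
    refine MemLp.integrable_mul (p := 2) (q := 2) ?_ (Lp.memLp g)
    refine memLp_two_of_norm_le_exp (hkx x).aestronglyMeasurable ha
      (C := C * Real.exp (a * |x|)) fun y => (h x y).trans ?_
    rw [mul_assoc, ← Real.exp_add]
    gcongr
    have := abs_sub_abs_le_abs_sub y x
    rw [abs_sub_comm y x] at this
    nlinarith
  set w : ℝ → ℝ≥0∞ := fun t => ENNReal.ofReal (C * Real.exp (-a * |t|)) with hw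
  have hwm : Measurable w := by fun_prop
  have hwN : ∫⁻ t, w t ≠ ⊤ := by
    rw [← ofReal_integral_eq_lintegral_ofReal ((integrable_exp_neg_mul_abs ha).const_mul C)
      (Eventually.of_forall fun t => by positivity)]
    exact ENNReal.ofReal_ne_top
  have hmeas : ∀ g : L2R, AEStronglyMeasurable (fun x => ∫ y, k x y * g y) volume := by
    intro g
    refine (StronglyMeasurable.integral_prod_right ?_).aestronglyMeasurable
    exact hk.stronglyMeasurable.mul ((Lp.stronglyMeasurable g).comp_measurable measurable_snd)
  have hnorm : ∀ g : L2R, eLpNorm (fun x => ∫ y, k x y * g y) 2 volume ≤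
      (∫⁻ t, w t) * eLpNorm g 2 volume := by
    intro g
    rw [eLpNorm_eq_lintegral_rpow_enorm_toReal (by simp) (by simp),
      eLpNorm_eq_lintegral_rpow_enorm_toReal (by simp) (by simp)]
    simp only [ENNReal.toReal_ofNat]
    have h1 : ∀ x, ‖∫ y, k x y * g y‖ₑ ≤ ∫⁻ y, w (x - y) * ‖g y‖ₑ := by
      intro x
      refine (enorm_integral_le_lintegral_enorm _).trans (lintegral_mono fun y => ?_)
      rw [enorm_mul]
      gcongr
      rw [← ofReal_norm]
      exact ENNReal.ofReal_le_ofReal (h x y)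
    have h2 := lintegral_sq_convolution_le hwm (Lp.stronglyMeasurable g).enorm
    calc (∫⁻ x, ‖∫ y, k x y * g y‖ₑ ^ (2 : ℝ)) ^ (1 / 2 : ℝ)
        ≤ (∫⁻ x, (∫⁻ y, w (x - y) * ‖g y‖ₑ) ^ (2 : ℝ)) ^ (1 / 2 : ℝ) := by
          gcongr
          exact h1 _
      _ ≤ ((∫⁻ t, w t) ^ 2 * ∫⁻ y, ‖g y‖ₑ ^ (2 : ℝ)) ^ (1 / 2 : ℝ) := by gcongr
      _ = _ := by
        rw [ENNReal.mul_rpow_of_nonneg _ _ (by norm_num), ← ENNReal.rpow_natCast_mul]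
        norm_num
  have hmem : ∀ g : L2R, MemLp (fun x => ∫ y, k x y * g y) 2 volume := fun g =>
    ⟨hmeas g, (hnorm g).trans_lt (ENNReal.mul_lt_top hwN.lt_top (Lp.eLpNorm_lt_top g))⟩
  let T : L2R →ₗ[ℂ] L2R :=
    { toFun := fun g => (hmem g).toLp _
      map_add' := by
        intro f g
        rw [← MemLp.toLp_add]
        refine (MemLp.toLp_eq_toLp_iff _ _).2 (Eventually.of_forall fun x => ?_)
        simp only [Pi.add_apply]
        rw [← integral_add (hint f x) (hint g x)]
        refine integral_congr_ae ?_
        filter_upwards [Lp.coeFn_add f g] with y hy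
        rw [hy, Pi.add_apply, mul_add]
      map_smul' := by
        intro c g
        rw [RingHom.id_apply, ← MemLp.toLp_const_smul]
        refine (MemLp.toLp_eq_toLp_iff _ _).2 (Eventually.of_forall fun x => ?_)
        simp only [Pi.smul_apply]
        rw [← integral_smul]
        refine integral_congr_ae ?_
        filter_upwards [Lp.coeFn_smul c g] with y hy
        rw [hy, Pi.smul_apply, smul_eq_mul, smul_eq_mul]
        ring }
  refine ⟨T.mkContinuous (∫⁻ t, w t).toReal fun g => ?_, fun g => ⟨hint g, ?_⟩⟩
  · change ‖(hmem g).toLp _‖ ≤ _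
    rw [Lp.norm_toLp, Lp.norm_def, ← ENNReal.toReal_mul]
    exact ENNReal.toReal_mono (ENNReal.mul_ne_top hwN (Lp.eLpNorm_ne_top g)) (hnorm g)
  · exact (hmem g).coeFn_toLp

/-! ### The resolvent built from a pair of solutions -/

/-- The data from which the resolvent at `z` of the operator with boundary function `Φ` is built:
a solution `j` that decays at `-∞` and a solution `h` that satisfies the boundary condition at
`+∞`, with Wronskian `-1`. -/
structure IsWeylPair (ℓ : ℝ) (z : ℂ) (Φ Φ' j j' h h' : ℝ → ℂ) : Prop where
  left : IsSolution ℓ z j j'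
  right : IsSolution ℓ z h h'
  wronskian_eq : ∀ x, j x * h' x - j' x * h x = -1
  growth : ∃ a C : ℝ, 0 < a ∧ 0 ≤ C ∧ ∀ x ≤ 0, ‖j x‖ ≤ C * Real.exp (a * x) ∧
    ‖j' x‖ ≤ C ∧ ‖h x‖ ≤ C * Real.exp (-a * x)
  boundary : Tendsto (fun x => Φ x * h' x - Φ' x * h x) atTop (𝓝 0)

/-- The integral kernel `j(min(x, y)) h(max(x, y))`. -/
def greenKernel (j h : ℝ → ℂ) (x y : ℝ) : ℂ := j (min x y) * h (max x y)

/-- The Wronskians of two functions `Φ`, `Ψ` with a pair `j`, `h` satisfy a Plücker relation, so a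
solution cannot satisfy the boundary condition together with `h` unless it is proportional to
`h`. -/
theorem IsWeylPair.not_tendsto_left {ℓ : ℝ} (hℓ : 0 < ℓ) {z w : ℂ} {Φ Φ' Ψ Ψ' j j' h h' : ℝ → ℂ}
    (H : IsWeylPair ℓ z Φ Φ' j j' h h') (hΨ : IsSolution ℓ w Ψ Ψ') {c : ℂ} (hc : c ≠ 0)
    (hW : ∀ x, Φ x * Ψ' x - Φ' x * Ψ x = c) :
    ¬ Tendsto (fun x => Φ x * j' x - Φ' x * j x) atTop (𝓝 0) := by
  intro hj
  obtain ⟨C, hC⟩ := hΨ.exists_wronskian_bound hℓ H.right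
  obtain ⟨D, hD⟩ := hΨ.exists_wronskian_bound hℓ H.left
  have h1 : Tendsto (fun x => (Φ x * j' x - Φ' x * j x) * (Ψ x * h' x - Ψ' x * h x)) atTop
      (𝓝 0) := by
    refine squeeze_zero_norm' ?_ (by simpa using hj.norm.mul_const C)
    filter_upwards [eventually_ge_atTop 0] with x hx
    rw [norm_mul]
    gcongr
    exact hC x hx
  have h2 : Tendsto (fun x => (Φ x * h' x - Φ' x * h x) * (Ψ x * j' x - Ψ' x * j x)) atTop
      (𝓝 0) := by
    refine squeeze_zero_norm' ?_ (by simpa using H.boundary.norm.mul_const D)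
    filter_upwards [eventually_ge_atTop 0] with x hx
    rw [norm_mul]
    gcongr
    exact hD x hx
  have h3 := h1.sub h2
  have h4 : (fun x => (Φ x * j' x - Φ' x * j x) * (Ψ x * h' x - Ψ' x * h x) -
      (Φ x * h' x - Φ' x * h x) * (Ψ x * j' x - Ψ' x * j x)) = fun _ => -c := by
    funext x
    rw [← hW x]
    linear_combination (Φ x * Ψ' x - Φ' x * Ψ x) * H.wronskian_eq x
  rw [h4, sub_zero] at h3
  exact hc (neg_eq_zero.1 (tendsto_nhds_unique tendsto_const_nhds h3))

/-- A square integrable solution is proportional to any nonzero solution that is bounded, together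
with its derivative, at `-∞`. -/
theorem IsSolution.exists_eq_mul_of_memLp {ℓ : ℝ} {z : ℂ} {j j' v v' : ℝ → ℂ}
    (hj : IsSolution ℓ z j j') {x₀ : ℝ} (h0 : j x₀ ≠ 0) {C : ℝ}
    (hC : ∀ x ≤ 0, ‖j x‖ ≤ C ∧ ‖j' x‖ ≤ C) (hv : IsSolution ℓ z v v') (hm : MemLp v 2 volume) :
    ∃ c, ∀ x, v x = c * j x := by
  obtain ⟨hv0, hv0'⟩ := hv.tendsto_atBot hm
  refine hj.exists_eq_mul hv h0 ?_
  have h1 : Tendsto (fun x => j x * v' x - j' x * v x) atBot (𝓝 0) := by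
    refine squeeze_zero_norm' (a := fun x => C * ‖v' x‖ + C * ‖v x‖) ?_
      (by simpa using (hv0'.norm.const_mul C).add (hv0.norm.const_mul C))
    filter_upwards [eventually_le_atBot 0] with x hx
    refine (norm_sub_le _ _).trans ?_
    rw [norm_mul, norm_mul]
    gcongr
    exacts [(hC x hx).1, (hC x hx).2]
  have h2 : (fun x => j x * v' x - j' x * v x) = fun _ => j x₀ * v' x₀ - j' x₀ * v x₀ :=
    funext fun x => hj.wronskian_const hv x x₀
  rw [h2] at h1
  exact tendsto_nhds_unique tendsto_const_nhds h1

/-- The exponential decay of the kernel away from the diagonal. At `-∞` the growth of `h` is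
compensated by the decay of `j`; at `+∞` both solutions decay like `e^{-x/2}`. -/
theorem IsWeylPair.norm_greenKernel_le {ℓ : ℝ} (hℓ : 0 < ℓ) {z : ℂ} {Φ Φ' j j' h h' : ℝ → ℂ}
    (H : IsWeylPair ℓ z Φ Φ' j j' h h') : ∃ a C : ℝ, 0 < a ∧ 0 ≤ C ∧
      (∀ x, ‖j x‖ ≤ C * Real.exp (-a * |x|)) ∧
      (∀ x, 0 ≤ x → ‖h x‖ ≤ C * Real.exp (-a * |x|)) ∧
      ∀ x y, ‖greenKernel j h x y‖ ≤ C * Real.exp (-a * |x - y|) := by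
  obtain ⟨b, B, hb, hB, hjh⟩ := H.growth
  obtain ⟨Cj, hCj0, hCj⟩ := H.left.exists_bound_atTop hℓ
  obtain ⟨Ch, hCh0, hCh⟩ := H.right.exists_bound_atTop hℓ
  set a := min b (1 / 2) with ha
  have ha0 : 0 < a := lt_min hb (by norm_num)
  have hab : a ≤ b := min_le_left _ _
  have ha2 : a ≤ 1 / 2 := min_le_right _ _
  set D := B + Cj + Ch with hD
  have hD0 : 0 ≤ D := by positivity
  have hj0 : ∀ x ≤ 0, ‖j x‖ ≤ D * Real.exp (b * x) := fun x hx => (hjh x hx).1.trans (by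
    gcongr; linarith)
  have hj1 : ∀ x, 0 ≤ x → ‖j x‖ ≤ D * Real.exp (-x / 2) := fun x hx => (hCj x hx).1.trans (by
    gcongr; linarith)
  have hh0 : ∀ x ≤ 0, ‖h x‖ ≤ D * Real.exp (-b * x) := fun x hx => (hjh x hx).2.2.trans (by
    gcongr; linarith)
  have hh1 : ∀ x, 0 ≤ x → ‖h x‖ ≤ D * Real.exp (-x / 2) := fun x hx => (hCh x hx).1.trans (by
    gcongr; linarith)
  have hjh' : ∀ x y, x ≤ y → ‖j x * h y‖ ≤ D ^ 2 * Real.exp (-a * (y - x)) := by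
    intro x y hxy
    have key : ∀ s t : ℝ, ‖j x‖ ≤ D * Real.exp s → ‖h y‖ ≤ D * Real.exp t →
        s + t ≤ -a * (y - x) → ‖j x * h y‖ ≤ D ^ 2 * Real.exp (-a * (y - x)) := by
      intro s t hs ht hst
      calc ‖j x * h y‖ = ‖j x‖ * ‖h y‖ := norm_mul _ _
        _ ≤ (D * Real.exp s) * (D * Real.exp t) := by gcongr
        _ = D ^ 2 * Real.exp (s + t) := by rw [Real.exp_add]; ring
        _ ≤ _ := by gcongr
    rcases le_total x 0 with hx | hx
    · rcases le_total y 0 with hy | hy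
      · exact key _ _ (hj0 x hx) (hh0 y hy) (by nlinarith)
      · exact key _ _ (hj0 x hx) (hh1 y hy) (by nlinarith)
    · have hy := hx.trans hxy
      exact key _ _ (hj1 x hx) (hh1 y hy) (by nlinarith)
  refine ⟨a, D + D ^ 2, ha0, by positivity, fun x => ?_, fun x hx => ?_, fun x y => ?_⟩
  · have h1 : ‖j x‖ ≤ D * Real.exp (-a * |x|) := by
      rcases le_total x 0 with hx | hx
      · refine (hj0 x hx).trans ?_
        rw [abs_of_nonpos hx]
        exact mul_le_mul_of_nonneg_left (Real.exp_le_exp.2 (by nlinarith)) hD0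
      · refine (hj1 x hx).trans ?_
        rw [abs_of_nonneg hx]
        gcongr
        nlinarith
    refine h1.trans ?_
    gcongr
    nlinarith
  · have h1 : ‖h x‖ ≤ D * Real.exp (-a * |x|) := by
      refine (hh1 x hx).trans ?_
      rw [abs_of_nonneg hx]
      gcongr
      nlinarith
    refine h1.trans ?_
    gcongr
    nlinarith
  · have h1 : ‖greenKernel j h x y‖ ≤ D ^ 2 * Real.exp (-a * |x - y|) := by
      rcases le_total x y with hxy | hxy
      · rw [greenKernel, min_eq_left hxy, max_eq_right hxy, abs_sub_comm,
          abs_of_nonneg (by linarith)]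
        exact hjh' x y hxy
      · rw [greenKernel, min_eq_right hxy, max_eq_left hxy, abs_of_nonneg (by linarith)]
        exact hjh' y x hxy
    refine h1.trans ?_
    gcongr
    linarith

/-- The function `u(x) = ∫ j(min(x, y)) h(max(x, y)) g(y) dy` solves the inhomogeneous equation and
satisfies the boundary condition. As in the variation of constants, `u = h A + j B`, where `A` is
the integral of `j g` over `]-∞, x]` and `B` that of `h g` over `]x, ∞[`. -/
theorem IsWeylPair.exists_green_solution {ℓ : ℝ} (hℓ : 0 < ℓ) {z w : ℂ} {Φ Φ' j j' h h' : ℝ → ℂ}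
    (H : IsWeylPair ℓ z Φ Φ' j j' h h') (hΦ : IsSolution ℓ w Φ Φ') {g : ℝ → ℂ}
    (hg : MemLp g 2 volume) :
    IsAC1 (fun x => ∫ y, greenKernel j h x y * g y) ∧
    (∀ᵐ x, formalOp ℓ (fun x => ∫ y, greenKernel j h x y * g y) x =
      z * (∫ y, greenKernel j h x y * g y) + g x) ∧
    Tendsto (wronskian Φ (fun x => ∫ y, greenKernel j h x y * g y)) atTop (𝓝 0) := by
  obtain ⟨a, C, ha, hC, hjb, hhb, hkb⟩ := H.norm_greenKernel_le hℓ
  have hjg : Integrable (fun y => j y * g y) volume :=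
    MemLp.integrable_mul (p := 2) (q := 2)
      (memLp_two_of_norm_le_exp H.left.continuous.aestronglyMeasurable ha hjb) hg
  have hgl : LocallyIntegrable g volume := hg.locallyIntegrable (by norm_num)
  have hhgl : LocallyIntegrable (fun y => h y * g y) volume :=
    hgl.continuous_mul H.right.continuous
  have hhi : ∀ x y, IntervalIntegrable (fun y => h y * g y) volume x y := fun x y =>
    intervalIntegrable_iff.mpr
      ((hhgl.integrableOn_isCompact isCompact_uIcc).mono_set uIoc_subset_uIcc)
  have hhg0 : IntegrableOn (fun y => h y * g y) (Ioi 0) volume := by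
    have h1 : MemLp ((Ioi (0 : ℝ)).indicator h) 2 volume := by
      refine memLp_two_of_norm_le_exp
        (H.right.continuous.aestronglyMeasurable.indicator measurableSet_Ioi) ha (C := C)
        fun x => ?_
      by_cases hx : x ∈ Ioi (0 : ℝ)
      · rw [indicator_of_mem hx]
        exact hhb x (le_of_lt hx)
      · rw [indicator_of_notMem hx, norm_zero]
        positivity
    have h2 : Integrable (fun y => (Ioi (0 : ℝ)).indicator h y * g y) volume :=
      MemLp.integrable_mul (p := 2) (q := 2) h1 hg
    rw [← integrable_indicator_iff measurableSet_Ioi]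
    refine h2.congr (Eventually.of_forall fun y => ?_)
    simp only [indicator_mul_left]
  -- `A` and `B` are written as primitives, which are absolutely continuous
  set A : ℝ → ℂ := fun x => (∫ y in Iic 0, j y * g y) + ∫ y in (0 : ℝ)..x, j y * g y with hA
  set B : ℝ → ℂ := fun x => (∫ y in Ioi 0, h y * g y) - ∫ y in (0 : ℝ)..x, h y * g y with hB
  have hAx : ∀ x, A x = ∫ y in Iic x, j y * g y := by
    intro x
    rw [hA]
    simp only
    rw [← intervalIntegral.integral_Iic_sub_Iic hjg.integrableOn hjg.integrableOn]
    ring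
  have hhgx : ∀ x, IntegrableOn (fun y => h y * g y) (Ioi x) volume := by
    intro x
    have h1 : IntegrableOn (fun y => h y * g y) (uIoc 0 x) volume :=
      intervalIntegrable_iff.1 (hhi 0 x)
    refine (hhg0.union h1).mono_set fun y hy => ?_
    rcases le_or_gt y 0 with h0 | h0
    · right
      rw [uIoc_of_ge (le_of_lt (lt_of_lt_of_le hy h0))]
      exact ⟨hy, h0⟩
    · exact Or.inl h0
  have hBx : ∀ x, B x = ∫ y in Ioi x, h y * g y := by
    intro x
    rw [hB]
    simp only
    rw [← intervalIntegral.integral_Ioi_sub_Ioi' (hhgx 0) (hhgx x)]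
    ring
  set u : ℝ → ℂ := fun x => ∫ y, greenKernel j h x y * g y with hu
  have hux : u = fun x => h x * A x + j x * B x := by
    funext x
    have hcont : Continuous fun y => greenKernel j h x y := by
      have := H.left.continuous
      have := H.right.continuous
      unfold greenKernel
      fun_prop
    have hint : Integrable (fun y => greenKernel j h x y * g y) volume := by
      refine MemLp.integrable_mul (p := 2) (q := 2) (memLp_two_of_norm_le_exp
        hcont.aestronglyMeasurable ha (C := C * Real.exp (a * |x|)) fun y => ?_) hg
      refine (hkb x y).trans ?_
      rw [mul_assoc, ← Real.exp_add]
      gcongr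
      have := abs_sub_abs_le_abs_sub y x
      rw [abs_sub_comm y x] at this
      nlinarith
    rw [hu]
    simp only
    rw [← intervalIntegral.integral_Iic_add_Ioi (b := x) hint.integrableOn hint.integrableOn, hAx,
      hBx, ← integral_const_mul, ← integral_const_mul]
    congr 1
    · refine setIntegral_congr_fun measurableSet_Iic fun y hy => ?_
      simp only [greenKernel, min_eq_right (mem_Iic.1 hy), max_eq_left (mem_Iic.1 hy)]
      ring
    · refine setIntegral_congr_fun measurableSet_Ioi fun y hy => ?_
      simp only [greenKernel, min_eq_left (mem_Ioi.1 hy).le, max_eq_right (mem_Ioi.1 hy).le]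
      ring
  have hAac : ∀ a b, AbsolutelyContinuousOnInterval A a b := fun a b =>
    (absolutelyContinuousOnInterval_of_hasDerivAt (fun x => hasDerivAt_const x _)
      continuous_const a b).add
      (absolutelyContinuousOnInterval_primitive hjg.locallyIntegrable 0 a b)
  have hBac : ∀ a b, AbsolutelyContinuousOnInterval B a b := fun a b =>
    (absolutelyContinuousOnInterval_of_hasDerivAt (fun x => hasDerivAt_const x _)
      continuous_const a b).sub
      (absolutelyContinuousOnInterval_primitive hhgl 0 a b)
  have hcc : ∀ {f : ℝ → ℂ}, (∀ a b, AbsolutelyContinuousOnInterval f a b) → Continuous f := by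
    intro f hf
    refine continuous_iff_continuousAt.2 fun x => ?_
    refine (hf (x - 1) (x + 1)).continuousOn.continuousAt ?_
    rw [uIcc_of_le (by linarith)]
    exact Icc_mem_nhds (by linarith) (by linarith)
  have hjac : ∀ a b, AbsolutelyContinuousOnInterval j a b :=
    absolutelyContinuousOnInterval_of_hasDerivAt (fun x => (H.left x).1) H.left.continuous'
  have hhac : ∀ a b, AbsolutelyContinuousOnInterval h a b :=
    absolutelyContinuousOnInterval_of_hasDerivAt (fun x => (H.right x).1) H.right.continuous'
  have hjc := H.left.continuous
  have hhc := H.right.continuous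
  have hjac' : ∀ a b, AbsolutelyContinuousOnInterval j' a b :=
    absolutelyContinuousOnInterval_of_hasDerivAt (fun x => (H.left x).2) (by fun_prop)
  have hhac' : ∀ a b, AbsolutelyContinuousOnInterval h' a b :=
    absolutelyContinuousOnInterval_of_hasDerivAt (fun x => (H.right x).2) (by fun_prop)
  have hAd : ∀ᵐ x, HasDerivAt A (j x * g x) x := by
    filter_upwards [LocallyIntegrable.ae_hasDerivAt_integral hjg.locallyIntegrable] with x hx
    exact (hx 0).const_add _
  have hBd : ∀ᵐ x, HasDerivAt B (-(h x * g x)) x := by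
    filter_upwards [LocallyIntegrable.ae_hasDerivAt_integral hhgl] with x hx
    exact (hx 0).const_sub _
  have hud : ∀ x, HasDerivAt u (h' x * A x + j' x * B x) x := by
    refine hasDerivAt_of_ae_hasDerivAt (w := fun x => h' x * A x + j' x * B x) (fun a b => ?_) ?_ ?_
    · rw [hux]
      exact (absolutelyContinuousOnInterval_mul (hhac a b) (hAac a b)).add
        (absolutelyContinuousOnInterval_mul (hjac a b) (hBac a b))
    · exact (H.right.continuous'.mul (hcc hAac)).add (H.left.continuous'.mul (hcc hBac))
    · filter_upwards [hAd, hBd] with x hxA hxB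
      rw [hux]
      exact (((H.right x).1.mul hxA).add ((H.left x).1.mul hxB)).congr_deriv (by ring)
  have hdu : deriv u = fun x => h' x * A x + j' x * B x := funext fun x => (hud x).deriv
  refine ⟨⟨fun x => (hud x).differentiableAt, fun a b => ?_⟩, ?_, ?_⟩
  · rw [hdu]
    exact (absolutelyContinuousOnInterval_mul (hhac' a b) (hAac a b)).add
      (absolutelyContinuousOnInterval_mul (hjac' a b) (hBac a b))
  · filter_upwards [hAd, hBd] with x hxA hxB
    have h2 := (((H.right x).2.mul hxA).add ((H.left x).2.mul hxB)).deriv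
    have h3 : deriv u = h' * A + j' * B := hdu
    rw [formalOp]
    change -deriv (deriv u) x - _ * u x = z * u x + g x
    rw [h3, h2, congrFun hux x]
    linear_combination (-g x) * H.wronskian_eq x
  -- `W(Φ, u) = W(Φ, h) A + W(Φ, j) B`, where `W(Φ, h)` and `B` tend to `0`
  · obtain ⟨D, hD⟩ := hΦ.exists_wronskian_bound hℓ H.left
    have hAlim : Tendsto A atTop (𝓝 ((∫ y in Iic 0, j y * g y) + ∫ y in Ioi 0, j y * g y)) :=
      (intervalIntegral_tendsto_integral_Ioi 0 hjg.integrableOn tendsto_id).const_add _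
    have hBlim : Tendsto B atTop (𝓝 0) := by
      have := (intervalIntegral_tendsto_integral_Ioi 0 hhg0 tendsto_id).const_sub
        (∫ y in Ioi 0, h y * g y)
      rwa [sub_self] at this
    have h1 : Tendsto (fun x => (Φ x * h' x - Φ' x * h x) * A x) atTop (𝓝 0) := by
      simpa using H.boundary.mul hAlim
    have h2 : Tendsto (fun x => (Φ x * j' x - Φ' x * j x) * B x) atTop (𝓝 0) := by
      refine squeeze_zero_norm' ?_ (by simpa using hBlim.norm.const_mul D)
      filter_upwards [eventually_ge_atTop 0] with x hx
      rw [norm_mul]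
      gcongr
      exact hD x hx
    have h3 := h1.add h2
    rw [add_zero] at h3
    refine h3.congr fun x => ?_
    rw [wronskian, hdu, hΦ.deriv_eq, congrFun hux x]
    ring

/-- The resolvent is the integral operator with kernel `j(min(x, y)) h(max(x, y))`. The second
function `Ψ`, independent of `Φ`, is used only to see that `j` violates the boundary condition. -/
theorem IsWeylPair.exists_resolvent {ℓ : ℝ} (hℓ : 0 < ℓ) {z w : ℂ} {Φ Φ' Ψ Ψ' j j' h h' : ℝ → ℂ}
    (H : IsWeylPair ℓ z Φ Φ' j j' h h') (hΦ : IsSolution ℓ w Φ Φ') (hΨ : IsSolution ℓ w Ψ Ψ')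
    {c : ℂ} (hc : c ≠ 0) (hW : ∀ x, Φ x * Ψ' x - Φ' x * Ψ x = c) :
    ∃ R : L2R →L[ℂ] L2R, IsResolventAt (bcOp ℓ Φ) z R ∧
      HasIntegralKernel R (greenKernel j h) := by
  obtain ⟨a, C, ha, hC, hjb, hhb, hkb⟩ := H.norm_greenKernel_le hℓ
  have hcont : Continuous (Function.uncurry (greenKernel j h)) := by
    have := H.left.continuous
    have := H.right.continuous
    unfold greenKernel Function.uncurry
    fun_prop
  obtain ⟨R, hR⟩ := exists_clm_of_norm_kernel_le hcont ha hC hkb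
  have hsurj : ∀ g : L2R, ∃ f : (bcOp ℓ Φ).domain, (f : L2R) = R g ∧
      bcOp ℓ Φ f - z • (f : L2R) = g := by
    intro g
    obtain ⟨h1, h2, h3⟩ := H.exists_green_solution hℓ hΦ (Lp.memLp g)
    have hae := (hR g).2
    have hop : formalOp ℓ (fun x => ∫ y, greenKernel j h x y * g y) =ᵐ[volume]
        ((z • R g + g : L2R) : ℝ → ℂ) := by
      filter_upwards [h2, hae, Lp.coeFn_add (z • R g) g, Lp.coeFn_smul z (R g)]
        with x h2 h4 h5 h6
      rw [h2, h5, Pi.add_apply, h6, Pi.smul_apply, h4, smul_eq_mul]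
    have hrep : IsMaxRep ℓ (R g) (fun x => ∫ y, greenKernel j h x y * g y) :=
      ⟨h1, hae, (memLp_congr_ae hop).2 (Lp.memLp _)⟩
    refine ⟨⟨R g, mem_bcOp_domain.2 ⟨_, hrep, h3⟩⟩, rfl, ?_⟩
    rw [sub_eq_iff_eq_add, add_comm]
    exact Lp.ext ((bcOp_apply_ae _ hrep).trans hop)
  have hinj : ∀ f : (bcOp ℓ Φ).domain, bcOp ℓ Φ f = z • (f : L2R) → f = 0 := by
    intro f hf
    obtain ⟨v, hv, hvm, hfv, hvW⟩ := exists_isSolution_of_eigen f hf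
    obtain ⟨b, D, hb, hD, hgr⟩ := H.growth
    have hj0 : ∃ x₀, j x₀ ≠ 0 := by
      by_contra! hz
      have hz' : j' 0 = 0 := by
        rw [← H.left.deriv_eq, show j = fun _ => 0 from funext hz]
        simp
      have := H.wronskian_eq 0
      rw [hz 0, hz'] at this
      simp at this
    obtain ⟨x₀, hx₀⟩ := hj0
    obtain ⟨c', hc'⟩ := H.left.exists_eq_mul_of_memLp hx₀ (C := D) (fun x hx =>
      ⟨(hgr x hx).1.trans (mul_le_of_le_one_right hD
        (Real.exp_le_one_iff.2 (mul_nonpos_of_nonneg_of_nonpos hb.le hx))), (hgr x hx).2.1⟩) hv hvm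
    have hc0 : c' = 0 := by
      by_contra hne
      refine H.not_tendsto_left hℓ hΨ hc hW ?_
      have h1 := hvW.const_mul c'⁻¹
      rw [mul_zero] at h1
      refine h1.congr fun x => ?_
      have hdv : deriv v x = c' * j' x := by
        rw [show v = fun x => c' * j x from funext hc']
        exact ((H.left x).1.const_mul c').deriv
      rw [wronskian, hdv, hc' x, hΦ.deriv_eq]
      field_simp
    refine Subtype.ext (Lp.ext (hfv.trans ?_))
    filter_upwards [Lp.coeFn_zero ℂ 2 (volume : Measure ℝ)] with x hx
    rw [hc' x, hc0, zero_mul]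
    exact hx.symm
  refine ⟨R, ⟨hsurj, fun f => ?_⟩, fun g => ?_⟩
  · obtain ⟨f', hf', hf''⟩ := hsurj (bcOp ℓ Φ f - z • (f : L2R))
    have h0 : f' - f = 0 := by
      refine hinj _ ?_
      rw [LinearPMap.map_sub]
      simp only [AddSubgroupClass.coe_sub, smul_sub]
      rw [sub_eq_sub_iff_sub_eq_sub]
      exact hf''
    rw [← hf', sub_eq_zero.1 h0]
  · filter_upwards [(hR g).2] with x hx
    exact ⟨(hR g).1 x, hx⟩

/-- An operator with a bounded resolvent at one point is closed. -/
theorem IsResolventAt.isClosed {A : L2R →ₗ.[ℂ] L2R} {z : ℂ} {R : L2R →L[ℂ] L2R}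
    (h : IsResolventAt A z R) : A.IsClosed := by
  have hg : (A.graph : Set (L2R × L2R)) = {p | R (p.2 - z • p.1) = p.1} := by
    ext ⟨f, g⟩
    simp only [SetLike.mem_coe, LinearPMap.mem_graph_iff, mem_ofPred_eq]
    constructor
    · rintro ⟨y, rfl, rfl⟩
      exact h.2 y
    · intro hR
      obtain ⟨f', hf', hf''⟩ := h.1 (g - z • f)
      rw [hR] at hf'
      refine ⟨f', hf', ?_⟩
      rw [hf'] at hf''
      exact sub_left_injective hf''
  rw [LinearPMap.IsClosed, hg]
  exact isClosed_eq (by fun_prop) continuous_fst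

theorem IsResolventAt.eq_zero_of_eigen {A : L2R →ₗ.[ℂ] L2R} {z : ℂ} {R : L2R →L[ℂ] L2R}
    (h : IsResolventAt A z R) (f : A.domain) (hf : A f = z • (f : L2R)) : (f : L2R) = 0 := by
  have := h.2 f
  rw [hf, sub_self, map_zero] at this
  exact this.symm

/-! ### The Bessel function -/

theorem hasSum_regularizedHGFun (μ w : ℂ) :
    HasSum (fun n : ℕ => ((n.factorial : ℂ))⁻¹ * (Complex.Gamma (μ + n))⁻¹ * w ^ n)
      (Complex.regularizedHGFun 0 {μ} w) := by
  have hr := Complex.radius_regularizedHGFunSeries_eq_top (a := 0) (b := {μ}) (by simp)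
  have h := ((Complex.regularizedHGFunSeries 0 {μ}).hasFPowerSeriesOnBall
    (by rw [hr]; simp)).hasSum (y := w) (by rw [hr]; simp)
  rw [zero_add] at h
  refine h.congr_fun fun n => ?_
  simp [Complex.regularizedHGFunSeries, Complex.regularizedHGFunCoeff, mul_comm]

theorem summable_regularizedHGFun (μ w : ℂ) :
    Summable (fun n : ℕ => ‖((n.factorial : ℂ))⁻¹ * (Complex.Gamma (μ + n))⁻¹ * w ^ n‖) :=
  (hasSum_regularizedHGFun μ w).summable.norm

/-- The derivative of `₀𝐅₁(μ; ·)` is `₀𝐅₁(μ + 1; ·)`. -/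
theorem hasDerivAt_regularizedHGFun (μ w : ℂ) :
    HasDerivAt (Complex.regularizedHGFun 0 {μ}) (Complex.regularizedHGFun 0 {μ + 1} w) w := by
  set F : ℕ → ℂ → ℂ := fun n w => ((n.factorial : ℂ))⁻¹ * (Complex.Gamma (μ + n))⁻¹ * w ^ n with hF
  have hq : Complex.regularizedHGFun 0 {μ} = fun w => ∑' n, F n w :=
    funext fun w => (hasSum_regularizedHGFun μ w).tsum_eq.symm
  set ρ : ℝ := ‖w‖ + 1 with hρ
  have hρ0 : 0 ≤ ρ := by positivity
  have hs : Summable (fun n => ‖F n (ρ : ℂ)‖) := summable_regularizedHGFun μ ρ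
  have hb : ∀ n, ∀ v ∈ Metric.ball (0 : ℂ) ρ, ‖F n v‖ ≤ ‖F n (ρ : ℂ)‖ := by
    intro n v hv
    rw [mem_ball_zero_iff] at hv
    simp only [hF, norm_mul, norm_pow, Complex.norm_real, Real.norm_of_nonneg hρ0]
    gcongr
  have hd : ∀ n, DifferentiableOn ℂ (F n) (Metric.ball (0 : ℂ) ρ) := fun n => by
    simp only [hF]; fun_prop
  have hw : w ∈ Metric.ball (0 : ℂ) ρ := by rw [mem_ball_zero_iff]; linarith
  have h1 := Complex.hasSum_deriv_of_summable_norm hs hd Metric.isOpen_ball hb hw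
  have h2 := Complex.differentiableOn_tsum_of_summable_norm hs hd Metric.isOpen_ball hb
  have hdF : ∀ n, deriv (F n) w =
      ((n.factorial : ℂ))⁻¹ * (Complex.Gamma (μ + n))⁻¹ * (n * w ^ (n - 1)) := by
    intro n
    exact ((hasDerivAt_pow n w).const_mul _).deriv
  have h3 : HasSum (fun n => deriv (F n) w) (Complex.regularizedHGFun 0 {μ + 1} w) := by
    rw [← hasSum_nat_add_iff' 1]
    simp only [Finset.range_one, Finset.sum_singleton, hdF 0, Nat.cast_zero, zero_mul, mul_zero,
      sub_zero]
    refine (hasSum_regularizedHGFun (μ + 1) w).congr_fun fun n => ?_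
    rw [hdF, Nat.factorial_succ, Nat.add_sub_cancel]
    have : (n : ℂ) + 1 ≠ 0 := Nat.cast_add_one_ne_zero n
    push_cast
    rw [show μ + 1 + (n : ℂ) = μ + (n + 1) by ring]
    field_simp
  rw [hq, h3.unique h1]
  exact (h2.differentiableAt (Metric.isOpen_ball.mem_nhds hw)).hasDerivAt

/-- The contiguity relation `w ₀𝐅₁(μ + 2; w) + μ ₀𝐅₁(μ + 1; w) = ₀𝐅₁(μ; w)`, which is the Bessel
differential equation. -/
theorem regularizedHGFun_contiguous (μ w : ℂ) :
    w * Complex.regularizedHGFun 0 {μ + 1 + 1} w + μ * Complex.regularizedHGFun 0 {μ + 1} w =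
      Complex.regularizedHGFun 0 {μ} w := by
  have h1 := (hasSum_regularizedHGFun (μ + 1 + 1) w).mul_left w
  have h2 := (hasSum_regularizedHGFun (μ + 1) w).mul_left μ
  have h3 := hasSum_regularizedHGFun μ w
  rw [← hasSum_nat_add_iff' 1] at h2 h3
  have h4 := (h1.add h2).unique (h3.congr_fun fun n => ?_)
  · simp only [Finset.range_one, Finset.sum_singleton, Nat.factorial_zero, Nat.cast_zero,
      Nat.cast_one, pow_zero, add_zero, inv_one, one_mul, mul_one] at h4
    have h5 := Complex.one_div_Gamma_eq_self_mul_one_div_Gamma_add_one μ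
    linear_combination h4 - h5
  · have h5 := Complex.one_div_Gamma_eq_self_mul_one_div_Gamma_add_one (μ + ((n : ℂ) + 1))
    have h6 : (n : ℂ) + 1 ≠ 0 := Nat.cast_add_one_ne_zero n
    have h7 : (n.factorial : ℂ) ≠ 0 := Nat.cast_ne_zero.2 n.factorial_ne_zero
    push_cast [Nat.factorial_succ]
    rw [h5, show μ + 1 + 1 + (n : ℂ) = μ + (n + 1) + 1 by ring,
      show μ + 1 + ((n : ℂ) + 1) = μ + (n + 1) + 1 by ring]
    field_simp
    ring

theorem cpow_scaled_exp {c : ℝ} (hc : 0 < c) (m : ℂ) (x : ℝ) :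
    ((c * Real.exp x : ℝ) : ℂ) ^ m = (c : ℂ) ^ m * Complex.exp (m * x) := by
  rw [Complex.ofReal_mul, Complex.mul_cpow_ofReal_nonneg hc.le (Real.exp_nonneg x)]
  congr 1
  rw [Complex.cpow_def_of_ne_zero (by simp), ← Complex.ofReal_log
    (Real.exp_nonneg x), Real.log_exp, mul_comm]

/-- The argument of the hypergeometric factor of `J_m(ℓ e^x)`. -/
def besselArg (ℓ x : ℝ) : ℂ := -(((ℓ * Real.exp x : ℝ) : ℂ) ^ 2 / 4)

/-- The derivative of `x ↦ J_m(ℓ e^x)`. -/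
def besselJExpDeriv (ℓ : ℝ) (m : ℂ) (x : ℝ) : ℂ :=
  ((ℓ / 2 : ℝ) : ℂ) ^ m * Complex.exp (m * x) *
    (m * Complex.regularizedHGFun 0 {m + 1} (besselArg ℓ x) +
      2 * besselArg ℓ x * Complex.regularizedHGFun 0 {m + 1 + 1} (besselArg ℓ x))

theorem besselJ_scaled_exp {ℓ : ℝ} (hℓ : 0 < ℓ) (m : ℂ) (x : ℝ) :
    besselJ m (ℓ * Real.exp x) = ((ℓ / 2 : ℝ) : ℂ) ^ m * Complex.exp (m * x) *
      Complex.regularizedHGFun 0 {m + 1} (besselArg ℓ x) := by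
  rw [besselJ, besselArg, ← cpow_scaled_exp (by positivity)]
  congr 2
  push_cast
  ring

theorem hasDerivAt_besselArg (ℓ x : ℝ) : HasDerivAt (besselArg ℓ) (2 * besselArg ℓ x) x := by
  have h := ((((Real.hasDerivAt_exp x).const_mul ℓ).ofReal_comp.pow 2).div_const 4).neg
  refine h.congr_deriv ?_
  simp only [besselArg]
  push_cast
  ring

theorem hasDerivAt_exp_mul_ofReal (m : ℂ) (x : ℝ) :
    HasDerivAt (fun x : ℝ => Complex.exp (m * x)) (m * Complex.exp (m * x)) x :=
  (((Complex.ofRealCLM.hasDerivAt (x := x)).const_mul m).cexp).congr_deriv (by simp; ring)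

theorem isSolution_besselJ {ℓ : ℝ} (hℓ : 0 < ℓ) (m : ℂ) :
    IsSolution ℓ (-m ^ 2) (fun x => besselJ m (ℓ * Real.exp x)) (besselJExpDeriv ℓ m) := by
  intro x
  have hq : ∀ μ, HasDerivAt (fun x => Complex.regularizedHGFun 0 {μ} (besselArg ℓ x))
      (Complex.regularizedHGFun 0 {μ + 1} (besselArg ℓ x) * (2 * besselArg ℓ x)) x := fun μ =>
    (hasDerivAt_regularizedHGFun μ (besselArg ℓ x)).comp x (hasDerivAt_besselArg ℓ x)
  have he := (hasDerivAt_exp_mul_ofReal m x).const_mul (((ℓ / 2 : ℝ) : ℂ) ^ m)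
  have hfun : (fun x => besselJ m (ℓ * Real.exp x)) = fun x : ℝ =>
      ((ℓ / 2 : ℝ) : ℂ) ^ m * Complex.exp (m * x) *
        Complex.regularizedHGFun 0 {m + 1} (besselArg ℓ x) :=
    funext fun x => besselJ_scaled_exp hℓ m x
  have hV : ((ℓ ^ 2 * Real.exp (2 * x) : ℝ) : ℂ) = -(4 * besselArg ℓ x) := by
    rw [besselArg, two_mul, Real.exp_add]
    push_cast
    ring
  constructor
  · rw [hfun]
    refine (he.mul (hq (m + 1))).congr_deriv ?_
    rw [besselJExpDeriv]
    ring
  · refine (he.mul (((hq (m + 1)).const_mul m).add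
      (((hasDerivAt_besselArg ℓ x).const_mul 2).mul (hq (m + 1 + 1))))).congr_deriv ?_
    have hc := regularizedHGFun_contiguous (m + 1) (besselArg ℓ x)
    rw [hfun, hV]
    simp only [Pi.add_apply, Pi.mul_apply]
    linear_combination (((ℓ / 2 : ℝ) : ℂ) ^ m * Complex.exp (m * x) * 4 * besselArg ℓ x) * hc

theorem tendsto_besselArg_atBot (ℓ : ℝ) : Tendsto (besselArg ℓ) atBot (𝓝 0) := by
  have h : Tendsto (fun x => ((ℓ * Real.exp x : ℝ) : ℂ)) atBot (𝓝 ((ℓ * 0 : ℝ) : ℂ)) :=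
    (Complex.continuous_ofReal.tendsto _).comp (Real.tendsto_exp_atBot.const_mul ℓ)
  have h2 := ((h.pow 2).div_const 4).neg
  have h3 : -(((ℓ * 0 : ℝ) : ℂ) ^ 2 / 4) = 0 := by simp
  rw [h3] at h2
  exact h2

theorem continuous_regularizedHGFun (μ : ℂ) : Continuous (Complex.regularizedHGFun 0 {μ}) :=
  continuous_iff_continuousAt.2 fun w => (hasDerivAt_regularizedHGFun μ w).continuousAt

theorem regularizedHGFun_zero (μ : ℂ) :
    Complex.regularizedHGFun 0 {μ} 0 = (Complex.Gamma μ)⁻¹ := by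
  refine (hasSum_regularizedHGFun μ 0).unique ?_
  convert hasSum_single (f := fun n : ℕ =>
    ((n.factorial : ℂ))⁻¹ * (Complex.Gamma (μ + n))⁻¹ * 0 ^ n) 0 ?_ using 1
  · simp
  · intro n hn
    simp [hn]

theorem tendsto_regularizedHGFun_besselArg (ℓ : ℝ) (μ : ℂ) :
    Tendsto (fun x => Complex.regularizedHGFun 0 {μ} (besselArg ℓ x)) atBot
      (𝓝 (Complex.Gamma μ)⁻¹) := by
  have h := ((continuous_regularizedHGFun μ).tendsto 0).comp (tendsto_besselArg_atBot ℓ)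
  rwa [regularizedHGFun_zero] at h

/-- `J_m(ℓ e^x)` behaves like `(ℓ/2)^m e^{mx} / Γ(m + 1)` at `-∞`. -/
theorem tendsto_besselJ_atBot {ℓ : ℝ} (hℓ : 0 < ℓ) (m : ℂ) :
    Tendsto (fun x : ℝ => Complex.exp (-m * x) * besselJ m (ℓ * Real.exp x)) atBot
      (𝓝 (((ℓ / 2 : ℝ) : ℂ) ^ m * (Complex.Gamma (m + 1))⁻¹)) := by
  refine ((tendsto_regularizedHGFun_besselArg ℓ (m + 1)).const_mul _).congr fun x => ?_
  rw [besselJ_scaled_exp hℓ]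
  have : Complex.exp (-m * x) * Complex.exp (m * x) = 1 := by
    rw [← Complex.exp_add]; simp
  linear_combination (-(((ℓ / 2 : ℝ) : ℂ) ^ m *
    Complex.regularizedHGFun 0 {m + 1} (besselArg ℓ x))) * this

theorem tendsto_besselJExpDeriv_atBot (ℓ : ℝ) (m : ℂ) :
    Tendsto (fun x : ℝ => Complex.exp (-m * x) * besselJExpDeriv ℓ m x) atBot
      (𝓝 (((ℓ / 2 : ℝ) : ℂ) ^ m * (m * (Complex.Gamma (m + 1))⁻¹))) := by
  have h := (((tendsto_regularizedHGFun_besselArg ℓ (m + 1)).const_mul m).add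
    (((tendsto_besselArg_atBot ℓ).const_mul 2).mul
      (tendsto_regularizedHGFun_besselArg ℓ (m + 1 + 1)))).const_mul (((ℓ / 2 : ℝ) : ℂ) ^ m)
  rw [mul_zero, zero_mul, add_zero] at h
  refine h.congr fun x => ?_
  rw [besselJExpDeriv]
  have : Complex.exp (-m * x) * Complex.exp (m * x) = 1 := by
    rw [← Complex.exp_add]; simp
  linear_combination (-(((ℓ / 2 : ℝ) : ℂ) ^ m *
    (m * Complex.regularizedHGFun 0 {m + 1} (besselArg ℓ x) +
      2 * besselArg ℓ x * Complex.regularizedHGFun 0 {m + 1 + 1} (besselArg ℓ x)))) * this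

/-- A continuous function with a limit at `-∞` is bounded on the negative half-line. -/
theorem exists_bound_of_tendsto_atBot {f : ℝ → ℂ} (hf : Continuous f) {L : ℂ}
    (h : Tendsto f atBot (𝓝 L)) : ∃ C, 0 ≤ C ∧ ∀ x ≤ 0, ‖f x‖ ≤ C := by
  obtain ⟨N, hN⟩ := eventually_atBot.1 (h.norm.eventually_lt_const (lt_add_one ‖L‖))
  obtain ⟨D, hD⟩ := isCompact_Icc.exists_bound_of_continuousOn (hf.continuousOn (s := Icc N 0))
  refine ⟨max (‖L‖ + 1) D, by positivity, fun x hx => ?_⟩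
  rcases le_total x N with hxN | hxN
  · exact (hN x hxN).le.trans (le_max_left _ _)
  · exact (hD x ⟨hxN, hx⟩).trans (le_max_right _ _)

/-- A function `f` for which `e^{-mx} f(x)` has a limit at `-∞` is `O(e^{Re m x})` there. -/
theorem exists_bound_of_tendsto_exp_mul {f : ℝ → ℂ} (hf : Continuous f) {m L : ℂ}
    (h : Tendsto (fun x : ℝ => Complex.exp (-m * x) * f x) atBot (𝓝 L)) :
    ∃ C, 0 ≤ C ∧ ∀ x ≤ 0, ‖f x‖ ≤ C * Real.exp (m.re * x) := by
  obtain ⟨C, hC0, hC⟩ := exists_bound_of_tendsto_atBot (by fun_prop) h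
  refine ⟨C, hC0, fun x hx => ?_⟩
  have h1 := hC x hx
  have h2 : ‖Complex.exp (-m * x)‖ = Real.exp (-(m.re * x)) := by
    rw [Complex.norm_exp]; simp
  rw [norm_mul, h2, Real.exp_neg, inv_mul_le_iff₀ (Real.exp_pos _)] at h1
  linarith

theorem besselJ_growth {ℓ : ℝ} (hℓ : 0 < ℓ) (m : ℂ) : ∃ C, 0 ≤ C ∧ ∀ x ≤ 0,
    ‖besselJ m (ℓ * Real.exp x)‖ ≤ C * Real.exp (m.re * x) ∧
    ‖besselJExpDeriv ℓ m x‖ ≤ C * Real.exp (m.re * x) := by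
  obtain ⟨C, hC0, hC⟩ := exists_bound_of_tendsto_exp_mul (isSolution_besselJ hℓ m).continuous
    (tendsto_besselJ_atBot hℓ m)
  obtain ⟨D, hD0, hD⟩ := exists_bound_of_tendsto_exp_mul (isSolution_besselJ hℓ m).continuous'
    (tendsto_besselJExpDeriv_atBot ℓ m)
  refine ⟨C + D, by positivity, fun x hx => ⟨(hC x hx).trans ?_, (hD x hx).trans ?_⟩⟩
  · gcongr; linarith
  · gcongr; linarith

/-! ### The Laplace integral of the Macdonald function -/

/-- The integrand `e^{-t} t^a (z + t/2)^b`. -/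
def laplaceKernel (a b z : ℂ) (t : ℝ) : ℂ :=
  Complex.exp (-(t : ℂ)) * (t : ℂ) ^ a * (z + t / 2) ^ b

/-- The Laplace integral `∫₀^∞ e^{-t} t^a (z + t/2)^b dt`, for `Re a > -1` and `z` on the imaginary
axis. -/
def laplaceInt (a b z : ℂ) : ℂ := ∫ t in Ioi (0 : ℝ), laplaceKernel a b z t

theorem norm_cpow_le_exp (w b : ℂ) :
    ‖w ^ b‖ ≤ Real.exp (Real.pi * |b.im|) * ‖w‖ ^ b.re := by
  refine (Complex.norm_cpow_le w b).trans ?_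
  rw [div_eq_mul_inv, ← Real.exp_neg, mul_comm]
  gcongr
  calc -(w.arg * b.im) ≤ |w.arg * b.im| := neg_le_abs _
    _ = |w.arg| * |b.im| := abs_mul _ _
    _ ≤ _ := by gcongr; exact Complex.abs_arg_le_pi w

theorem integrableOn_exp_half_mul_rpow {p : ℝ} (hp : -1 < p) :
    IntegrableOn (fun t : ℝ => Real.exp (-t / 2) * t ^ p) (Ioi 0) volume := by
  have h := integrableOn_rpow_mul_exp_neg_mul_rpow (p := 1) (b := 1 / 2) hp one_pos (by norm_num)
  refine h.congr_fun (fun t _ => ?_) measurableSet_Ioi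
  simp only [Real.rpow_one]
  rw [mul_comm]
  congr 2
  ring

theorem exists_one_add_div_rpow_le {c : ℝ} (hc : 0 < c) (σ : ℝ) :
    ∃ K, 0 ≤ K ∧ ∀ t, 0 ≤ t → (1 + t / c) ^ |σ| ≤ K * Real.exp (t / 2) := by
  set s := |σ| + 1 with hs
  have hs1 : 1 ≤ s := by have := abs_nonneg σ; linarith
  set A := max 1 (2 * s / c) with hA
  have hA1 : 1 ≤ A := le_max_left _ _
  refine ⟨A ^ s, by positivity, fun t ht => ?_⟩
  have h1 : 1 + t / c ≤ A * Real.exp (t / (2 * s)) := by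
    calc 1 + t / c ≤ A * (1 + t / (2 * s)) := by
          have h2 : t / c ≤ A * (t / (2 * s)) := by
            calc t / c = 2 * s / c * (t / (2 * s)) := by field_simp
              _ ≤ _ := by gcongr; exact le_max_right _ _
          linarith
      _ ≤ _ := by
          gcongr
          linarith [Real.add_one_le_exp (t / (2 * s))]
  have h0 : 1 ≤ 1 + t / c := by have : 0 ≤ t / c := by positivity
                                linarith
  calc (1 + t / c) ^ |σ| ≤ (1 + t / c) ^ s := Real.rpow_le_rpow_of_exponent_le h0 (by linarith)
    _ ≤ (A * Real.exp (t / (2 * s))) ^ s := by gcongr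
    _ = A ^ s * Real.exp (t / 2) := by
      rw [Real.mul_rpow (by positivity) (by positivity), ← Real.exp_mul]
      congr 2
      field_simp

section ImaginaryAxis

variable {z : ℂ}

theorem norm_le_norm_add_half (hz : z.re = 0) {t : ℝ} (ht : 0 ≤ t) :
    ‖z‖ ≤ ‖z + t / 2‖ ∧ t / 2 ≤ ‖z + t / 2‖ ∧ ‖z + t / 2‖ ≤ ‖z‖ + t / 2 := by
  have hre : (z + t / 2).re = t / 2 := by simp [hz]
  have him : (z + t / 2).im = z.im := by simp
  refine ⟨?_, ?_, ?_⟩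
  · refine le_of_sq_le_sq ?_ (norm_nonneg _)
    rw [← Complex.normSq_eq_norm_sq, ← Complex.normSq_eq_norm_sq, Complex.normSq_apply,
      Complex.normSq_apply, hre, him, hz]
    nlinarith
  · have := Complex.re_le_norm (z + t / 2)
    rwa [hre] at this
  · refine (norm_add_le _ _).trans ?_
    simp [abs_of_nonneg ht]

theorem add_half_mem_slitPlane (hz : z.re = 0) (hz0 : z ≠ 0) {t : ℝ} (ht : 0 ≤ t) :
    z + t / 2 ∈ Complex.slitPlane := by
  rcases ht.eq_or_lt with rfl | ht
  · right
    simpa using fun h => hz0 (Complex.ext hz h)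
  · left
    simpa [hz] using ht

/-- Away from `z = 0` the power `(z + t/2)^b` is bounded by `|z|^{Re b} e^{t/2}`. -/
theorem exists_norm_add_half_cpow_le {c : ℝ} (hc : 0 < c) (b : ℂ) :
    ∃ M, 0 ≤ M ∧ ∀ z : ℂ, z.re = 0 → c ≤ ‖z‖ → ∀ t : ℝ, 0 ≤ t →
      ‖(z + t / 2) ^ b‖ ≤ M * ‖z‖ ^ b.re * Real.exp (t / 2) := by
  obtain ⟨K, hK0, hK⟩ := exists_one_add_div_rpow_le hc b.re
  refine ⟨Real.exp (Real.pi * |b.im|) * K, by positivity, fun z hz hcz t ht => ?_⟩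
  obtain ⟨h1, -, h3⟩ := norm_le_norm_add_half hz ht
  have hz0 : 0 < ‖z‖ := hc.trans_le hcz
  have h4 : ‖z + t / 2‖ ≤ ‖z‖ * (1 + t / c) := by
    have : t / 2 ≤ ‖z‖ * (t / c) := by
      calc t / 2 ≤ t := by linarith
        _ = c * (t / c) := by field_simp
        _ ≤ _ := by gcongr
    linarith
  have h0 : 1 ≤ 1 + t / c := by have : 0 ≤ t / c := by positivity
                                linarith
  have h5 : ‖z + t / 2‖ ^ b.re ≤ ‖z‖ ^ b.re * (1 + t / c) ^ |b.re| := by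
    rcases le_total 0 b.re with hb | hb
    · rw [abs_of_nonneg hb, ← Real.mul_rpow (by positivity) (by positivity)]
      gcongr
    · calc ‖z + t / 2‖ ^ b.re ≤ ‖z‖ ^ b.re := Real.rpow_le_rpow_of_nonpos hz0 h1 hb
        _ ≤ _ := le_mul_of_one_le_right (by positivity)
          (Real.one_le_rpow h0 (abs_nonneg _))
  calc ‖(z + t / 2) ^ b‖ ≤ Real.exp (Real.pi * |b.im|) * ‖z + t / 2‖ ^ b.re :=
        norm_cpow_le_exp _ _
    _ ≤ Real.exp (Real.pi * |b.im|) * (‖z‖ ^ b.re * (K * Real.exp (t / 2))) := by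
        gcongr
        refine h5.trans ?_
        gcongr
        exact hK t ht
    _ = _ := by ring

theorem norm_exp_mul_cpow {t : ℝ} (ht : 0 < t) (a : ℂ) :
    ‖Complex.exp (-(t : ℂ)) * (t : ℂ) ^ a‖ = Real.exp (-t) * t ^ a.re := by
  rw [norm_mul, Complex.norm_cpow_eq_rpow_re_of_pos ht, Complex.norm_exp]
  simp

theorem exists_norm_laplaceKernel_le {c : ℝ} (hc : 0 < c) (a b : ℂ) :
    ∃ M, 0 ≤ M ∧ ∀ z : ℂ, z.re = 0 → c ≤ ‖z‖ → ∀ t : ℝ, 0 < t →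
      ‖laplaceKernel a b z t‖ ≤ M * ‖z‖ ^ b.re * (Real.exp (-t / 2) * t ^ a.re) := by
  obtain ⟨M, hM0, hM⟩ := exists_norm_add_half_cpow_le hc b
  refine ⟨M, hM0, fun z hz hcz t ht => ?_⟩
  have he : Real.exp (-t / 2) = Real.exp (-t) * Real.exp (t / 2) := by
    rw [← Real.exp_add]; ring_nf
  calc ‖laplaceKernel a b z t‖ = Real.exp (-t) * t ^ a.re * ‖(z + t / 2) ^ b‖ := by
        rw [laplaceKernel, norm_mul, norm_exp_mul_cpow ht]
    _ ≤ Real.exp (-t) * t ^ a.re * (M * ‖z‖ ^ b.re * Real.exp (t / 2)) := by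
        gcongr
        exact hM z hz hcz t ht.le
    _ = _ := by rw [he]; ring

theorem aestronglyMeasurable_laplaceKernel (a b z : ℂ) :
    AEStronglyMeasurable (laplaceKernel a b z) (volume.restrict (Ioi 0)) := by
  unfold laplaceKernel
  exact (by fun_prop : Measurable fun t : ℝ =>
    Complex.exp (-(t : ℂ)) * (t : ℂ) ^ a * (z + t / 2) ^ b).aestronglyMeasurable

theorem integrableOn_laplaceKernel {a : ℂ} (ha : -1 < a.re) (b : ℂ) (hz : z.re = 0)
    (hz0 : z ≠ 0) : IntegrableOn (laplaceKernel a b z) (Ioi 0) volume := by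
  obtain ⟨M, hM0, hM⟩ := exists_norm_laplaceKernel_le (norm_pos_iff.2 hz0) a b
  refine Integrable.mono' ((integrableOn_exp_half_mul_rpow ha).const_mul (M * ‖z‖ ^ b.re))
    (aestronglyMeasurable_laplaceKernel a b z) ?_
  filter_upwards [ae_restrict_mem measurableSet_Ioi] with t ht
  exact hM z hz le_rfl t ht

/-- For `|z| ≥ c` the Laplace integral is `O(|z|^{Re b})`. -/
theorem exists_norm_laplaceInt_le {c : ℝ} (hc : 0 < c) {a : ℂ} (ha : -1 < a.re) (b : ℂ) :
    ∃ M, 0 ≤ M ∧ ∀ z : ℂ, z.re = 0 → c ≤ ‖z‖ → ‖laplaceInt a b z‖ ≤ M * ‖z‖ ^ b.re := by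
  obtain ⟨M, hM0, hM⟩ := exists_norm_laplaceKernel_le hc a b
  refine ⟨M * ∫ t in Ioi (0 : ℝ), Real.exp (-t / 2) * t ^ a.re, ?_, fun z hz hcz => ?_⟩
  · refine mul_nonneg hM0 (setIntegral_nonneg measurableSet_Ioi fun t ht => ?_)
    have : (0 : ℝ) < t := ht
    positivity
  · have h1 := norm_integral_le_of_norm_le
      ((integrableOn_exp_half_mul_rpow ha).const_mul (M * ‖z‖ ^ b.re)) (by
        filter_upwards [ae_restrict_mem measurableSet_Ioi] with t ht
        exact hM z hz hcz t ht)
    rw [integral_const_mul] at h1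
    rw [laplaceInt]
    linarith

theorem laplaceInt_add_one_right {a : ℂ} (ha : -1 < a.re) (b : ℂ) (hz : z.re = 0)
    (hz0 : z ≠ 0) :
    laplaceInt a (b + 1) z = z * laplaceInt a b z + laplaceInt (a + 1) b z / 2 := by
  have ha' : -1 < (a + 1).re := by simp; linarith
  rw [laplaceInt, laplaceInt, laplaceInt, ← integral_const_mul, ← integral_div,
    ← integral_add ((integrableOn_laplaceKernel ha b hz hz0).const_mul z)
      ((integrableOn_laplaceKernel ha' b hz hz0).div_const 2)]
  refine setIntegral_congr_fun measurableSet_Ioi fun t ht => ?_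
  have ht0 : (t : ℂ) ≠ 0 := by
    have : t ≠ 0 := ne_of_gt ht
    exact_mod_cast this
  have hw0 := Complex.slitPlane_ne_zero (add_half_mem_slitPlane hz hz0 (le_of_lt (mem_Ioi.1 ht)))
  simp only [laplaceKernel]
  rw [Complex.cpow_add _ _ hw0, Complex.cpow_add _ _ ht0, Complex.cpow_one, Complex.cpow_one]
  ring

/-- Integration by parts in the Laplace integral. -/
theorem laplaceInt_add_one_left {a : ℂ} (ha : -1 < a.re) (b : ℂ) (hz : z.re = 0)
    (hz0 : z ≠ 0) :
    laplaceInt (a + 1) b z = (a + 1) * laplaceInt a b z +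
      b / 2 * laplaceInt (a + 1) (b - 1) z := by
  have ha' : -1 < (a + 1).re := by simp; linarith
  have ha0 : 0 < (a + 1).re := by simp; linarith
  have ha1 : a + 1 ≠ 0 := fun h => by rw [h] at ha0; simp at ha0
  have i1 := integrableOn_laplaceKernel ha' b hz hz0
  have i2 := (integrableOn_laplaceKernel ha b hz hz0).const_mul (a + 1)
  have i3 := (integrableOn_laplaceKernel ha' (b - 1) hz hz0).const_mul (b / 2)
  have hcont : ContinuousWithinAt (laplaceKernel (a + 1) b z) (Ici 0) 0 := by
    refine ContinuousAt.continuousWithinAt ?_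
    unfold laplaceKernel
    refine ((by fun_prop : ContinuousAt (fun t : ℝ => Complex.exp (-(t : ℂ))) 0).mul
      (Complex.continuousAt_ofReal_cpow_const 0 (a + 1) (Or.inl ha0))).mul ?_
    refine ContinuousAt.cpow (by fun_prop) (by fun_prop) ?_
    exact add_half_mem_slitPlane hz hz0 le_rfl
  have hderiv : ∀ t ∈ Ioi (0 : ℝ), HasDerivAt (laplaceKernel (a + 1) b z)
      (-laplaceKernel (a + 1) b z t + (a + 1) * laplaceKernel a b z t +
        b / 2 * laplaceKernel (a + 1) (b - 1) z t) t := by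
    intro t ht
    have h1 : HasDerivAt (fun t : ℝ => Complex.exp (-(t : ℂ))) (Complex.exp (-(t : ℂ)) * -1) t :=
      ((Complex.ofRealCLM.hasDerivAt (x := t)).neg.cexp).congr_deriv (by simp)
    have h2 := hasDerivAt_ofReal_cpow_const (ne_of_gt ht) ha1
    have h3 : HasDerivAt (fun t : ℝ => z + (t : ℂ) / 2) (1 / 2) t :=
      (((Complex.ofRealCLM.hasDerivAt (x := t)).div_const 2).const_add z).congr_deriv (by simp)
    have h4 : HasDerivAt (fun t : ℝ => (z + (t : ℂ) / 2) ^ b)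
        (b * (z + (t : ℂ) / 2) ^ (b - 1) * (1 / 2)) t := by
      have h5 : HasDerivAt (fun w : ℂ => w ^ b) (b * (z + (t : ℂ) / 2) ^ (b - 1))
          (z + (t : ℂ) / 2) := by
        simpa using (hasDerivAt_id (z + (t : ℂ) / 2)).cpow_const (c := b)
          (add_half_mem_slitPlane hz hz0 (le_of_lt (mem_Ioi.1 ht)))
      exact h5.comp t h3
    refine ((h1.mul h2).mul h4).congr_deriv ?_
    simp only [laplaceKernel, Pi.mul_apply]
    rw [add_sub_cancel_right]
    ring
  have hlim : Tendsto (laplaceKernel (a + 1) b z) atTop (𝓝 0) := by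
    obtain ⟨M, hM0, hM⟩ := exists_norm_laplaceKernel_le (norm_pos_iff.2 hz0) (a + 1) b
    have h1 := (tendsto_rpow_mul_exp_neg_mul_atTop_nhds_zero (a + 1).re (1 / 2)
      (by norm_num)).const_mul (M * ‖z‖ ^ b.re)
    rw [mul_zero] at h1
    refine squeeze_zero_norm' ?_ h1
    filter_upwards [eventually_gt_atTop 0] with t ht
    refine (hM z hz le_rfl t ht).trans (le_of_eq ?_)
    rw [mul_comm (Real.exp _)]
    congr 3
    ring
  have key := integral_Ioi_of_hasDerivAt_of_tendsto hcont hderiv ((i1.neg.add i2).add i3) hlim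
  have h0 : laplaceKernel (a + 1) b z 0 = 0 := by
    simp [laplaceKernel, Complex.zero_cpow ha1]
  rw [h0, sub_zero] at key
  have e1 : ∫ t in Ioi (0 : ℝ), (-laplaceKernel (a + 1) b z t + (a + 1) * laplaceKernel a b z t +
        b / 2 * laplaceKernel (a + 1) (b - 1) z t) =
      -laplaceInt (a + 1) b z + (a + 1) * laplaceInt a b z +
        b / 2 * laplaceInt (a + 1) (b - 1) z := by
    have i4 : Integrable (fun t => -laplaceKernel (a + 1) b z t) (volume.restrict (Ioi 0)) :=
      i1.neg
    have i5 : Integrable (fun t => -laplaceKernel (a + 1) b z t + (a + 1) * laplaceKernel a b z t)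
      (volume.restrict (Ioi 0)) := i4.add i2
    rw [integral_add i5 i3, integral_add i4 i2, integral_const_mul, integral_const_mul,
      integral_neg]
    rfl
  rw [e1] at key
  linear_combination -key

end ImaginaryAxis

/-! ### The Macdonald function on the imaginary axis -/

/-- The point `η ℓ e^x`, where `η = ±i`. -/
def axisPoint (η : ℂ) (ℓ x : ℝ) : ℂ := η * ((ℓ * Real.exp x : ℝ) : ℂ)

theorem re_axisPoint {η : ℂ} (hη : η = Complex.I ∨ η = -Complex.I) (ℓ x : ℝ) :
    (axisPoint η ℓ x).re = 0 := by
  rw [axisPoint, Complex.re_mul_ofReal]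
  rcases hη with rfl | rfl <;> simp

theorem norm_axisPoint {η : ℂ} (hη : η = Complex.I ∨ η = -Complex.I) {ℓ : ℝ} (hℓ : 0 < ℓ) (x : ℝ) :
    ‖axisPoint η ℓ x‖ = ℓ * Real.exp x := by
  rw [axisPoint, norm_mul, Complex.norm_real, Real.norm_of_nonneg (by positivity)]
  rcases hη with rfl | rfl <;> simp

theorem axisPoint_ne_zero {η : ℂ} (hη : η = Complex.I ∨ η = -Complex.I) {ℓ : ℝ} (hℓ : 0 < ℓ)
    (x : ℝ) : axisPoint η ℓ x ≠ 0 := by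
  rw [← norm_pos_iff, norm_axisPoint hη hℓ]
  positivity

theorem axisPoint_sq {η : ℂ} (hη : η = Complex.I ∨ η = -Complex.I) (ℓ x : ℝ) :
    axisPoint η ℓ x ^ 2 = -((ℓ ^ 2 * Real.exp (2 * x) : ℝ) : ℂ) := by
  have h : η ^ 2 = -1 := by rcases hη with rfl | rfl <;> simp
  rw [axisPoint, mul_pow, h, two_mul, Real.exp_add]
  push_cast
  ring

theorem hasDerivAt_axisPoint (η : ℂ) (ℓ x : ℝ) :
    HasDerivAt (axisPoint η ℓ) (axisPoint η ℓ x) x :=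
  ((((Real.hasDerivAt_exp x).const_mul ℓ).ofReal_comp).const_mul η)

theorem tendsto_axisPoint_atBot (η : ℂ) (ℓ : ℝ) : Tendsto (axisPoint η ℓ) atBot (𝓝 0) := by
  have h : Tendsto (fun x => ((ℓ * Real.exp x : ℝ) : ℂ)) atBot (𝓝 ((ℓ * 0 : ℝ) : ℂ)) :=
    (Complex.continuous_ofReal.tendsto _).comp (Real.tendsto_exp_atBot.const_mul ℓ)
  have h2 := h.const_mul η
  rw [mul_zero, Complex.ofReal_zero, mul_zero] at h2
  exact h2

/-- Differentiation under the integral sign along the imaginary axis. -/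
theorem hasDerivAt_laplaceInt {η : ℂ} (hη : η = Complex.I ∨ η = -Complex.I) {ℓ : ℝ} (hℓ : 0 < ℓ)
    {a : ℂ} (ha : -1 < a.re) (b : ℂ) (x : ℝ) :
    HasDerivAt (fun x => laplaceInt a b (axisPoint η ℓ x))
      (b * axisPoint η ℓ x * laplaceInt a (b - 1) (axisPoint η ℓ x)) x := by
  set c : ℝ := ℓ * Real.exp (x - 1) with hc
  have hc0 : 0 < c := by positivity
  obtain ⟨M, hM0, hM⟩ := exists_norm_laplaceKernel_le hc0 a (b - 1)
  -- `N` bounds `|axisPoint η ℓ y| ^ Re b` for `|y - x| < 1`, whatever the sign of `Re b`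
  set N : ℝ := ℓ ^ b.re * Real.exp (|b.re| * (|x| + 1)) with hN
  have hNb : ∀ y ∈ Metric.ball x 1, (ℓ * Real.exp y) ^ b.re ≤ N := by
    intro y hy
    rw [Metric.mem_ball, Real.dist_eq] at hy
    rw [Real.mul_rpow hℓ.le (Real.exp_nonneg y), ← Real.exp_mul, hN]
    refine mul_le_mul_of_nonneg_left (Real.exp_le_exp.2 ?_) (by positivity)
    have h1 : |y| ≤ |x| + 1 := by
      have := abs_sub_abs_le_abs_sub y x
      linarith
    calc y * b.re ≤ |y * b.re| := le_abs_self _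
      _ = |b.re| * |y| := by rw [abs_mul, mul_comm]
      _ ≤ _ := by gcongr
  have key := hasDerivAt_integral_of_dominated_loc_of_deriv_le
    (μ := volume.restrict (Ioi (0 : ℝ))) (𝕜 := ℝ)
    (F := fun y t => laplaceKernel a b (axisPoint η ℓ y) t)
    (F' := fun y t => b * axisPoint η ℓ y * laplaceKernel a (b - 1) (axisPoint η ℓ y) t)
    (bound := fun t => ‖b‖ * M * N * (Real.exp (-t / 2) * t ^ a.re))
    (x₀ := x) (Metric.ball_mem_nhds x one_pos)
    (Eventually.of_forall fun y => aestronglyMeasurable_laplaceKernel a b _)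
    (integrableOn_laplaceKernel ha b (re_axisPoint hη ℓ x) (axisPoint_ne_zero hη hℓ x))
    ((aestronglyMeasurable_laplaceKernel a (b - 1) _).const_mul _)
    (by
      filter_upwards [ae_restrict_mem measurableSet_Ioi] with t ht y hy
      have ht0 : (0 : ℝ) < t := ht
      have hy' := hNb y hy
      rw [Metric.mem_ball, Real.dist_eq] at hy
      have hcy : c ≤ ‖axisPoint η ℓ y‖ := by
        rw [norm_axisPoint hη hℓ, hc]
        gcongr
        linarith [(abs_lt.1 hy).1]
      have h1 := hM _ (re_axisPoint hη ℓ y) hcy t ht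
      rw [norm_mul, norm_mul]
      have hpos : 0 < ‖axisPoint η ℓ y‖ := hc0.trans_le hcy
      calc ‖b‖ * ‖axisPoint η ℓ y‖ * ‖laplaceKernel a (b - 1) (axisPoint η ℓ y) t‖
          ≤ ‖b‖ * ‖axisPoint η ℓ y‖ * (M * ‖axisPoint η ℓ y‖ ^ (b - 1).re *
            (Real.exp (-t / 2) * t ^ a.re)) := by gcongr
        _ = ‖b‖ * M * ‖axisPoint η ℓ y‖ ^ b.re * (Real.exp (-t / 2) * t ^ a.re) := by
          rw [Complex.sub_re, Complex.one_re, Real.rpow_sub_one hpos.ne']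
          field_simp
        _ ≤ _ := by
          rw [norm_axisPoint hη hℓ]
          gcongr)
    ((integrableOn_exp_half_mul_rpow ha).const_mul _)
    (by
      filter_upwards [ae_restrict_mem measurableSet_Ioi] with t ht y _
      have h5 : HasDerivAt (fun w : ℂ => w ^ b)
          (b * (axisPoint η ℓ y + (t : ℂ) / 2) ^ (b - 1)) (axisPoint η ℓ y + (t : ℂ) / 2) := by
        simpa using (hasDerivAt_id (axisPoint η ℓ y + (t : ℂ) / 2)).cpow_const (c := b)
          (add_half_mem_slitPlane (re_axisPoint hη ℓ y) (axisPoint_ne_zero hη hℓ y)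
            (le_of_lt (mem_Ioi.1 ht)))
      have h6 := (h5.comp y ((hasDerivAt_axisPoint η ℓ y).add_const ((t : ℂ) / 2))).const_mul
        (Complex.exp (-(t : ℂ)) * (t : ℂ) ^ a)
      refine h6.congr_deriv ?_
      rw [laplaceKernel]
      ring)
  refine key.2.congr_deriv ?_
  rw [integral_const_mul]
  rfl

/-- The limit of the Laplace integral as `z → 0` is a value of the Gamma function. -/
theorem tendsto_laplaceInt_atBot {η : ℂ} (hη : η = Complex.I ∨ η = -Complex.I) {ℓ : ℝ} (hℓ : 0 < ℓ)
    {a b : ℂ} (ha : -1 < a.re) (hab : -1 < a.re + b.re) :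
    Tendsto (fun x => laplaceInt a b (axisPoint η ℓ x)) atBot
      (𝓝 (((1 / 2 : ℝ) : ℂ) ^ b * Complex.Gamma (a + b + 1))) := by
  have hval : ((1 / 2 : ℝ) : ℂ) ^ b * Complex.Gamma (a + b + 1) = laplaceInt a b 0 := by
    rw [Complex.Gamma_eq_integral (by simp; linarith), Complex.GammaIntegral, laplaceInt,
      ← integral_const_mul]
    refine setIntegral_congr_fun measurableSet_Ioi fun t ht => ?_
    have ht0 : (0 : ℝ) < t := ht
    have ht1 : (t : ℂ) ≠ 0 := by exact_mod_cast ht0.ne'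
    simp only [laplaceKernel]
    rw [zero_add, add_sub_cancel_right, Complex.cpow_add _ _ ht1,
      show (t : ℂ) / 2 = ((1 / 2 : ℝ) : ℂ) * (t : ℂ) by push_cast; ring,
      Complex.mul_cpow_ofReal_nonneg (by norm_num) ht0.le, Complex.ofReal_exp, Complex.ofReal_neg]
    ring
  rw [hval]
  obtain ⟨K, hK0, hK⟩ := exists_one_add_div_rpow_le hℓ b.re
  refine tendsto_integral_filter_of_dominated_convergence
    (fun t => Real.exp (Real.pi * |b.im|) * ℓ ^ b.re * K * (Real.exp (-t / 2) * t ^ a.re) +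
      Real.exp (Real.pi * |b.im|) * (1 / 2) ^ b.re * (Real.exp (-t / 2) * t ^ (a.re + b.re)))
    (Eventually.of_forall fun x => aestronglyMeasurable_laplaceKernel a b _) ?_
    (((integrableOn_exp_half_mul_rpow ha).const_mul _).add
      ((integrableOn_exp_half_mul_rpow hab).const_mul _)) ?_
  · filter_upwards [eventually_le_atBot 0] with x hx
    filter_upwards [ae_restrict_mem measurableSet_Ioi] with t ht
    have ht0 : (0 : ℝ) < t := ht
    set z := axisPoint η ℓ x with hz
    obtain ⟨h1, h2, h3⟩ := norm_le_norm_add_half (re_axisPoint hη ℓ x) ht0.le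
    rw [← hz] at h1 h2 h3
    have hzℓ : ‖z‖ ≤ ℓ := by
      rw [hz, norm_axisPoint hη hℓ]
      exact mul_le_of_le_one_right hℓ.le (Real.exp_le_one_iff.2 hx)
    rw [laplaceKernel, norm_mul, norm_exp_mul_cpow ht0]
    -- the first term is needed for `Re b ≥ 0`, the second for `Re b ≤ 0`
    have h4 : ‖z + t / 2‖ ^ b.re ≤
        ℓ ^ b.re * K * Real.exp (t / 2) + (1 / 2) ^ b.re * t ^ b.re := by
      rcases le_total 0 b.re with hb | hb
      · refine le_add_of_le_of_nonneg ?_ (by positivity)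
        calc ‖z + t / 2‖ ^ b.re ≤ (ℓ * (1 + t / ℓ)) ^ b.re := by
              gcongr
              have : ℓ * (1 + t / ℓ) = ℓ + t := by field_simp
              linarith
          _ = ℓ ^ b.re * (1 + t / ℓ) ^ |b.re| := by
              rw [Real.mul_rpow hℓ.le (by positivity), abs_of_nonneg hb]
          _ ≤ ℓ ^ b.re * (K * Real.exp (t / 2)) := by
              gcongr
              exact hK t ht0.le
          _ = _ := by ring
      · refine le_add_of_nonneg_of_le (by positivity) ?_
        rw [← Real.mul_rpow (by norm_num) ht0.le]
        exact Real.rpow_le_rpow_of_nonpos (by positivity) (by linarith) hb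
    have he : Real.exp (-t) * Real.exp (t / 2) = Real.exp (-t / 2) := by
      rw [← Real.exp_add]; ring_nf
    have he' : Real.exp (-t) ≤ Real.exp (-t / 2) := Real.exp_le_exp.2 (by linarith)
    calc Real.exp (-t) * t ^ a.re * ‖(z + t / 2) ^ b‖
        ≤ Real.exp (-t) * t ^ a.re * (Real.exp (Real.pi * |b.im|) *
          (ℓ ^ b.re * K * Real.exp (t / 2) + (1 / 2) ^ b.re * t ^ b.re)) := by
          gcongr
          exact (norm_cpow_le_exp _ _).trans (by gcongr)
      _ = Real.exp (Real.pi * |b.im|) * ℓ ^ b.re * K *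
            ((Real.exp (-t) * Real.exp (t / 2)) * t ^ a.re) +
          Real.exp (Real.pi * |b.im|) * (1 / 2) ^ b.re *
            (Real.exp (-t) * t ^ (a.re + b.re)) := by
          rw [Real.rpow_add ht0]; ring
      _ ≤ _ := by
          rw [he]
          gcongr
  · filter_upwards [ae_restrict_mem measurableSet_Ioi] with t ht
    have ht0 : (0 : ℝ) < t := ht
    unfold laplaceKernel
    refine Tendsto.const_mul _ ?_
    have h1 : ContinuousAt (fun w : ℂ => w ^ b) (0 + (t : ℂ) / 2) := by
      refine ContinuousAt.cpow continuousAt_id continuousAt_const ?_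
      left
      simpa using ht0
    exact h1.tendsto.comp ((tendsto_axisPoint_atBot η ℓ).add_const ((t : ℂ) / 2))

theorem mul_cpow_of_re_nonneg {z w : ℂ} (hz : 0 ≤ z.re) (hz0 : z ≠ 0) (hw : 0 < w.re) (b : ℂ) :
    (z * w) ^ b = z ^ b * w ^ b := by
  have hw0 : w ≠ 0 := fun h => by simp [h] at hw
  have h1 := abs_le.1 (Complex.abs_arg_le_pi_div_two_iff.2 hz)
  have h2 := abs_lt.1 (Complex.abs_arg_lt_pi_div_two_iff.2 (Or.inl hw))
  rw [Complex.cpow_def_of_ne_zero (mul_ne_zero hz0 hw0), Complex.cpow_def_of_ne_zero hz0,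
    Complex.cpow_def_of_ne_zero hw0, ← Complex.exp_add,
    Complex.log_mul_eq_add_log_iff hz0 hw0 |>.2 ⟨by linarith, by linarith⟩]
  ring_nf

/-- The function `x ↦ η^m K_m(η ℓ e^x)`, written with the Laplace integral. -/
def macdonaldExp (η : ℂ) (ℓ : ℝ) (m : ℂ) (x : ℝ) : ℂ :=
  ((Real.pi / 2 : ℝ) : ℂ) ^ (1 / 2 : ℂ) * (Complex.Gamma (m + 1 / 2))⁻¹ * (ℓ : ℂ) ^ (-m) *
    (Complex.exp (-m * x) * Complex.exp (-axisPoint η ℓ x) *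
      laplaceInt (m - 1 / 2) (m - 1 / 2) (axisPoint η ℓ x))

/-- The factor `η^m` removes the oscillating constant from the Macdonald function. All powers of
products split, since the factors are positive, or lie in the closed and in the open right
half-plane. -/
theorem cpow_mul_macdonaldK {η : ℂ} (hη : η = Complex.I ∨ η = -Complex.I) {ℓ : ℝ} (hℓ : 0 < ℓ)
    (m : ℂ) (x : ℝ) :
    η ^ m * macdonaldK m (η * ((ℓ * Real.exp x : ℝ) : ℂ)) = macdonaldExp η ℓ m x := by
  set r : ℝ := ℓ * Real.exp x with hr
  have hr0 : 0 < r := by positivity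
  have hrc : (r : ℂ) ≠ 0 := by exact_mod_cast hr0.ne'
  have hη0 : η ≠ 0 := by rcases hη with rfl | rfl <;> simp
  have hηre : η.re = 0 := by rcases hη with rfl | rfl <;> simp
  have hηarg : η.arg ≠ Real.pi := by
    intro h
    rw [Complex.arg_eq_pi_iff] at h
    linarith [h.1]
  have hz0 : η * (r : ℂ) ≠ 0 := mul_ne_zero hη0 hrc
  have hzre : (η * (r : ℂ)).re = 0 := by rw [Complex.re_mul_ofReal, hηre, zero_mul]
  set b := m - 1 / 2 with hb
  have h1 : ((Real.pi : ℂ) / (2 * (η * (r : ℂ)))) ^ (1 / 2 : ℂ) = (η ^ (1 / 2 : ℂ))⁻¹ *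
      (((Real.pi / 2 : ℝ) : ℂ) ^ (1 / 2 : ℂ) * ((r : ℂ) ^ (1 / 2 : ℂ))⁻¹) := by
    have e1 : (Real.pi : ℂ) / (2 * (η * (r : ℂ))) =
        η⁻¹ * (((Real.pi / 2 : ℝ) : ℂ) * ((r⁻¹ : ℝ) : ℂ)) := by
      push_cast
      field_simp
    have hpos : 0 < Real.pi / 2 * r⁻¹ := by positivity
    rw [e1, mul_cpow_of_re_nonneg, Complex.inv_cpow _ _ hηarg,
      Complex.mul_cpow_ofReal_nonneg (by positivity) (by positivity), Complex.ofReal_inv,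
      Complex.inv_cpow _ _ (by rw [Complex.arg_ofReal_of_nonneg hr0.le]; exact Real.pi_pos.ne)]
    · rw [Complex.inv_re, hηre, zero_div]
    · exact inv_ne_zero hη0
    · rw [← Complex.ofReal_mul, Complex.ofReal_re]
      exact hpos
  -- with `z = η r`, the factor `1 + t/(2z)` of the integrand lies in the right half-plane
  have h2 : laplaceInt b b (η * (r : ℂ)) = (η * (r : ℂ)) ^ b *
      ∫ t in Ioi (0 : ℝ), Complex.exp (-(t : ℂ)) * (t : ℂ) ^ (1 / 2 + m - 1) *
        (1 - -1 / (2 * (η * (r : ℂ))) * (t : ℂ)) ^ (-(1 / 2 - m)) := by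
    rw [laplaceInt, ← integral_const_mul]
    refine setIntegral_congr_fun measurableSet_Ioi fun t ht => ?_
    have e2 : η * (r : ℂ) + t / 2 = η * (r : ℂ) * (1 - -1 / (2 * (η * (r : ℂ))) * (t : ℂ)) := by
      field_simp
      ring
    have e3 : 0 < (1 - -1 / (2 * (η * (r : ℂ))) * (t : ℂ)).re := by
      have : -1 / (2 * (η * (r : ℂ))) * (t : ℂ) = (η * (r : ℂ))⁻¹ * ((-(t / 2) : ℝ) : ℂ) := by
        push_cast
        field_simp
      rw [this, Complex.sub_re, Complex.re_mul_ofReal, Complex.inv_re, hzre]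
      simp
    simp only [laplaceKernel]
    rw [e2, mul_cpow_of_re_nonneg hzre.ge hz0 e3, hb, show (1 / 2 + m - 1 : ℂ) = m - 1 / 2 by ring,
      show -(1 / 2 - m) = m - 1 / 2 by ring]
    ring
  have h3 : η ^ m = η ^ b * η ^ (1 / 2 : ℂ) := by
    rw [← Complex.cpow_add _ _ hη0, hb]; ring_nf
  have h4 : (η * (r : ℂ)) ^ b = η ^ b * (r : ℂ) ^ b :=
    mul_cpow_of_re_nonneg hηre.ge hη0 (by simpa using hr0) b
  have h5 : (r : ℂ) ^ (-m) = ((r : ℂ) ^ b)⁻¹ * ((r : ℂ) ^ (1 / 2 : ℂ))⁻¹ := by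
    rw [← mul_inv, ← Complex.cpow_add _ _ hrc, hb, Complex.cpow_neg]
    ring_nf
  have h6 : (r : ℂ) ^ (-m) = (ℓ : ℂ) ^ (-m) * Complex.exp (-m * x) := cpow_scaled_exp hℓ (-m) x
  have hηb : η ^ b ≠ 0 := by simp [Complex.cpow_eq_zero_iff, hη0]
  have hη2 : η ^ (1 / 2 : ℂ) ≠ 0 := by simp [Complex.cpow_eq_zero_iff, hη0]
  have hrb : (r : ℂ) ^ b ≠ 0 := by
    rw [Ne, Complex.cpow_eq_zero_iff]
    exact fun h => hrc h.1
  have hax : axisPoint η ℓ x = η * (r : ℂ) := rfl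
  rw [macdonaldExp, macdonaldK, hyp2F0, hax, h1, ← hb, h2, h3, h4, add_comm (1 / 2 : ℂ) m]
  rw [add_comm m (1 / 2 : ℂ)]
  set J := ∫ t in Ioi (0 : ℝ), Complex.exp (-(t : ℂ)) * (t : ℂ) ^ (1 / 2 + m - 1) *
        (1 - -1 / (2 * (η * (r : ℂ))) * (t : ℂ)) ^ (-(1 / 2 - m)) with hJ
  have h7 : (ℓ : ℂ) ^ (-m) * Complex.exp (-m * x) =
      ((r : ℂ) ^ b)⁻¹ * ((r : ℂ) ^ (1 / 2 : ℂ))⁻¹ := by rw [← h6, h5]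
  have hη2' : η ^ (1 / 2 : ℂ) * (η ^ (1 / 2 : ℂ))⁻¹ = 1 := mul_inv_cancel₀ hη2
  have hrb' : ((r : ℂ) ^ b)⁻¹ * (r : ℂ) ^ b = 1 := inv_mul_cancel₀ hrb
  set X := ((Real.pi / 2 : ℝ) : ℂ) ^ (1 / 2 : ℂ)
  set G := (Complex.Gamma (1 / 2 + m))⁻¹
  set E := Complex.exp (-(η * (r : ℂ)))
  linear_combination (η ^ b * X * ((r : ℂ) ^ (1 / 2 : ℂ))⁻¹ * E * G * J) * hη2' -
    (η ^ b * X * ((r : ℂ) ^ (1 / 2 : ℂ))⁻¹ * E * G * J) * hrb' -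
    (X * G * E * η ^ b * (r : ℂ) ^ b * J) * h7

/-! ### Differential equation and asymptotics of the Macdonald function -/

/-- The derivative of `macdonaldExp`. -/
def macdonaldExpDeriv (η : ℂ) (ℓ : ℝ) (m : ℂ) (x : ℝ) : ℂ :=
  ((Real.pi / 2 : ℝ) : ℂ) ^ (1 / 2 : ℂ) * (Complex.Gamma (m + 1 / 2))⁻¹ * (ℓ : ℂ) ^ (-m) *
    (Complex.exp (-m * x) * Complex.exp (-axisPoint η ℓ x) *
      ((m - 1 / 2) * axisPoint η ℓ x *
          laplaceInt (m - 1 / 2) (m - 1 / 2 - 1) (axisPoint η ℓ x) -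
        (m + axisPoint η ℓ x) * laplaceInt (m - 1 / 2) (m - 1 / 2) (axisPoint η ℓ x)))

section Macdonald

variable {η : ℂ} {ℓ : ℝ} {m : ℂ}

theorem neg_one_lt_re_sub_half (hm : 0 < m.re) : -1 < (m - 1 / 2).re := by
  have : ((1 : ℂ) / 2).re = 1 / 2 := by norm_num
  rw [Complex.sub_re, this]
  linarith

/-- The differential equation follows from the contiguity relations of the Laplace integral. -/
theorem isSolution_macdonaldExp (hη : η = Complex.I ∨ η = -Complex.I) (hℓ : 0 < ℓ)
    (hm : 0 < m.re) :
    IsSolution ℓ (-m ^ 2) (macdonaldExp η ℓ m) (macdonaldExpDeriv η ℓ m) := by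
  intro x
  have ha := neg_one_lt_re_sub_half hm
  set b := m - 1 / 2 with hb
  set z := axisPoint η ℓ x with hz
  have hzre : z.re = 0 := re_axisPoint hη ℓ x
  have hz0 : z ≠ 0 := axisPoint_ne_zero hη hℓ x
  have hd0 := hasDerivAt_laplaceInt hη hℓ ha b x
  have hd1 := hasDerivAt_laplaceInt hη hℓ ha (b - 1) x
  have hzd := hasDerivAt_axisPoint η ℓ x
  have hE := (hasDerivAt_exp_mul_ofReal (-m) x).mul hzd.neg.cexp
  have r1 := laplaceInt_add_one_right ha (b - 1) hzre hz0
  have r2 := laplaceInt_add_one_right ha (b - 1 - 1) hzre hz0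
  have r3 := laplaceInt_add_one_left ha (b - 1) hzre hz0
  rw [sub_add_cancel] at r1 r2
  constructor
  · refine ((hE.mul hd0).const_mul (((Real.pi / 2 : ℝ) : ℂ) ^ (1 / 2 : ℂ) *
      (Complex.Gamma (m + 1 / 2))⁻¹ * (ℓ : ℂ) ^ (-m))).congr_deriv ?_
    simp only [macdonaldExpDeriv, ← hb, ← hz, Pi.mul_apply, Pi.neg_apply]
    ring
  · refine ((hE.mul (((hzd.const_mul b).mul hd1).sub ((hzd.const_add m).mul hd0))).const_mul
      (((Real.pi / 2 : ℝ) : ℂ) ^ (1 / 2 : ℂ) *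
      (Complex.Gamma (m + 1 / 2))⁻¹ * (ℓ : ℂ) ^ (-m))).congr_deriv ?_
    have hV := axisPoint_sq hη ℓ x
    rw [← neg_eq_iff_eq_neg] at hV
    simp only [macdonaldExp, ← hb, ← hz, Pi.mul_apply, Pi.neg_apply, Pi.sub_apply]
    rw [← hV, ← hz]
    have hmb : m = b + 1 / 2 := by rw [hb]; ring
    set P := ((Real.pi / 2 : ℝ) : ℂ) ^ (1 / 2 : ℂ) *
      (Complex.Gamma (m + 1 / 2))⁻¹ * (ℓ : ℂ) ^ (-m) *
      (Complex.exp (-m * x) * Complex.exp (-z)) with hP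
    linear_combination (P * b * z) * (2 * r1 + r3 - (b - 1) * r2) +
      (P * (2 * z * laplaceInt b b z - 2 * b * z * laplaceInt b (b - 1) z)) * hmb

/-- The function `e^{-x/2} e^{-η ℓ e^x}`, a multiple of `H^±_{1/2}(ℓ e^x)`. -/
def boundaryFun (η : ℂ) (ℓ x : ℝ) : ℂ :=
  Complex.exp (-(1 / 2) * x) * Complex.exp (-axisPoint η ℓ x)

/-- The derivative of `boundaryFun`. -/
def boundaryFunDeriv (η : ℂ) (ℓ x : ℝ) : ℂ :=
  -(1 / 2 + axisPoint η ℓ x) * boundaryFun η ℓ x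

theorem isSolution_boundaryFun (hη : η = Complex.I ∨ η = -Complex.I) (ℓ : ℝ) :
    IsSolution ℓ (-(1 / 4)) (boundaryFun η ℓ) (boundaryFunDeriv η ℓ) := by
  intro x
  have hzd := hasDerivAt_axisPoint η ℓ x
  have h1 : HasDerivAt (boundaryFun η ℓ) (boundaryFunDeriv η ℓ x) x :=
    ((hasDerivAt_exp_mul_ofReal (-(1 / 2)) x).mul hzd.neg.cexp).congr_deriv (by
      simp only [boundaryFunDeriv, boundaryFun, Pi.neg_apply]
      ring)
  refine ⟨h1, ((hzd.const_add (1 / 2)).neg.mul h1).congr_deriv ?_⟩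
  have hV := axisPoint_sq hη ℓ x
  rw [← neg_eq_iff_eq_neg] at hV
  rw [← hV, boundaryFunDeriv]
  simp only [Pi.neg_apply]
  ring

/-- The Wronskian of the two boundary functions. -/
theorem wronskian_boundaryFun (η : ℂ) (ℓ x : ℝ) :
    boundaryFun η ℓ x * boundaryFunDeriv (-η) ℓ x - boundaryFunDeriv η ℓ x * boundaryFun (-η) ℓ x =
      2 * η * ℓ := by
  have h1 : axisPoint (-η) ℓ x = -axisPoint η ℓ x := by simp [axisPoint]
  have h2 : Complex.exp (-(1 / 2) * x) * Complex.exp (-(1 / 2) * x) * Complex.exp x = 1 := by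
    rw [← Complex.exp_add, ← Complex.exp_add]; ring_nf; simp
  have h3 : Complex.exp (-axisPoint η ℓ x) * Complex.exp (axisPoint η ℓ x) = 1 := by
    rw [← Complex.exp_add]; simp
  simp only [boundaryFunDeriv, boundaryFun, h1, neg_neg]
  have h4 : axisPoint η ℓ x = η * ℓ * Complex.exp x := by
    rw [axisPoint]; push_cast; ring
  set A := Complex.exp (-axisPoint η ℓ x)
  set B := Complex.exp (axisPoint η ℓ x)
  rw [h4]
  linear_combination (2 * η * ℓ * A * B) * h2 + (2 * η * ℓ) * h3

/-- For `m = 1/2` the Macdonald function is elementary, up to a constant. -/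
theorem exists_macdonaldExp_half (η : ℂ) (hℓ : 0 < ℓ) :
    ∃ c : ℂ, c ≠ 0 ∧ ∀ x, macdonaldExp η ℓ (1 / 2) x = c * boundaryFun η ℓ x := by
  have hℓ0 : (ℓ : ℂ) ≠ 0 := by exact_mod_cast hℓ.ne'
  have hpi : ((Real.pi / 2 : ℝ) : ℂ) ≠ 0 := by
    have : Real.pi / 2 ≠ 0 := by positivity
    exact_mod_cast this
  refine ⟨((Real.pi / 2 : ℝ) : ℂ) ^ (1 / 2 : ℂ) * (ℓ : ℂ) ^ (-(1 / 2) : ℂ), ?_, fun x => ?_⟩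
  · refine mul_ne_zero ?_ ?_
    · rw [Ne, Complex.cpow_eq_zero_iff]; exact fun h => hpi h.1
    · rw [Ne, Complex.cpow_eq_zero_iff]; exact fun h => hℓ0 h.1
  · have h1 : ∀ w, laplaceInt 0 0 w = 1 := by
      intro w
      have := Complex.Gamma_eq_integral (s := 1) (by simp)
      rw [Complex.Gamma_one, Complex.GammaIntegral] at this
      rw [this, laplaceInt]
      refine setIntegral_congr_fun measurableSet_Ioi fun t _ => ?_
      simp [laplaceKernel]
    rw [macdonaldExp, boundaryFun, sub_self, h1]
    norm_num

/-- `e^{-x/2} e^{-η ℓ e^x}` and `K_m(η ℓ e^x)` satisfy the same boundary condition at `+∞`. -/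
theorem tendsto_wronskian_macdonaldExp (hη : η = Complex.I ∨ η = -Complex.I) (hℓ : 0 < ℓ)
    (hm : 0 < m.re) :
    Tendsto (fun x => boundaryFun η ℓ x * macdonaldExpDeriv η ℓ m x -
      boundaryFunDeriv η ℓ x * macdonaldExp η ℓ m x) atTop (𝓝 0) := by
  have ha := neg_one_lt_re_sub_half hm
  have ha' : -1 < (m - 1 / 2 + 1).re := by rw [Complex.add_re, Complex.one_re]; linarith
  set b := m - 1 / 2 with hb
  obtain ⟨M, hM0, hM⟩ := exists_norm_laplaceInt_le hℓ ha' (b - 1)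
  set P := ((Real.pi / 2 : ℝ) : ℂ) ^ (1 / 2 : ℂ) *
      (Complex.Gamma (m + 1 / 2))⁻¹ * (ℓ : ℂ) ^ (-m) with hP
  -- the leading terms cancel, and a term of relative size `1/|z|` remains
  have hW : ∀ x, boundaryFun η ℓ x * macdonaldExpDeriv η ℓ m x -
      boundaryFunDeriv η ℓ x * macdonaldExp η ℓ m x =
      -(b / 2) * P * (Complex.exp (-axisPoint η ℓ x) ^ 2) *
        (Complex.exp (-(1 / 2) * x) * Complex.exp (-m * x)) *
        laplaceInt (b + 1) (b - 1) (axisPoint η ℓ x) := by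
    intro x
    have r1 := laplaceInt_add_one_right ha (b - 1) (re_axisPoint hη ℓ x)
      (axisPoint_ne_zero hη hℓ x)
    rw [sub_add_cancel] at r1
    simp only [macdonaldExp, macdonaldExpDeriv, boundaryFunDeriv, boundaryFun, ← hb]
    set z := axisPoint η ℓ x
    have hmb : m = b + 1 / 2 := by rw [hb]; ring
    linear_combination (-b * P * (Complex.exp (-z) ^ 2) *
        (Complex.exp (-(1 / 2) * x) * Complex.exp (-m * x))) * r1 -
      (P * (Complex.exp (-z) ^ 2) *
        (Complex.exp (-(1 / 2) * x) * Complex.exp (-m * x)) * laplaceInt b b z) * hmb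
  have hlim : Tendsto (fun x : ℝ => ‖-(b / 2) * P‖ * M * ℓ ^ (b - 1).re * Real.exp (-(2 * x))) atTop
      (𝓝 0) := by
    have h1 : Tendsto (fun x : ℝ => Real.exp (-(2 * x))) atTop (𝓝 0) :=
      Real.tendsto_exp_neg_atTop_nhds_zero.comp (tendsto_id.const_mul_atTop (by norm_num))
    simpa using h1.const_mul (‖-(b / 2) * P‖ * M * ℓ ^ (b - 1).re)
  refine squeeze_zero_norm' ?_ hlim
  filter_upwards [eventually_ge_atTop 0] with x hx
  have h1 : ℓ ≤ ‖axisPoint η ℓ x‖ := by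
    rw [norm_axisPoint hη hℓ]
    exact le_mul_of_one_le_right hℓ.le (Real.one_le_exp hx)
  have h2 := hM _ (re_axisPoint hη ℓ x) h1
  rw [norm_axisPoint hη hℓ, Real.mul_rpow hℓ.le (Real.exp_nonneg x), ← Real.exp_mul] at h2
  have h3 : ‖Complex.exp (-axisPoint η ℓ x)‖ = 1 := by
    rw [Complex.norm_exp, Complex.neg_re, re_axisPoint hη]; simp
  have h4 : ‖Complex.exp (-(1 / 2) * x) * Complex.exp (-m * x)‖ =
      Real.exp (-(1 / 2 + m.re) * x) := by
    have h5 : ((1 : ℂ) / 2).re = 1 / 2 := by norm_num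
    have h6 : (-(1 / 2) + -m : ℂ).re = -(1 / 2 + m.re) := by
      rw [Complex.add_re, Complex.neg_re, Complex.neg_re, h5]
      ring
    rw [← Complex.exp_add, Complex.norm_exp, ← add_mul, Complex.re_mul_ofReal, h6]
  have hbre : (b - 1).re = m.re - 3 / 2 := by
    have : ((1 : ℂ) / 2).re = 1 / 2 := by norm_num
    rw [hb, Complex.sub_re, Complex.sub_re, this, Complex.one_re]
    ring
  rw [hW, norm_mul, norm_mul, norm_mul, norm_pow, h3, h4, one_pow, mul_one]
  calc ‖-(b / 2) * P‖ * Real.exp (-(1 / 2 + m.re) * x) *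
        ‖laplaceInt (b + 1) (b - 1) (axisPoint η ℓ x)‖
      ≤ ‖-(b / 2) * P‖ * Real.exp (-(1 / 2 + m.re) * x) *
        (M * (ℓ ^ (b - 1).re * Real.exp (x * (b - 1).re))) := by gcongr
    _ = ‖-(b / 2) * P‖ * M * ℓ ^ (b - 1).re *
        (Real.exp (-(1 / 2 + m.re) * x) * Real.exp (x * (b - 1).re)) := by ring
    _ = _ := by
      rw [← Real.exp_add, hbre]
      congr 2
      ring

theorem tendsto_exp_mul_of_tendsto {f : ℝ → ℂ} {A L : ℂ} (m : ℂ) (η : ℂ) (ℓ : ℝ)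
    (h : Tendsto f atBot (𝓝 L)) :
    Tendsto (fun x : ℝ => Complex.exp (m * x) *
      (A * (Complex.exp (-m * x) * Complex.exp (-axisPoint η ℓ x) * f x))) atBot (𝓝 (A * L)) := by
  have h1 : Tendsto (fun x => Complex.exp (-axisPoint η ℓ x)) atBot (𝓝 1) := by
    have := (Complex.continuous_exp.tendsto _).comp (tendsto_axisPoint_atBot η ℓ).neg
    simpa using! this
  have h2 := (h1.mul h).const_mul A
  rw [one_mul] at h2
  refine h2.congr fun x => ?_
  have : Complex.exp (m * x) * Complex.exp (-m * x) = 1 := by rw [← Complex.exp_add]; simp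
  linear_combination (-A * Complex.exp (-axisPoint η ℓ x) * f x) * this

/-- The limit of `e^{mx} η^m K_m(η ℓ e^x)` at `-∞`. -/
def macdonaldLimit (ℓ : ℝ) (m : ℂ) : ℂ :=
  ((Real.pi / 2 : ℝ) : ℂ) ^ (1 / 2 : ℂ) * (Complex.Gamma (m + 1 / 2))⁻¹ * (ℓ : ℂ) ^ (-m) *
    (((1 / 2 : ℝ) : ℂ) ^ (m - 1 / 2) * Complex.Gamma (2 * m))

theorem tendsto_macdonaldExp_atBot (hη : η = Complex.I ∨ η = -Complex.I) (hℓ : 0 < ℓ)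
    (hm : 0 < m.re) :
    Tendsto (fun x : ℝ => Complex.exp (m * x) * macdonaldExp η ℓ m x) atBot
      (𝓝 (macdonaldLimit ℓ m)) := by
  have ha := neg_one_lt_re_sub_half hm
  have h2 : ((1 : ℂ) / 2).re = 1 / 2 := by norm_num
  have h := tendsto_laplaceInt_atBot hη hℓ ha (b := m - 1 / 2) (by
    rw [Complex.sub_re, h2]; linarith)
  rw [show m - 1 / 2 + (m - 1 / 2) + 1 = 2 * m by ring] at h
  exact tendsto_exp_mul_of_tendsto m η ℓ h

theorem tendsto_macdonaldExpDeriv_atBot (hη : η = Complex.I ∨ η = -Complex.I) (hℓ : 0 < ℓ)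
    (hm : 0 < m.re) :
    Tendsto (fun x : ℝ => Complex.exp (m * x) * macdonaldExpDeriv η ℓ m x) atBot
      (𝓝 (-m * macdonaldLimit ℓ m)) := by
  have ha := neg_one_lt_re_sub_half hm
  have h2 : ((1 : ℂ) / 2).re = 1 / 2 := by norm_num
  have h := tendsto_laplaceInt_atBot hη hℓ ha (b := m - 1 / 2) (by
    rw [Complex.sub_re, h2]; linarith)
  have h' := tendsto_laplaceInt_atBot hη hℓ (a := m - 1 / 2 + 1) (b := m - 1 / 2 - 1)
    (by rw [Complex.add_re, Complex.one_re]; linarith)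
    (by rw [Complex.add_re, Complex.sub_re (m - 1 / 2), Complex.one_re, Complex.sub_re, h2]
        linarith)
  rw [show m - 1 / 2 + (m - 1 / 2) + 1 = 2 * m by ring] at h
  rw [show m - 1 / 2 + 1 + (m - 1 / 2 - 1) + 1 = 2 * m by ring] at h'
  set b := m - 1 / 2 with hb
  have hhalf : ((1 / 2 : ℝ) : ℂ) ≠ 0 := by norm_num
  have h3 : ((1 / 2 : ℝ) : ℂ) ^ (b - 1) = 2 * ((1 / 2 : ℝ) : ℂ) ^ b := by
    rw [Complex.cpow_sub _ _ hhalf, Complex.cpow_one]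
    push_cast
    field_simp
  -- `z L(b, b - 1) = L(b, b) - L(b + 1, b - 1) / 2` tends to `0`
  have h4 : Tendsto (fun x => b * axisPoint η ℓ x * laplaceInt b (b - 1) (axisPoint η ℓ x) -
      (m + axisPoint η ℓ x) * laplaceInt b b (axisPoint η ℓ x)) atBot
      (𝓝 (-m * (((1 / 2 : ℝ) : ℂ) ^ b * Complex.Gamma (2 * m)))) := by
    have h5 := ((h.sub (h'.div_const 2)).const_mul b).sub
      (((tendsto_axisPoint_atBot η ℓ).const_add m).mul h)
    have h6 : b * (((1 / 2 : ℝ) : ℂ) ^ b * Complex.Gamma (2 * m) -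
        ((1 / 2 : ℝ) : ℂ) ^ (b - 1) * Complex.Gamma (2 * m) / 2) -
        (m + 0) * (((1 / 2 : ℝ) : ℂ) ^ b * Complex.Gamma (2 * m)) =
        -m * (((1 / 2 : ℝ) : ℂ) ^ b * Complex.Gamma (2 * m)) := by
      rw [h3]; ring
    rw [h6] at h5
    refine h5.congr fun x => ?_
    have r1 := laplaceInt_add_one_right ha (b - 1) (re_axisPoint hη ℓ x)
      (axisPoint_ne_zero hη hℓ x)
    rw [sub_add_cancel] at r1
    linear_combination b * r1
  have h7 := tendsto_exp_mul_of_tendsto (A := ((Real.pi / 2 : ℝ) : ℂ) ^ (1 / 2 : ℂ) *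
      (Complex.Gamma (m + 1 / 2))⁻¹ * (ℓ : ℂ) ^ (-m)) m η ℓ h4
  have h8 : -m * macdonaldLimit ℓ m = ((Real.pi / 2 : ℝ) : ℂ) ^ (1 / 2 : ℂ) *
      (Complex.Gamma (m + 1 / 2))⁻¹ * (ℓ : ℂ) ^ (-m) *
      (-m * (((1 / 2 : ℝ) : ℂ) ^ b * Complex.Gamma (2 * m))) := by
    rw [macdonaldLimit]; ring
  rw [h8]
  exact h7

/-- The product of the leading coefficients of `J_m` and `K_m` at `-∞`, evaluated with the
duplication formula for the Gamma function. -/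
theorem besselLimit_mul_macdonaldLimit (hℓ : 0 < ℓ) (hm : 0 < m.re) :
    2 * m * ((((ℓ / 2 : ℝ) : ℂ) ^ m * (Complex.Gamma (m + 1))⁻¹) * macdonaldLimit ℓ m) = 1 := by
  have hm0 : m ≠ 0 := fun h => by simp [h] at hm
  have hℓ0 : (ℓ : ℂ) ≠ 0 := by exact_mod_cast hℓ.ne'
  have hhalf : ((1 / 2 : ℝ) : ℂ) ≠ 0 := by norm_num
  have e1 : ((ℓ / 2 : ℝ) : ℂ) ^ m = (ℓ : ℂ) ^ m * ((1 / 2 : ℝ) : ℂ) ^ m := by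
    rw [← Complex.mul_cpow_ofReal_nonneg hℓ.le (by norm_num)]
    congr 1
    push_cast
    ring
  have e2 : ((Real.pi / 2 : ℝ) : ℂ) ^ (1 / 2 : ℂ) =
      (Real.sqrt Real.pi : ℂ) * ((1 / 2 : ℝ) : ℂ) ^ (1 / 2 : ℂ) := by
    rw [div_eq_mul_one_div, Complex.ofReal_mul,
      Complex.mul_cpow_ofReal_nonneg Real.pi_pos.le (by norm_num), Real.sqrt_eq_rpow,
      Complex.ofReal_cpow Real.pi_pos.le]
    norm_num
  have e3 : ((1 / 2 : ℝ) : ℂ) ^ (1 / 2 : ℂ) * ((1 / 2 : ℝ) : ℂ) ^ (m - 1 / 2) =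
      ((1 / 2 : ℝ) : ℂ) ^ m := by
    rw [← Complex.cpow_add _ _ hhalf]; ring_nf
  have e4 : (ℓ : ℂ) ^ m * (ℓ : ℂ) ^ (-m) = 1 := by
    rw [← Complex.cpow_add _ _ hℓ0]; simp
  have e5 : ((1 / 2 : ℝ) : ℂ) ^ m * ((1 / 2 : ℝ) : ℂ) ^ m * 2 = (2 : ℂ) ^ (1 - 2 * m) := by
    have h1 : ((1 / 2 : ℝ) : ℂ) = (2 : ℂ)⁻¹ := by push_cast; ring
    have h2 : (2 : ℂ).arg ≠ Real.pi := by
      rw [show (2 : ℂ) = ((2 : ℝ) : ℂ) by simp, Complex.arg_ofReal_of_nonneg (by norm_num)]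
      exact Real.pi_pos.ne
    rw [h1, Complex.inv_cpow _ _ h2, ← Complex.cpow_neg,
      show 1 - 2 * m = -m + -m + 1 by ring, Complex.cpow_add _ _ two_ne_zero,
      Complex.cpow_add _ _ two_ne_zero, Complex.cpow_one]
  have e6 := Complex.Gamma_mul_Gamma_add_half m
  have e7 := Complex.Gamma_add_one m hm0
  have g1 : Complex.Gamma m ≠ 0 := Complex.Gamma_ne_zero_of_re_pos hm
  have g2 : Complex.Gamma (m + 1 / 2) ≠ 0 := Complex.Gamma_ne_zero_of_re_pos (by
    have : ((1 : ℂ) / 2).re = 1 / 2 := by norm_num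
    rw [Complex.add_re, this]; linarith)
  rw [← e5] at e6
  rw [macdonaldLimit, e1, e2, e7, mul_inv]
  generalize ((1 / 2 : ℝ) : ℂ) ^ (1 / 2 : ℂ) = s at *
  generalize ((1 / 2 : ℝ) : ℂ) ^ (m - 1 / 2) = t at *
  generalize ((1 / 2 : ℝ) : ℂ) ^ m = p at *
  generalize (ℓ : ℂ) ^ m = k at *
  generalize (ℓ : ℂ) ^ (-m) = k' at *
  generalize (Real.sqrt Real.pi : ℂ) = q at *
  generalize Complex.Gamma (2 * m) = G at *
  generalize Complex.Gamma (m + 1 / 2) = G₂ at *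
  generalize Complex.Gamma m = G₁ at *
  have g3 : G₁ * G₁⁻¹ = 1 := mul_inv_cancel₀ g1
  have g4 : G₂ * G₂⁻¹ = 1 := mul_inv_cancel₀ g2
  have g5 : m * m⁻¹ = 1 := mul_inv_cancel₀ hm0
  calc 2 * m * (k * p * (m⁻¹ * G₁⁻¹) * (q * s * G₂⁻¹ * k' * (t * G)))
      = (m * m⁻¹) * (k * k') * (G₁⁻¹ * G₂⁻¹) * (G * (p * (s * t) * 2) * q) := by ring
    _ = (G₁ * G₁⁻¹) * (G₂ * G₂⁻¹) := by rw [e3, ← e6, e4, g5]; ring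
    _ = 1 := by rw [g3, g4, one_mul]

/-- The Bessel function and the Macdonald function on the imaginary axis form a Weyl pair. -/
theorem isWeylPair_bessel_macdonald (hη : η = Complex.I ∨ η = -Complex.I) (hℓ : 0 < ℓ)
    (hm : 0 < m.re) :
    IsWeylPair ℓ (-m ^ 2) (boundaryFun η ℓ) (boundaryFunDeriv η ℓ)
      (fun x => besselJ m (ℓ * Real.exp x)) (besselJExpDeriv ℓ m)
      (macdonaldExp η ℓ m) (macdonaldExpDeriv η ℓ m) := by
  have hj := isSolution_besselJ hℓ m
  have hk := isSolution_macdonaldExp hη hℓ hm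
  refine ⟨hj, hk, fun x => ?_, ?_, tendsto_wronskian_macdonaldExp hη hℓ hm⟩
  -- the Wronskian is constant and is evaluated at `-∞`
  · have h1 := ((tendsto_besselJ_atBot hℓ m).mul (tendsto_macdonaldExpDeriv_atBot hη hℓ hm)).sub
      ((tendsto_besselJExpDeriv_atBot ℓ m).mul (tendsto_macdonaldExp_atBot hη hℓ hm))
    have h2 := besselLimit_mul_macdonaldLimit hℓ hm
    have h3 : ((ℓ / 2 : ℝ) : ℂ) ^ m * (Complex.Gamma (m + 1))⁻¹ * (-m * macdonaldLimit ℓ m) -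
        ((ℓ / 2 : ℝ) : ℂ) ^ m * (m * (Complex.Gamma (m + 1))⁻¹) * macdonaldLimit ℓ m = -1 := by
      linear_combination -h2
    rw [h3] at h1
    refine tendsto_nhds_unique (tendsto_const_nhds.congr fun y => ?_) h1
    rw [hj.wronskian_const hk x y]
    have : Complex.exp (-m * y) * Complex.exp (m * y) = 1 := by rw [← Complex.exp_add]; simp
    linear_combination (-(besselJ m (ℓ * Real.exp y) * macdonaldExpDeriv η ℓ m y -
      besselJExpDeriv ℓ m y * macdonaldExp η ℓ m y)) * this
  · obtain ⟨C, hC0, hC⟩ := besselJ_growth hℓ m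
    have h4 : Tendsto (fun x : ℝ => Complex.exp (- -m * x) * macdonaldExp η ℓ m x) atBot
        (𝓝 (macdonaldLimit ℓ m)) := by
      simpa only [neg_neg] using tendsto_macdonaldExp_atBot hη hℓ hm
    obtain ⟨D, hD0, hD⟩ := exists_bound_of_tendsto_exp_mul hk.continuous h4
    refine ⟨m.re, C + D, hm, by positivity, fun x hx => ⟨(hC x hx).1.trans ?_,
      (hC x hx).2.trans ?_, (hD x hx).trans ?_⟩⟩
    · gcongr; linarith
    · have h5 : Real.exp (m.re * x) ≤ 1 :=
        Real.exp_le_one_iff.2 (mul_nonpos_of_nonneg_of_nonpos hm.le hx)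
      have h6 := mul_le_of_le_one_right hC0 h5
      linarith
    · rw [Complex.neg_re]
      gcongr
      linarith

end Macdonald

/-! ### Approximate eigenfunctions -/

/-- A classical function with the required integrability and boundary behaviour defines an element
of the domain. -/
theorem exists_mem_domain_of_hasDerivAt (ℓ : ℝ) {Φ Φ' u u' u'' : ℝ → ℂ}
    (hΦ : ∀ x, HasDerivAt Φ (Φ' x) x) (h : ∀ x, HasDerivAt u (u' x) x)
    (h' : ∀ x, HasDerivAt u' (u'' x) x) (hc : Continuous u'') (hu : MemLp u 2 volume)
    (hg : MemLp (fun x => -u'' x - ((ℓ ^ 2 * Real.exp (2 * x) : ℝ) : ℂ) * u x) 2 volume)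
    (hW : Tendsto (fun x => Φ x * u' x - Φ' x * u x) atTop (𝓝 0)) :
    ∃ f : (bcOp ℓ Φ).domain, IsMaxRep ℓ (f : L2R) u ∧ (f : L2R) = hu.toLp ∧
      bcOp ℓ Φ f = hg.toLp := by
  have hF : formalOp ℓ u = fun x => -u'' x - ((ℓ ^ 2 * Real.exp (2 * x) : ℝ) : ℂ) * u x :=
    funext (formalOp_of_hasDerivAt ℓ h h')
  have hrep : IsMaxRep ℓ hu.toLp u :=
    ⟨isAC1_of_hasDerivAt h h' hc, hu.coeFn_toLp, by rw [hF]; exact hg⟩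
  have hW' : Tendsto (wronskian Φ u) atTop (𝓝 0) := by
    refine hW.congr fun x => ?_
    rw [wronskian, (h x).deriv, (hΦ x).deriv]
  refine ⟨⟨hu.toLp, mem_bcOp_domain.2 ⟨u, hrep, hW'⟩⟩, hrep, rfl, ?_⟩
  refine Lp.ext ((bcOp_apply_ae _ hrep).trans ?_)
  rw [hF]
  exact hg.coeFn_toLp.symm

/-- The function `e^{μ x} e^{-e^x}`. For `μ = ε + i k` with small `ε > 0` it is nearly an
eigenfunction for `k²`, most of its mass lying where `x` is very negative. -/
def gammaFun (μ : ℂ) (x : ℝ) : ℂ := Complex.exp (μ * x) * Complex.exp (-(Real.exp x : ℂ))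

theorem norm_gammaFun (μ : ℂ) (x : ℝ) : ‖gammaFun μ x‖ = Real.exp (μ.re * x - Real.exp x) := by
  rw [gammaFun, norm_mul, Complex.norm_exp, Complex.norm_exp, Complex.re_mul_ofReal,
    Complex.neg_re, Complex.ofReal_re, ← Real.exp_add, sub_eq_add_neg]

theorem gammaFun_add_one (μ : ℂ) (x : ℝ) :
    gammaFun (μ + 1) x = (Real.exp x : ℂ) * gammaFun μ x := by
  rw [gammaFun, gammaFun, add_mul, one_mul, Complex.exp_add, Complex.ofReal_exp]
  ring

theorem hasDerivAt_gammaFun (μ : ℂ) (x : ℝ) :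
    HasDerivAt (gammaFun μ) (μ * gammaFun μ x - gammaFun (μ + 1) x) x := by
  refine ((hasDerivAt_exp_mul_ofReal μ x).mul
    (Real.hasDerivAt_exp x).ofReal_comp.neg.cexp).congr_deriv ?_
  rw [gammaFun_add_one, gammaFun]
  simp only [Pi.neg_apply]
  ring

theorem continuous_gammaFun (μ : ℂ) : Continuous (gammaFun μ) :=
  continuous_iff_continuousAt.2 fun x => (hasDerivAt_gammaFun μ x).continuousAt

theorem memLp_gammaFun {μ : ℂ} (hμ : 0 < μ.re) : MemLp (gammaFun μ) 2 volume := by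
  -- `e^x ≥ x²/2` for `x ≥ 0`, and `2 s x - x²/2 ≤ 2 s²` with `s = Re μ`
  refine memLp_two_of_norm_le_exp (continuous_gammaFun μ).aestronglyMeasurable hμ
    (C := Real.exp (2 * μ.re ^ 2)) fun x => ?_
  rw [norm_gammaFun, ← Real.exp_add, Real.exp_le_exp]
  rcases le_total 0 x with hx | hx
  · have := Real.quadratic_le_exp_of_nonneg hx
    rw [abs_of_nonneg hx]
    nlinarith [sq_nonneg (x - 2 * μ.re)]
  · rw [abs_of_nonpos hx]
    nlinarith [Real.exp_pos x, sq_nonneg μ.re]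

theorem tendsto_exp_mul_norm_gammaFun (a : ℝ) (μ : ℂ) :
    Tendsto (fun x => Real.exp (a * x) * ‖gammaFun μ x‖) atTop (𝓝 0) := by
  have h := (tendsto_rpow_mul_exp_neg_mul_atTop_nhds_zero (a + μ.re) 1 one_pos).comp
    Real.tendsto_exp_atTop
  refine h.congr fun x => ?_
  rw [Function.comp_apply, norm_gammaFun, ← Real.exp_mul, ← Real.exp_add, ← Real.exp_add]
  congr 1
  ring

theorem IsSolution.tendsto_wronskian_gammaFun {ℓ : ℝ} (hℓ : 0 < ℓ) {w : ℂ} {Φ Φ' : ℝ → ℂ}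
    (hΦ : IsSolution ℓ w Φ Φ') (μ : ℂ) :
    Tendsto (fun x => Φ x * (μ * gammaFun μ x - gammaFun (μ + 1) x) - Φ' x * gammaFun μ x) atTop
      (𝓝 0) := by
  obtain ⟨C, hC0, hC⟩ := hΦ.exists_bound_atTop hℓ
  have key : ∀ ν : ℂ, Tendsto (fun x => Φ x * gammaFun ν x) atTop (𝓝 0) ∧
      Tendsto (fun x => Φ' x * gammaFun ν x) atTop (𝓝 0) := by
    intro ν
    constructor
    · refine squeeze_zero_norm' (a := fun x => C * (Real.exp (-(1 / 2) * x) * ‖gammaFun ν x‖)) ?_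
        (by simpa only [mul_zero] using (tendsto_exp_mul_norm_gammaFun (-(1 / 2)) ν).const_mul C)
      filter_upwards [eventually_ge_atTop 0] with x hx
      rw [norm_mul, ← mul_assoc, show -(1 / 2) * x = -x / 2 by ring]
      exact mul_le_mul_of_nonneg_right (hC x hx).1 (norm_nonneg _)
    · refine squeeze_zero_norm' (a := fun x => C * (Real.exp (1 / 2 * x) * ‖gammaFun ν x‖)) ?_
        (by simpa only [mul_zero] using (tendsto_exp_mul_norm_gammaFun (1 / 2) ν).const_mul C)
      filter_upwards [eventually_ge_atTop 0] with x hx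
      rw [norm_mul, ← mul_assoc, show 1 / 2 * x = x / 2 by ring]
      exact mul_le_mul_of_nonneg_right (hC x hx).2 (norm_nonneg _)
  have h := (((key μ).1.const_mul μ).sub (key (μ + 1)).1).sub (key μ).2
  simp only [mul_zero, sub_zero] at h
  refine h.congr fun x => ?_
  ring

/-- The functions `e^{μ x} e^{-e^x}` with `Re μ > 0` decay so fast at `+∞` that they satisfy every
boundary condition; the operator maps such a function to a combination of functions of the same
kind. -/
theorem exists_gammaFun_mem_domain {ℓ : ℝ} (hℓ : 0 < ℓ) {w : ℂ} {Φ Φ' : ℝ → ℂ}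
    (hΦ : IsSolution ℓ w Φ Φ') {μ : ℂ} (h0 : 0 < μ.re) (h1 : 0 < (μ + 1).re)
    (h2 : 0 < (μ + 1 + 1).re) :
    ∃ f : (bcOp ℓ Φ).domain, (f : L2R) = (memLp_gammaFun h0).toLp ∧
      bcOp ℓ Φ f = -μ ^ 2 • (memLp_gammaFun h0).toLp + (2 * μ + 1) • (memLp_gammaFun h1).toLp -
        (1 + (ℓ : ℂ) ^ 2) • (memLp_gammaFun h2).toLp := by
  have hd := hasDerivAt_gammaFun μ
  have hd2 : ∀ x, HasDerivAt (fun x => μ * gammaFun μ x - gammaFun (μ + 1) x)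
      (μ ^ 2 * gammaFun μ x - (2 * μ + 1) * gammaFun (μ + 1) x + gammaFun (μ + 1 + 1) x) x :=
    fun x => (((hd x).const_mul μ).sub (hasDerivAt_gammaFun (μ + 1) x)).congr_deriv (by ring)
  have hm := ((memLp_gammaFun h0).const_smul (-μ ^ 2)).add
    ((memLp_gammaFun h1).const_smul (2 * μ + 1)) |>.sub
    ((memLp_gammaFun h2).const_smul (1 + (ℓ : ℂ) ^ 2))
  have hEq : (fun x => -(μ ^ 2 * gammaFun μ x - (2 * μ + 1) * gammaFun (μ + 1) x +
      gammaFun (μ + 1 + 1) x) - ((ℓ ^ 2 * Real.exp (2 * x) : ℝ) : ℂ) * gammaFun μ x) =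
      -μ ^ 2 • gammaFun μ + (2 * μ + 1) • gammaFun (μ + 1) -
        (1 + (ℓ : ℂ) ^ 2) • gammaFun (μ + 1 + 1) := by
    funext x
    simp only [Pi.add_apply, Pi.sub_apply, Pi.smul_apply, smul_eq_mul]
    rw [gammaFun_add_one (μ + 1), gammaFun_add_one, two_mul x, Real.exp_add]
    push_cast
    ring
  obtain ⟨f, -, hf, hf'⟩ := exists_mem_domain_of_hasDerivAt ℓ (fun x => (hΦ x).1) hd hd2
    (((continuous_gammaFun μ).const_mul _).sub ((continuous_gammaFun _).const_mul _) |>.add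
      (continuous_gammaFun _)) (memLp_gammaFun h0) (by rw [hEq]; exact hm)
    (hΦ.tendsto_wronskian_gammaFun hℓ μ)
  refine ⟨f, hf, ?_⟩
  rw [hf', ← MemLp.toLp_const_smul, ← MemLp.toLp_const_smul, ← MemLp.toLp_const_smul,
    ← MemLp.toLp_add, ← MemLp.toLp_sub]
  refine (MemLp.toLp_eq_toLp_iff _ _).2 ?_
  rw [hEq]

/-- For `1 ≤ Re μ ≤ 3` the function `e^{Re μ x}` is at most `e^x + e^{3x}`, which bounds the norms
uniformly. -/
theorem exists_norm_toLp_gammaFun_le :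
    ∃ B : ℝ, 0 ≤ B ∧ ∀ (μ : ℂ) (h : 0 < μ.re), 1 ≤ μ.re → μ.re ≤ 3 →
      ‖(memLp_gammaFun h).toLp‖ ≤ B := by
  have h1 := memLp_gammaFun (μ := 1) (by simp)
  have h3 := memLp_gammaFun (μ := 3) (by simp)
  refine ⟨‖(h1.norm.add h3.norm).toLp‖, norm_nonneg _, fun μ h hμ1 hμ3 => ?_⟩
  refine Lp.norm_le_norm_of_ae_le ?_
  filter_upwards [(memLp_gammaFun h).coeFn_toLp, (h1.norm.add h3.norm).coeFn_toLp] with x e1 e2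
  rw [e1, e2, Pi.add_apply, Real.norm_of_nonneg (by positivity), norm_gammaFun, norm_gammaFun,
    norm_gammaFun]
  simp only [Complex.one_re, Complex.re_ofNat]
  rcases le_total 0 x with hx | hx
  · refine (Real.exp_le_exp.2 ?_).trans (le_add_of_nonneg_left (Real.exp_nonneg _))
    nlinarith
  · refine (Real.exp_le_exp.2 ?_).trans (le_add_of_nonneg_right (Real.exp_nonneg _))
    nlinarith

/-- On the interval `[-1/Re μ, 0]` the function `e^{μ x} e^{-e^x}` is at least `e^{-2}` in absolute
value. -/
theorem le_norm_toLp_gammaFun {μ : ℂ} (h : 0 < μ.re) {T : ℝ} (hT : 0 ≤ T)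
    (hμ : μ.re * T ^ 2 = 1) : Real.exp (-2) * T ≤ ‖(memLp_gammaFun h).toLp‖ := by
  have hs : volume (Icc (-T ^ 2) 0) ≠ ⊤ := by simp
  have h1 := norm_indicatorConstLp (p := 2) (c := (Real.exp (-2) : ℂ))
    (hs := measurableSet_Icc (a := -T ^ 2) (b := 0)) (hμs := hs) two_ne_zero (by simp)
  have h2 : (volume.real (Icc (-T ^ 2) 0)) ^ (1 / (2 : ℝ≥0∞).toReal) = T := by
    rw [Real.volume_real_Icc_of_le (by nlinarith), ENNReal.toReal_ofNat, ← Real.sqrt_eq_rpow]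
    simp [hT]
  rw [h2, Complex.norm_real, Real.norm_of_nonneg (Real.exp_nonneg _)] at h1
  rw [← h1]
  refine Lp.norm_le_norm_of_ae_le ?_
  filter_upwards [(memLp_gammaFun h).coeFn_toLp, indicatorConstLp_coeFn (p := 2)
    (hs := measurableSet_Icc (a := -T ^ 2) (b := 0)) (hμs := hs) (c := (Real.exp (-2) : ℂ))]
    with x e1 e2
  rw [e1, e2]
  by_cases hx : x ∈ Icc (-T ^ 2) 0
  · rw [indicator_of_mem hx, Complex.norm_real, Real.norm_of_nonneg (Real.exp_nonneg _),
      norm_gammaFun]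
    have := Real.exp_le_one_iff.2 hx.2
    refine Real.exp_le_exp.2 ?_
    nlinarith [hx.1]
  · rw [indicator_of_notMem hx, norm_zero]
    exact norm_nonneg _

/-- No point of `[0, ∞[` belongs to the resolvent set: as `ε → 0` the norm of
`u = e^{(ε + ik) x} e^{-e^x}` tends to infinity, while `(A - k²) u` is the sum of a multiple of
`u` of size `O(ε)` and of bounded terms. -/
theorem not_isResolventAt_sq {ℓ : ℝ} (hℓ : 0 < ℓ) {w : ℂ} {Φ Φ' : ℝ → ℂ}
    (hΦ : IsSolution ℓ w Φ Φ') (k : ℝ) (R : L2R →L[ℂ] L2R) :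
    ¬ IsResolventAt (bcOp ℓ Φ) ((k : ℂ) ^ 2) R := by
  intro hR
  obtain ⟨B, hB0, hB⟩ := exists_norm_toLp_gammaFun_le
  set r := ‖R‖ with hr
  have hr0 : 0 ≤ r := norm_nonneg R
  set D := (2 * (1 + |k|) + 1) * B + (1 + ℓ ^ 2) * B with hD
  have hD0 : 0 ≤ D := by positivity
  -- the cutoff scale is `1/ε = T²`, so that the norm of `u` is at least of order `T`
  set T := 1 + 2 * (r * (1 + 2 * |k|)) + Real.exp 2 * (2 * (r * D) + 1) with hT
  have hT1 : 1 ≤ T := by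
    have : 0 ≤ 2 * (r * (1 + 2 * |k|)) + Real.exp 2 * (2 * (r * D) + 1) := by positivity
    linarith
  have hT0 : 0 < T := one_pos.trans_le hT1
  set ε := 1 / T ^ 2 with hε
  have hε0 : 0 < ε := by positivity
  have hεT : ε * T ^ 2 = 1 := by rw [hε]; field_simp
  have hε1 : ε ≤ 1 := by
    rw [hε, div_le_one (by positivity)]
    exact one_le_pow₀ hT1
  set μ : ℂ := ⟨ε, k⟩ with hμ
  have hμε : μ = ε + k * Complex.I := Complex.ext (by simp [hμ]) (by simp [hμ])
  have h0 : 0 < μ.re := hε0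
  have e1 : (μ + 1).re = ε + 1 := by simp [hμ]
  have e2 : (μ + 1 + 1).re = ε + 2 := by simp [hμ]; ring
  have h1 : 0 < (μ + 1).re := by rw [e1]; positivity
  have h2 : 0 < (μ + 1 + 1).re := by rw [e2]; positivity
  obtain ⟨f, hf, hf'⟩ := exists_gammaFun_mem_domain hℓ hΦ h0 h1 h2
  have hB1 := hB _ h1 (by rw [e1]; linarith) (by rw [e1]; linarith)
  have hB2 := hB _ h2 (by rw [e2]; linarith) (by rw [e2]; linarith)
  have hlow := le_norm_toLp_gammaFun h0 hT0.le hεT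
  have hfix := hR.2 f
  rw [hf, hf'] at hfix
  set u := (memLp_gammaFun h0).toLp
  set v := (memLp_gammaFun h1).toLp
  set y := (memLp_gammaFun h2).toLp
  have hnorm : ‖u‖ ≤ r * ‖-μ ^ 2 • u + (2 * μ + 1) • v - (1 + (ℓ : ℂ) ^ 2) • y -
      (k : ℂ) ^ 2 • u‖ := by
    conv_lhs => rw [← hfix]
    exact R.le_opNorm _
  have hrw : -μ ^ 2 • u + (2 * μ + 1) • v - (1 + (ℓ : ℂ) ^ 2) • y - (k : ℂ) ^ 2 • u =
      -(μ ^ 2 + (k : ℂ) ^ 2) • u + (2 * μ + 1) • v - (1 + (ℓ : ℂ) ^ 2) • y := by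
    module
  have hμn : ‖μ‖ ≤ ε + |k| := by
    rw [hμε]
    refine (norm_add_le _ _).trans ?_
    rw [norm_mul, Complex.norm_I, mul_one, Complex.norm_real, Complex.norm_real,
      Real.norm_of_nonneg hε0.le, Real.norm_eq_abs]
  have c1 : ‖-(μ ^ 2 + (k : ℂ) ^ 2)‖ ≤ ε * (1 + 2 * |k|) := by
    have : μ ^ 2 + (k : ℂ) ^ 2 = ε * (ε + 2 * (k * Complex.I)) := by
      rw [hμε]
      linear_combination (k : ℂ) ^ 2 * Complex.I_sq
    rw [norm_neg, this, norm_mul, Complex.norm_real, Real.norm_of_nonneg hε0.le]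
    gcongr
    refine (norm_add_le _ _).trans ?_
    rw [norm_mul, norm_mul, Complex.norm_I, mul_one, Complex.norm_real, Complex.norm_real,
      Real.norm_of_nonneg hε0.le, Real.norm_eq_abs, Complex.norm_ofNat]
    linarith
  have c2 : ‖2 * μ + 1‖ ≤ 2 * (1 + |k|) + 1 := by
    refine (norm_add_le _ _).trans ?_
    rw [norm_mul, Complex.norm_ofNat, norm_one]
    linarith
  have c3 : ‖1 + (ℓ : ℂ) ^ 2‖ ≤ 1 + ℓ ^ 2 := by
    refine (norm_add_le _ _).trans ?_
    rw [norm_pow, Complex.norm_real, norm_one, Real.norm_of_nonneg hℓ.le]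
  have hmain : ‖u‖ ≤ r * (ε * (1 + 2 * |k|) * ‖u‖ + D) := by
    refine hnorm.trans (mul_le_mul_of_nonneg_left ?_ hr0)
    rw [hrw]
    refine (norm_sub_le _ _).trans ((add_le_add_left (norm_add_le _ _) _).trans ?_)
    rw [norm_smul, norm_smul, norm_smul, hD, add_assoc]
    gcongr
  have hsmall : r * (ε * (1 + 2 * |k|)) ≤ 1 / 2 := by
    have : 2 * (r * (1 + 2 * |k|)) ≤ T ^ 2 := by
      have : 0 ≤ Real.exp 2 * (2 * (r * D) + 1) := by positivity
      nlinarith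
    calc r * (ε * (1 + 2 * |k|)) = ε * (2 * (r * (1 + 2 * |k|))) / 2 := by ring
      _ ≤ ε * T ^ 2 / 2 := by gcongr
      _ = 1 / 2 := by rw [hεT]
  have hup : ‖u‖ ≤ 2 * (r * D) := by
    have h3 := mul_le_mul_of_nonneg_right hsmall (norm_nonneg u)
    have h4 : r * (ε * (1 + 2 * |k|) * ‖u‖ + D) = r * (ε * (1 + 2 * |k|)) * ‖u‖ + r * D := by ring
    rw [h4] at hmain
    linarith
  have hbig : 2 * (r * D) + 1 ≤ Real.exp (-2) * T := by
    have h3 : Real.exp (-2) * Real.exp 2 = 1 := by rw [← Real.exp_add]; simp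
    have h4 : Real.exp 2 * (2 * (r * D) + 1) ≤ T := by
      have : 0 ≤ 2 * (r * (1 + 2 * |k|)) := by positivity
      linarith
    calc 2 * (r * D) + 1 = Real.exp (-2) * (Real.exp 2 * (2 * (r * D) + 1)) := by
          linear_combination -(2 * (r * D) + 1) * h3
      _ ≤ _ := by gcongr
  linarith

/-! ### The two boundary conditions are different -/

/-- The function `e^{-e^{-x}} e^{-s x} e^{-η ℓ e^x}`: for `s = 1/2` it is the boundary function,
cut off at `-∞`. -/
def cutoffFun (η : ℂ) (ℓ : ℝ) (s : ℂ) (x : ℝ) : ℂ :=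
  gammaFun s (-x) * Complex.exp (-axisPoint η ℓ x)

theorem gammaFun_sub_one_neg (s : ℂ) (x : ℝ) :
    gammaFun (s - 1) (-x) = (Real.exp x : ℂ) * gammaFun s (-x) := by
  have h := gammaFun_add_one (s - 1) (-x)
  have h1 : (Real.exp x : ℂ) * (Real.exp (-x) : ℂ) = 1 := by
    rw [← Complex.ofReal_mul, ← Real.exp_add]; simp
  rw [sub_add_cancel] at h
  linear_combination (-(Real.exp x : ℂ)) * h - gammaFun (s - 1) (-x) * h1

theorem hasDerivAt_cutoffFun (η : ℂ) (ℓ : ℝ) (s : ℂ) (x : ℝ) :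
    HasDerivAt (cutoffFun η ℓ s) (-s * cutoffFun η ℓ s x + cutoffFun η ℓ (s + 1) x -
      η * ℓ * cutoffFun η ℓ (s - 1) x) x := by
  have h1 : HasDerivAt (fun x : ℝ => gammaFun s (-x))
      (-(s * gammaFun s (-x) - gammaFun (s + 1) (-x))) x :=
    ((hasDerivAt_gammaFun s (-x)).scomp x (hasDerivAt_neg x)).congr_deriv (by simp)
  refine (h1.mul (hasDerivAt_axisPoint η ℓ x).neg.cexp).congr_deriv ?_
  simp only [cutoffFun, Pi.neg_apply]
  rw [gammaFun_sub_one_neg, axisPoint]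
  push_cast
  ring

theorem continuous_cutoffFun (η : ℂ) (ℓ : ℝ) (s : ℂ) : Continuous (cutoffFun η ℓ s) :=
  continuous_iff_continuousAt.2 fun x => (hasDerivAt_cutoffFun η ℓ s x).continuousAt

theorem norm_exp_neg_axisPoint {η : ℂ} (hη : η = Complex.I ∨ η = -Complex.I) (ℓ x : ℝ) :
    ‖Complex.exp (-axisPoint η ℓ x)‖ = 1 := by
  rw [Complex.norm_exp, Complex.neg_re, re_axisPoint hη, neg_zero, Real.exp_zero]

theorem memLp_cutoffFun {η : ℂ} (hη : η = Complex.I ∨ η = -Complex.I) (ℓ : ℝ) {s : ℂ}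
    (hs : 0 < s.re) : MemLp (cutoffFun η ℓ s) 2 volume := by
  refine ((memLp_gammaFun hs).comp_measurePreserving
    (Measure.measurePreserving_neg volume)).of_le
    (continuous_cutoffFun η ℓ s).aestronglyMeasurable (Eventually.of_forall fun x => ?_)
  rw [cutoffFun, norm_mul, norm_exp_neg_axisPoint hη, mul_one]
  exact le_rfl

theorem cutoffFun_half (η : ℂ) (ℓ x : ℝ) :
    cutoffFun η ℓ (1 / 2) x = Complex.exp (-(Real.exp (-x) : ℂ)) * boundaryFun η ℓ x := by
  rw [cutoffFun, gammaFun, boundaryFun]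
  push_cast
  rw [show (1 / 2 : ℂ) * -(x : ℂ) = -(1 / 2) * x by ring]
  ring

theorem tendsto_cutoff_atTop :
    Tendsto (fun x : ℝ => Complex.exp (-(Real.exp (-x) : ℂ))) atTop (𝓝 1) := by
  have h1 : Tendsto (fun x : ℝ => (Real.exp (-x) : ℂ)) atTop (𝓝 ((0 : ℝ) : ℂ)) :=
    (Complex.continuous_ofReal.tendsto _).comp
      (Real.tendsto_exp_atBot.comp tendsto_neg_atTop_atBot)
  have h2 := (Complex.continuous_exp.tendsto _).comp h1.neg
  simpa using! h2

/-- The Wronskian of a function `Ψ` with `e^{-e^{-x}} Φ_η`. -/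
theorem wronskian_cutoffFun (η : ℂ) (ℓ : ℝ) (p p' : ℂ) (x : ℝ) :
    p * (-(1 / 2) * cutoffFun η ℓ (1 / 2) x + cutoffFun η ℓ (1 / 2 + 1) x -
      η * ℓ * cutoffFun η ℓ (1 / 2 - 1) x) - p' * cutoffFun η ℓ (1 / 2) x =
    Complex.exp (-(Real.exp (-x) : ℂ)) * ((Real.exp (-x) : ℂ) * (p * boundaryFun η ℓ x) +
      (p * boundaryFunDeriv η ℓ x - p' * boundaryFun η ℓ x)) := by
  have h1 : cutoffFun η ℓ (1 / 2 + 1) x = (Real.exp (-x) : ℂ) * cutoffFun η ℓ (1 / 2) x := by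
    rw [cutoffFun, gammaFun_add_one, cutoffFun, mul_assoc]
  have h2 : cutoffFun η ℓ (1 / 2 - 1) x = (Real.exp x : ℂ) * cutoffFun η ℓ (1 / 2) x := by
    rw [cutoffFun, gammaFun_sub_one_neg, cutoffFun, mul_assoc]
  rw [h1, h2, cutoffFun_half, boundaryFunDeriv, axisPoint]
  push_cast
  ring

theorem tendsto_exp_neg_mul_boundaryFun {η θ : ℂ} (hη : η = Complex.I ∨ η = -Complex.I)
    (hθ : θ = Complex.I ∨ θ = -Complex.I) (ℓ : ℝ) :
    Tendsto (fun x : ℝ => (Real.exp (-x) : ℂ) * (boundaryFun θ ℓ x * boundaryFun η ℓ x)) atTop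
      (𝓝 0) := by
  have h0 : Tendsto (fun x : ℝ => Real.exp (-(2 * x))) atTop (𝓝 0) :=
    Real.tendsto_exp_neg_atTop_nhds_zero.comp (tendsto_id.const_mul_atTop (by norm_num))
  refine squeeze_zero_norm (fun x => le_of_eq ?_) h0
  have h2 : (-(1 / 2) : ℂ).re = -(1 / 2) := by norm_num
  rw [boundaryFun, boundaryFun, norm_mul, norm_mul, norm_mul, norm_mul,
    norm_exp_neg_axisPoint hη, norm_exp_neg_axisPoint hθ, Complex.norm_real,
    Real.norm_of_nonneg (Real.exp_nonneg _), Complex.norm_exp, Complex.re_mul_ofReal, h2, mul_one,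
    ← Real.exp_add, ← Real.exp_add]
  congr 1
  ring

/-- The boundary function `Φ_η`, cut off at `-∞`, satisfies the boundary condition set by `Φ_η`
but not the one set by `Φ_{-η}`. -/
theorem bcOp_boundaryFun_ne {η : ℂ} (hη : η = Complex.I ∨ η = -Complex.I) {ℓ : ℝ} (hℓ : 0 < ℓ) :
    bcOp ℓ (boundaryFun η ℓ) ≠ bcOp ℓ (boundaryFun (-η) ℓ) := by
  have hη' : -η = Complex.I ∨ -η = -Complex.I := by
    rcases hη with rfl | rfl
    · exact Or.inr rfl
    · exact Or.inl (neg_neg _)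
  have hη2 : η ^ 2 = -1 := by rcases hη with rfl | rfl <;> simp
  have hη0 : η ≠ 0 := by rcases hη with rfl | rfl <;> simp
  have hℓ0 : (ℓ : ℂ) ≠ 0 := by exact_mod_cast hℓ.ne'
  have hΦ := isSolution_boundaryFun hη ℓ
  have hΨ := isSolution_boundaryFun hη' ℓ
  set u := cutoffFun η ℓ (1 / 2) with hu
  set u' := fun x => -(1 / 2) * cutoffFun η ℓ (1 / 2) x + cutoffFun η ℓ (1 / 2 + 1) x -
      η * ℓ * cutoffFun η ℓ (1 / 2 - 1) x with hu'
  have hd : ∀ x, HasDerivAt u (u' x) x := hasDerivAt_cutoffFun η ℓ (1 / 2)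
  -- the coefficient `(2 s - 1) η ℓ` of `e^x u` in `u''` vanishes for `s = 1/2`
  set u'' := fun x => (1 / 4 - 2 * η * ℓ) * cutoffFun η ℓ (1 / 2) x -
    2 * cutoffFun η ℓ (1 / 2 + 1) x + cutoffFun η ℓ (1 / 2 + 1 + 1) x -
    ℓ ^ 2 * cutoffFun η ℓ (1 / 2 - 1 - 1) x with hu''
  have hd' : ∀ x, HasDerivAt u' (u'' x) x := by
    intro x
    have h1 := hasDerivAt_cutoffFun η ℓ (1 / 2 + 1) x
    have h2 := hasDerivAt_cutoffFun η ℓ (1 / 2 - 1) x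
    rw [add_sub_cancel_right] at h1
    rw [sub_add_cancel] at h2
    refine ((((hd x).const_mul (-(1 / 2))).add h1).sub (h2.const_mul (η * ℓ))).congr_deriv ?_
    simp only [hu', hu'']
    linear_combination ((ℓ : ℂ) ^ 2 * cutoffFun η ℓ (1 / 2 - 1 - 1) x) * hη2
  have hre : 0 < ((1 : ℂ) / 2).re := by norm_num
  have hre1 : 0 < ((1 : ℂ) / 2 + 1).re := by norm_num
  have hre2 : 0 < ((1 : ℂ) / 2 + 1 + 1).re := by norm_num
  have hg : MemLp (fun x => -u'' x - ((ℓ ^ 2 * Real.exp (2 * x) : ℝ) : ℂ) * u x) 2 volume := by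
    refine (((memLp_cutoffFun hη ℓ hre).const_mul (-(1 / 4 - 2 * η * ℓ))).add
      ((memLp_cutoffFun hη ℓ hre1).const_mul 2) |>.sub (memLp_cutoffFun hη ℓ hre2)).ae_eq
      (Eventually.of_forall fun x => ?_)
    have h1 : cutoffFun η ℓ (1 / 2 - 1 - 1) x =
        (Real.exp x : ℂ) * ((Real.exp x : ℂ) * cutoffFun η ℓ (1 / 2) x) := by
      rw [cutoffFun, gammaFun_sub_one_neg, gammaFun_sub_one_neg, cutoffFun, mul_assoc, mul_assoc]
    simp only [hu'', hu, Pi.add_apply, Pi.sub_apply]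
    rw [h1, two_mul x, Real.exp_add]
    push_cast
    ring
  have hcont : Continuous u'' :=
    (((continuous_cutoffFun η ℓ _).const_mul _).sub ((continuous_cutoffFun η ℓ _).const_mul _)
      |>.add (continuous_cutoffFun η ℓ _)).sub ((continuous_cutoffFun η ℓ _).const_mul _)
  have hWΦ : Tendsto (fun x => boundaryFun η ℓ x * u' x - boundaryFunDeriv η ℓ x * u x) atTop
      (𝓝 0) := by
    have h := tendsto_cutoff_atTop.mul (tendsto_exp_neg_mul_boundaryFun hη hη ℓ)
    rw [mul_zero] at h
    refine h.congr fun x => ?_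
    rw [hu', wronskian_cutoffFun]
    ring
  have hWΨ : Tendsto (fun x => boundaryFun (-η) ℓ x * u' x - boundaryFunDeriv (-η) ℓ x * u x)
      atTop (𝓝 (-(2 * η * ℓ))) := by
    have h := tendsto_cutoff_atTop.mul
      ((tendsto_exp_neg_mul_boundaryFun hη hη' ℓ).add_const (-(2 * η * ℓ)))
    rw [zero_add, one_mul] at h
    refine h.congr fun x => ?_
    rw [hu', wronskian_cutoffFun]
    linear_combination Complex.exp (-(Real.exp (-x) : ℂ)) * wronskian_boundaryFun η ℓ x
  obtain ⟨f, hf, -, -⟩ := exists_mem_domain_of_hasDerivAt ℓ (fun x => (hΦ x).1) hd hd' hcont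
    (memLp_cutoffFun hη ℓ hre) hg hWΦ
  intro hEq
  have hmem : (f : L2R) ∈ (bcOp ℓ (boundaryFun (-η) ℓ)).domain := hEq ▸ f.2
  obtain ⟨v, hv, hW⟩ := mem_bcOp_domain.1 hmem
  rw [hv.unique hf] at hW
  have hW' := hWΨ.congr (f₂ := wronskian (boundaryFun (-η) ℓ) u) fun x => by
    rw [wronskian, (hd x).deriv, (hΨ x).1.deriv]
  have h0 := tendsto_nhds_unique hW hW'
  exact neg_ne_zero.2 (mul_ne_zero (mul_ne_zero two_ne_zero hη0) hℓ0) h0.symm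

/-! ### Spectrum and resolvent -/

theorem exists_resolvent_boundaryFun {η : ℂ} (hη : η = Complex.I ∨ η = -Complex.I) {ℓ : ℝ}
    (hℓ : 0 < ℓ) {m : ℂ} (hm : 0 < m.re) :
    ∃ R : L2R →L[ℂ] L2R, IsResolventAt (bcOp ℓ (boundaryFun η ℓ)) (-m ^ 2) R ∧
      HasIntegralKernel R
        (greenKernel (fun x => besselJ m (ℓ * Real.exp x)) (macdonaldExp η ℓ m)) := by
  have hη' : -η = Complex.I ∨ -η = -Complex.I := by
    rcases hη with rfl | rfl
    · exact Or.inr rfl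
    · exact Or.inl (neg_neg _)
  have hη0 : η ≠ 0 := by rcases hη with rfl | rfl <;> simp
  have hℓ0 : (ℓ : ℂ) ≠ 0 := by exact_mod_cast hℓ.ne'
  exact (isWeylPair_bessel_macdonald hη hℓ hm).exists_resolvent hℓ
    (isSolution_boundaryFun hη ℓ) (isSolution_boundaryFun hη' ℓ)
    (mul_ne_zero (mul_ne_zero two_ne_zero hη0) hℓ0) (wronskian_boundaryFun η ℓ)

theorem isClosedRealization_boundaryFun {η : ℂ} (hη : η = Complex.I ∨ η = -Complex.I) {ℓ : ℝ}
    (hℓ : 0 < ℓ) : IsClosedRealization ℓ (bcOp ℓ (boundaryFun η ℓ)) := by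
  obtain ⟨R, hR, -⟩ := exists_resolvent_boundaryFun hη hℓ (m := 1) (by simp)
  exact ⟨hR.isClosed, bcOp_le_maxOp ℓ _, bcOp_on_test ℓ _⟩

/-- Every `z ∉ [0, ∞[` is `-m²` for some `m` with `Re m > 0`. -/
theorem exists_neg_sq_eq {z : ℂ} (hz : z ∉ Complex.ofReal '' Ici (0 : ℝ)) :
    ∃ m : ℂ, 0 < m.re ∧ -m ^ 2 = z := by
  have hz0 : -z ≠ 0 := fun h => hz ⟨0, mem_Ici.2 le_rfl, by
    rw [Complex.ofReal_zero, neg_eq_zero.1 h]⟩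
  refine ⟨(-z) ^ (1 / 2 : ℂ), ?_, ?_⟩
  · have harg : (-z).arg ≠ Real.pi := by
      intro h
      rw [Complex.arg_eq_pi_iff] at h
      refine hz ⟨z.re, ?_, Complex.ext (by simp) ?_⟩
      · have := h.1
        rw [Complex.neg_re] at this
        exact mem_Ici.2 (by linarith)
      · have := h.2
        rw [Complex.neg_im] at this
        rw [Complex.ofReal_im]
        linarith
    rw [Complex.cpow_def_of_ne_zero hz0, Complex.exp_re]
    refine mul_pos (Real.exp_pos _) (Real.cos_pos_of_mem_Ioo ?_)
    have him : (Complex.log (-z) * (1 / 2)).im = (-z).arg / 2 := by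
      rw [show (1 / 2 : ℂ) = ((1 / 2 : ℝ) : ℂ) by push_cast; ring, Complex.im_mul_ofReal,
        Complex.log_im]
      ring
    rw [him]
    have h1 := Complex.neg_pi_lt_arg (-z)
    have h2 := lt_of_le_of_ne (Complex.arg_le_pi (-z)) harg
    exact ⟨by linarith, by linarith⟩
  · rw [one_div, show ((2 : ℂ)⁻¹) = ((2 : ℕ) : ℂ)⁻¹ by norm_num,
      Complex.cpow_nat_inv_pow _ two_ne_zero, neg_neg]

theorem opSpectrum_boundaryFun {η : ℂ} (hη : η = Complex.I ∨ η = -Complex.I) {ℓ : ℝ}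
    (hℓ : 0 < ℓ) : opSpectrum (bcOp ℓ (boundaryFun η ℓ)) = Complex.ofReal '' Ici (0 : ℝ) := by
  ext z
  constructor
  · intro h
    by_contra hz
    obtain ⟨m, hm, rfl⟩ := exists_neg_sq_eq hz
    obtain ⟨R, hR, -⟩ := exists_resolvent_boundaryFun hη hℓ hm
    exact h ⟨R, hR⟩
  · rintro ⟨t, ht, rfl⟩ ⟨R, hR⟩
    refine not_isResolventAt_sq hℓ (isSolution_boundaryFun hη ℓ) (Real.sqrt t) R ?_
    rwa [← Complex.ofReal_pow, Real.sq_sqrt (mem_Ici.1 ht)]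

/-- There are no square integrable solutions for `z = k² ≥ 0`: a square integrable solution would
be proportional to `J_{ik}(ℓ e^x)`, whose absolute value has a nonzero limit at `-∞`. -/
theorem IsSolution.eq_zero_of_memLp {ℓ : ℝ} (hℓ : 0 < ℓ) {k : ℝ} {u u' : ℝ → ℂ}
    (hu : IsSolution ℓ ((k : ℂ) ^ 2) u u') (hm : MemLp u 2 volume) (x : ℝ) : u x = 0 := by
  set m : ℂ := k * Complex.I with hmdef
  have hmre : m.re = 0 := by simp [hmdef]
  have hmsq : -m ^ 2 = (k : ℂ) ^ 2 := by rw [hmdef, mul_pow, Complex.I_sq]; ring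
  have hj := isSolution_besselJ hℓ m
  rw [hmsq] at hj
  have hlim := tendsto_besselJ_atBot hℓ m
  set j := fun x : ℝ => besselJ m (ℓ * Real.exp x) with hjdef
  set L := ((ℓ / 2 : ℝ) : ℂ) ^ m * (Complex.Gamma (m + 1))⁻¹ with hL
  have hL0 : L ≠ 0 := by
    refine mul_ne_zero ?_ (inv_ne_zero (Complex.Gamma_ne_zero_of_re_pos (by simp [hmre])))
    rw [Ne, Complex.cpow_eq_zero_iff]
    intro h
    have : (ℓ / 2 : ℝ) = 0 := by exact_mod_cast h.1
    linarith
  have hnorm : Tendsto (fun x => ‖j x‖) atBot (𝓝 ‖L‖) := by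
    refine hlim.norm.congr fun x => ?_
    rw [norm_mul, Complex.norm_exp, Complex.re_mul_ofReal, Complex.neg_re, hmre]
    simp [hjdef]
  obtain ⟨x₀, hx₀⟩ : ∃ x₀, j x₀ ≠ 0 := by
    by_contra! h
    simp only [h, norm_zero] at hnorm
    exact hL0 (norm_eq_zero.1 (tendsto_nhds_unique hnorm tendsto_const_nhds))
  obtain ⟨C, -, hC⟩ := besselJ_growth hℓ m
  simp only [hmre, zero_mul, Real.exp_zero, mul_one] at hC
  obtain ⟨c, hc⟩ := hj.exists_eq_mul_of_memLp hx₀ hC hu hm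
  have h1 := (hu.tendsto_atBot hm).1.norm
  have h2 := (hnorm.const_mul ‖c‖).congr fun x => by rw [← norm_mul, ← hc x]
  have h3 := tendsto_nhds_unique h2 h1
  rw [norm_zero, ← norm_mul, norm_eq_zero] at h3
  rw [hc x, (mul_eq_zero.1 h3).resolve_right hL0, zero_mul]

theorem opPointSpectrum_boundaryFun {η : ℂ} (hη : η = Complex.I ∨ η = -Complex.I) {ℓ : ℝ}
    (hℓ : 0 < ℓ) : opPointSpectrum (bcOp ℓ (boundaryFun η ℓ)) = ∅ := by
  refine eq_empty_of_forall_notMem fun z => ?_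
  rintro ⟨f, hf0, hf⟩
  refine hf0 ?_
  by_cases hz : z ∈ Complex.ofReal '' Ici (0 : ℝ)
  · obtain ⟨t, ht, rfl⟩ := hz
    obtain ⟨u, hu, hm, hfu, -⟩ := exists_isSolution_of_eigen f hf
    rw [← Real.sq_sqrt (mem_Ici.1 ht), Complex.ofReal_pow] at hu
    rw [Lp.eq_zero_iff_ae_eq_zero]
    filter_upwards [hfu] with x hx
    rw [hx, hu.eq_zero_of_memLp hℓ hm x, Pi.zero_apply]
  · obtain ⟨m, hm, rfl⟩ := exists_neg_sq_eq hz
    obtain ⟨R, hR, -⟩ := exists_resolvent_boundaryFun hη hℓ hm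
    exact hR.eq_zero_of_eigen f hf

/-! ### Hankel functions -/

theorem hankelPlus_eq {ℓ : ℝ} (hℓ : 0 < ℓ) (m : ℂ) (x : ℝ) :
    (Real.pi : ℂ) * Complex.I / 2 * hankelPlus m (ℓ * Real.exp x) =
      macdonaldExp (-Complex.I) ℓ m x := by
  have hpi : (Real.pi : ℂ) ≠ 0 := by exact_mod_cast Real.pi_ne_zero
  have h1 : (-Complex.I) ^ m * -Complex.I =
      Complex.exp (-(Complex.I * Real.pi / 2 * (m + 1))) := by
    have h2 : -Complex.I = Complex.exp (-(Complex.I * Real.pi / 2)) := by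
      rw [show -(Complex.I * Real.pi / 2) = -Real.pi / 2 * Complex.I by ring,
        Complex.exp_neg_pi_div_two_mul_I]
    rw [Complex.cpow_def_of_ne_zero (neg_ne_zero.2 Complex.I_ne_zero), Complex.log_neg_I]
    nth_rewrite 1 [h2]
    rw [← Complex.exp_add]
    congr 1
    ring
  rw [← cpow_mul_macdonaldK (Or.inr rfl) hℓ, hankelPlus, ← h1]
  generalize macdonaldK m (-Complex.I * ((ℓ * Real.exp x : ℝ) : ℂ)) = K
  linear_combination (-Complex.I ^ 2 * (-Complex.I) ^ m * K) * mul_inv_cancel₀ hpi -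
    ((-Complex.I) ^ m * K) * Complex.I_sq

theorem hankelMinus_eq {ℓ : ℝ} (hℓ : 0 < ℓ) (m : ℂ) (x : ℝ) :
    -((Real.pi : ℂ) * Complex.I / 2) * hankelMinus m (ℓ * Real.exp x) =
      macdonaldExp Complex.I ℓ m x := by
  have hpi : (Real.pi : ℂ) ≠ 0 := by exact_mod_cast Real.pi_ne_zero
  have h1 : Complex.I ^ m * Complex.I =
      Complex.exp (Complex.I * Real.pi / 2 * (m + 1)) := by
    have h2 : Complex.I = Complex.exp (Complex.I * Real.pi / 2) := by
      rw [show Complex.I * Real.pi / 2 = Real.pi / 2 * Complex.I by ring,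
        Complex.exp_pi_div_two_mul_I]
    rw [Complex.cpow_def_of_ne_zero Complex.I_ne_zero, Complex.log_I]
    nth_rewrite 2 [h2]
    rw [← Complex.exp_add]
    congr 1
    ring
  rw [← cpow_mul_macdonaldK (Or.inl rfl) hℓ, hankelMinus, ← h1]
  generalize macdonaldK m (Complex.I * ((ℓ * Real.exp x : ℝ) : ℂ)) = K
  linear_combination (-Complex.I ^ 2 * Complex.I ^ m * K) * mul_inv_cancel₀ hpi -
    (Complex.I ^ m * K) * Complex.I_sq

theorem opZero_eq {ℓ : ℝ} (hℓ : 0 < ℓ) : opZero ℓ = bcOp ℓ (boundaryFun (-Complex.I) ℓ) := by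
  obtain ⟨c, hc, h⟩ := exists_macdonaldExp_half (-Complex.I) hℓ
  have hpi : (Real.pi : ℂ) * Complex.I / 2 ≠ 0 := by simp [Real.pi_ne_zero]
  rw [opZero, ← bcOp_const_mul ℓ hpi, ← bcOp_const_mul ℓ hc (boundaryFun (-Complex.I) ℓ)]
  congr 1
  funext x
  rw [hankelPlus_eq hℓ, h]

theorem opInfty_eq {ℓ : ℝ} (hℓ : 0 < ℓ) : opInfty ℓ = bcOp ℓ (boundaryFun Complex.I ℓ) := by
  obtain ⟨c, hc, h⟩ := exists_macdonaldExp_half Complex.I hℓ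
  have hpi : -((Real.pi : ℂ) * Complex.I / 2) ≠ 0 := by simp [Real.pi_ne_zero]
  rw [opInfty, ← bcOp_const_mul ℓ hpi, ← bcOp_const_mul ℓ hc (boundaryFun Complex.I ℓ)]
  congr 1
  funext x
  rw [hankelMinus_eq hℓ, h]

end NegExp

end

theorem mainTheorem6 (ℓ : ℝ) (hℓ : 0 < ℓ) :
    (NegExp.IsClosedRealization ℓ (NegExp.opZero ℓ) ∧
      NegExp.IsClosedRealization ℓ (NegExp.opInfty ℓ) ∧
      NegExp.opZero ℓ ≠ NegExp.opInfty ℓ) ∧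
    (NegExp.opSpectrum (NegExp.opZero ℓ) = Complex.ofReal '' Set.Ici (0 : ℝ) ∧
      NegExp.opSpectrum (NegExp.opInfty ℓ) = Complex.ofReal '' Set.Ici (0 : ℝ)) ∧
    (NegExp.opPointSpectrum (NegExp.opZero ℓ) = ∅ ∧
      NegExp.opPointSpectrum (NegExp.opInfty ℓ) = ∅) ∧
    (∀ m : ℂ, 0 < m.re →
      (∃ R : NegExp.L2R →L[ℂ] NegExp.L2R,
        NegExp.IsResolventAt (NegExp.opZero ℓ) (-m ^ 2) R ∧
        NegExp.HasIntegralKernel R (fun x y =>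
          (Real.pi : ℂ) * Complex.I / 2 *
            (NegExp.besselJ m (ℓ * Real.exp (min x y)) *
              NegExp.hankelPlus m (ℓ * Real.exp (max x y))))) ∧
      (∃ R : NegExp.L2R →L[ℂ] NegExp.L2R,
        NegExp.IsResolventAt (NegExp.opInfty ℓ) (-m ^ 2) R ∧
        NegExp.HasIntegralKernel R (fun x y =>
          -((Real.pi : ℂ) * Complex.I / 2) *
            (NegExp.besselJ m (ℓ * Real.exp (min x y)) *
              NegExp.hankelMinus m (ℓ * Real.exp (max x y)))))) := by
  have hI : Complex.I = Complex.I ∨ Complex.I = -Complex.I := Or.inl rfl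
  have hI' : -Complex.I = Complex.I ∨ -Complex.I = -Complex.I := Or.inr rfl
  have hne := NegExp.bcOp_boundaryFun_ne hI' hℓ
  rw [neg_neg] at hne
  simp only [NegExp.opZero_eq hℓ, NegExp.opInfty_eq hℓ]
  refine ⟨⟨NegExp.isClosedRealization_boundaryFun hI' hℓ,
    NegExp.isClosedRealization_boundaryFun hI hℓ, hne⟩,
    ⟨NegExp.opSpectrum_boundaryFun hI' hℓ, NegExp.opSpectrum_boundaryFun hI hℓ⟩,
    ⟨NegExp.opPointSpectrum_boundaryFun hI' hℓ, NegExp.opPointSpectrum_boundaryFun hI hℓ⟩,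
    fun m hm => ⟨?_, ?_⟩⟩
  · obtain ⟨R, hR, hk⟩ := NegExp.exists_resolvent_boundaryFun hI' hℓ hm
    refine ⟨R, hR, ?_⟩
    convert hk using 3 with x y
    rw [NegExp.greenKernel, ← NegExp.hankelPlus_eq hℓ]
    ring
  · obtain ⟨R, hR, hk⟩ := NegExp.exists_resolvent_boundaryFun hI hℓ hm
    refine ⟨R, hR, ?_⟩
    convert hk using 3 with x y
    rw [NegExp.greenKernel, ← NegExp.hankelMinus_eq hℓ]
    ring
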